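/- **Setting.** Let $\mathbb T=\mathbb R/2\pi\mathbb Z$. Let $X=X^s(\mathbb T)$ and $Y=X^t(\mathbb T)$ be real Banach spaces of real functions on $\mathbb T$, continuously embedded in $L^2(\mathbb T)$. Assume that if some element of the space has a nonzero $k$-th Fourier coefficient, then $\cos kx$ and $\sin kx$ belong to the space, and that $X$ and $Y$ contain the same modes; let $\Lambda\subset\mathbb Z$ be the set of all $k$ with $\cos kx,\sin kx\in X$ (for instance $\Lambda=\mathbb Z$, or $\Lambda=\mathbb Z\setminus\{0\}$ for functions of zero mean). Let $M\subset\mathbb R^d$ be open and consider $$F(\mu,u)=L(\mu)u+N(\mu,u)=0,\qquad \mu\in M,\ u\in X,\ F(\mu,u)\in Y,$$ under the following assumptions for every $\mu\in M$. 1. $L(\mu):X\to Y$ is a bounded Fredholm operator of index $0$ and a Fourier multiplier, $\widehat{L(\mu)u}(k)=l_\mu(k)\hat u(k)$, with $l_\mu(-k)=l_\mu(k)$ for $k\in\Lambda$. 2. $N(\mu,u)=\sum_{m\ge2}N_m(\mu,(u,\dots,u))$ for all $u$ near $0$, where each $N_m(\mu,\cdot):X^m\to Y$ is $m$-linear, its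 complex-multilinear extension satisfies $N_m(\mu,(e^{i\kappa_1x},\dots,e^{i\kappa_mx}))=n_{m,\mu}(\kappa_1,\dots,\kappa_m)e^{i(\kappa_1+\dots+\kappa_m)x}$, and $n_{m,\mu}(-\kappa_1,\dots,-\kappa_m)=n_{m,\mu}(\kappa_1,\dots,\kappa_m)$, for $\kappa_j\in\Lambda$. 3. There is a real functional $\mathcal J_\mu$ with $D_u\mathcal J_\mu(u)w=\int_{\mathbb T}F(\mu,u)\,w\,dx$ for all $u$ near $0$ and all $w\in X$. 4. $F$ is real analytic, jointly in its two arguments, near $(\mu,0)$. Put $K_\mu=\{k\in\Lambda: l_\mu(k)=0\}$ and fix $\mu_0\in M$. A function $f$ on $\mathbb T$ is *symmetric* if $x\mapsto f(x+a)$ is even for some $a$, and *asymmetric* otherwise. For distinct positive integers $k_1,k_2$ with $K_{\mu_0}=\{\pm k_1,\pm k_2\}$ and $\alpha,\gamma\in\mathbb N_0^2$, let $k_{\alpha,\gamma}=(\alpha_1-\gamma_1)k_1+(\alpha_2-\gamma_2)k_2$, let $\ell_\mu(k)=0$ for $k\in K_{\mu_0}$ and $\ell_\mu(k)=1/l_\mu(k)$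 otherwise (with the convention $1/0=0$), and define recursively $\hat u_{0,0}=0$, $\hat u_{\alpha,\gamma}=\tfrac12$ if $|\alpha|+|\gamma|=1$, and $$\hat n_{\alpha,\gamma}(\mu)=\sum_{m=2}^{|\alpha|+|\gamma|}\ \sum_{\substack{\alpha^{(1)}+\dots+\alpha^{(m)}=\alpha\\ \gamma^{(1)}+\dots+\gamma^{(m)}=\gamma}} n_{m,\mu}(k_{\alpha^{(1)},\gamma^{(1)}},\dots,k_{\alpha^{(m)},\gamma^{(m)}})\prod_{i=1}^m\hat u_{\alpha^{(i)},\gamma^{(i)}}(\mu),$$ $$\hat u_{\alpha,\gamma}(\mu)=-\ell_\mu(k_{\alpha,\gamma})\,\hat n_{\alpha,\gamma}(\mu)\quad\text{if }|\alpha|+|\gamma|\ge2 .$$ (Terms containing a wavenumber outside $\Lambda$ contribute $0$.) **Theorem.** (a) Suppose that $|K_{\mu_0}|=0$, or $|K_{\mu_0}|=2$, or $K_{\mu_0}=\{\pm k_1,\pm k_2\}$ with distinct coprime positive integers $k_1,k_2$ and $\hat n_{(0,k_1),(k_2-1,0)}(\mu_0)\ne0$. Then there is $\varepsilon>0$ such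 that no $u\in X$ with $\|u\|<\varepsilon$ is an asymmetric solution of $F(\mu,u)=0$ for any $\mu\in M$ with $|\mu-\mu_0|<\varepsilon$. (b) Suppose that $d\ge3$, that $K_{\mu_0}=\{\pm k_1,\pm k_2\}$ with distinct coprime positive integers $k_1,k_2$, that $\hat n_{(0,k_1),(k_2-1,0)}(\mu_0)=0$, and that $$\left.\det\frac{\partial\big(l_\mu(k_1),\,l_\mu(k_2),\,\hat n_{(0,k_1),(k_2-1,0)}(\mu)\big)}{\partial(\mu_1,\mu_2,\mu_3)}\right|_{\mu=\mu_0}\ne0 .$$ Then there are $\varepsilon>0$ and an analytic map $(r,\theta)\mapsto(u,\mu)\in X\times M$, defined for $r,\theta\in\mathbb R^2$ with $|r|<\varepsilon$, all of whose values satisfy $F(\mu,u)=0$, such that $$u=r_1\cos(k_1(x+\theta_1))+r_2\cos(k_2(x+\theta_2))+\mathcal O(|r|^2)\ \text{ in }X,\qquad \mu=\mu_0+\mathcal O(|r|^2),$$ uniformly in $\theta$. The solution $u$ is asymmetric if and only if $r_1r_2\neq0$ and $k_1k_2(\theta_1-\theta_2)\notin\pi\mathbb Z$. The map parametrizes a manifold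 of solutions: it is an immersion where $r_1r_2\ne0$, and two points $(r,\theta)$, $(r',\theta')$ with all $r_i,r_i'>0$ have the same image if and only if $r=r'$ and $k_i(\theta_i-\theta_i')\in2\pi\mathbb Z$ for $i=1,2$. -/

import Mathlib

open MeasureTheory Filter Topology

noncomputable section

/-- The circle `ℝ / 2πℤ`; functions on it are the `2π`-periodic functions on `ℝ`. -/
abbrev Torus : Type := AddCircle (2 * Real.pi)

instance instFactTwoPiPos : Fact (0 < 2 * Real.pi) := ⟨Real.two_pi_pos⟩

/-- The function `x ↦ cos (k x)` on the circle. -/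
def cosMode (k : ℤ) (x : Torus) : ℝ := (fourier k x).re

/-- The function `x ↦ sin (k x)` on the circle. -/
def sinMode (k : ℤ) (x : Torus) : ℝ := (fourier k x).im

theorem fourier_torus_coe (k : ℤ) (x : ℝ) :
    fourier k (x : Torus) = Complex.exp ((((k : ℝ) * x : ℝ) : ℂ) * Complex.I) := by
  rw [fourier_coe_apply]
  congr 1
  have h : (Real.pi : ℂ) ≠ 0 := by exact_mod_cast Real.pi_ne_zero
  push_cast
  field_simp

theorem cosMode_coe (k : ℤ) (x : ℝ) : cosMode k (x : Torus) = Real.cos (k * x) := by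
  rw [cosMode, fourier_torus_coe, Complex.exp_ofReal_mul_I_re]

theorem sinMode_coe (k : ℤ) (x : ℝ) : sinMode k (x : Torus) = Real.sin (k * x) := by
  rw [sinMode, fourier_torus_coe, Complex.exp_ofReal_mul_I_im]

/-- A periodic function is symmetric if one of its translates `x ↦ f (x + a)` is even. Elements of
the function spaces below are classes of functions modulo null sets, hence "almost every". -/
def IsSymmetric (f : Torus → ℝ) : Prop :=
  ∃ a : Torus, ∀ᵐ x : Torus, f (x + a) = f (-x + a)

/-- A function is asymmetric if it is not symmetric. -/
def IsAsymmetric (f : Torus → ℝ) : Prop := ¬ IsSymmetric f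

/-! ### Function spaces -/

/-- A normed space `X` of real functions on the circle: it embeds continuously in `L²`, and
whenever some element of `X` has a nonzero `k`-th Fourier coefficient, then `cos (k x)` and
`sin (k x)` belong to `X`. (Spaces of zero-mean functions are allowed: they do not contain the
mode `k = 0`.) Completeness is a separate assumption. -/
class PeriodicSpace (X : Type*) [NormedAddCommGroup X] [NormedSpace ℝ X] where
  toL2 : X →L[ℝ] Lp ℝ 2 (volume : Measure Torus)
  toL2_injective : Function.Injective toL2
  exists_mode : ∀ (u : X) (k : ℤ), fourierCoeff (fun x => ((toL2 u x : ℝ) : ℂ)) k ≠ 0 →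
    (∃ c : X, ∀ᵐ x : Torus, toL2 c x = cosMode k x) ∧
      ∃ s : X, ∀ᵐ x : Torus, toL2 s x = sinMode k x

section Spaces

variable {X : Type*} [NormedAddCommGroup X] [NormedSpace ℝ X] [PeriodicSpace X]

/-- The function (defined up to a null set) given by an element of `X`. -/
def asFun (u : X) : Torus → ℝ := fun x => PeriodicSpace.toL2 u x

/-- The element `u` of `X` is the function `f`. -/
def Represents (u : X) (f : Torus → ℝ) : Prop := ∀ᵐ x : Torus, asFun u x = f x

/-- The `k`-th Fourier coefficient of an element of `X`. -/
def coeff (u : X) (k : ℤ) : ℂ := fourierCoeff (fun x => ((asFun u x : ℝ) : ℂ)) k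

variable (X) in
/-- The wavenumbers `k` whose mode `e^{ikx}` lies in (the complexification of) `X`. -/
def modes : Set ℤ :=
  {k | (∃ c : X, Represents c (cosMode k)) ∧ ∃ s : X, Represents s (sinMode k)}

end Spaces

/-! ### The class of equations -/

/-- The parameter space `ℝ^d`. -/
abbrev Param (d : ℕ) : Type := EuclideanSpace ℝ (Fin d)

section Equations

variable (d : ℕ) (X Y : Type*) [NormedAddCommGroup X] [NormedSpace ℝ X] [PeriodicSpace X]
  [NormedAddCommGroup Y] [NormedSpace ℝ Y] [PeriodicSpace Y]

/-- The data of an equation `L(μ)u + N(μ,u) = 0`, with `μ` in a set `M` of parameters: the linear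
part and its symbol `l_μ(k)`, the nonlinear part with its `m`-linear terms `N_m(μ,·)` and their
symbols `n_{m,μ}(k_1,…,k_m)`. -/
structure PeriodicEquation where
  M : Set (Param d)
  L : Param d → X →L[ℝ] Y
  l : Param d → ℤ → ℝ
  N : Param d → X → Y
  Nterm : (m : ℕ) → Param d → MultilinearMap ℝ (fun _ : Fin m => X) Y
  n : (m : ℕ) → Param d → (Fin m → ℤ) → ℝ

namespace PeriodicEquation

variable {d X Y} (E : PeriodicEquation d X Y)

/-- The map `F(μ,u) = L(μ)u + N(μ,u)`. -/
def F (μ : Param d) (u : X) : Y := E.L μ u + E.N μ u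

/-- `L(μ)` is Fredholm of index `0`, and it is a Fourier multiplier with an even symbol. -/
def FredholmMultiplier : Prop :=
  ∀ μ ∈ E.M,
    (E.L μ).IsFredholm ∧
    Module.finrank ℝ (E.L μ).ker = Module.finrank ℝ (Y ⧸ (E.L μ).range) ∧
    (∀ (u : X) (k : ℤ), coeff (E.L μ u) k = (E.l μ k : ℂ) * coeff u k) ∧
    ∀ k ∈ modes X, E.l μ (-k) = E.l μ k

/-- The complex-multilinear extension of `T` evaluated at `(a_1 + i b_1, …, a_m + i b_m)`,
as a complex function on the circle. -/
def complexEval {m : ℕ} (T : MultilinearMap ℝ (fun _ : Fin m => X) Y) (a b : Fin m → X) :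
    Torus → ℂ :=
  fun x => ∑ S : Finset (Fin m), Complex.I ^ S.card * ((asFun (T (S.piecewise b a)) x : ℝ) : ℂ)

/-- `N(μ,u) = ∑_{m ≥ 2} N_m(μ,(u,…,u))` for small `u`, where
`N_m(μ,(e^{ik_1x},…,e^{ik_mx})) = n_{m,μ}(k_1,…,k_m) e^{i(k_1+⋯+k_m)x}` and
`n_{m,μ}(-k_1,…,-k_m) = n_{m,μ}(k_1,…,k_m)`. -/
def MultilinearFourierSeries : Prop :=
  ∀ μ ∈ E.M,
    (∀ᶠ u : X in 𝓝 0, HasSum (fun j : ℕ => E.Nterm (j + 2) μ (fun _ => u)) (E.N μ u)) ∧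
    (∀ m : ℕ, 2 ≤ m → ∀ κ : Fin m → ℤ, ∀ c s : Fin m → X,
      (∀ j, Represents (c j) (cosMode (κ j))) → (∀ j, Represents (s j) (sinMode (κ j))) →
      ∀ᵐ x : Torus, complexEval (E.Nterm m μ) c s x = (E.n m μ κ : ℂ) * fourier (∑ j, κ j) x) ∧
    ∀ m : ℕ, 2 ≤ m → ∀ κ : Fin m → ℤ, (∀ j, κ j ∈ modes X) →
      E.n m μ (fun j => -κ j) = E.n m μ κ

/-- For each `μ` there is a functional `J_μ`, defined for small `u`, with
`D_u J_μ(u) w = ∫ (L(μ)u + N(μ,u)) w dx`. -/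
def Variational : Prop :=
  ∀ μ ∈ E.M, ∃ J : X → ℝ, ∀ᶠ u : X in 𝓝 0, ∃ J' : X →L[ℝ] ℝ, HasFDerivAt J J' u ∧
    ∀ w : X, J' w = ∫ x : Torus, asFun (E.F μ u) x * asFun w x

/-- `F` is real analytic near every `(μ,0)` with `μ ∈ M`. -/
def Analytic : Prop :=
  ∀ μ ∈ E.M, AnalyticAt ℝ (fun p : Param d × X => E.F p.1 p.2) (μ, 0)

/-- The set `K_μ` of wavenumbers with `L(μ) e^{ikx} = 0`. -/
def kernelSet (μ : Param d) : Set ℤ := {k | k ∈ modes X ∧ E.l μ k = 0}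

/-! ### The resonant coefficients

A pair `p = (α, γ)` consists of two multi-indices in `ℕ²`. The functions are expanded in the
monomials `r^{α+γ} E^{α-γ}`, where `E = (e^{ik_1(x+θ_1)}, e^{ik_2(x+θ_2)})`. -/

/-- Pairs `(α, γ)` of multi-indices in `ℕ²`. -/
abbrev Index : Type := (ℕ × ℕ) × (ℕ × ℕ)

/-- `|α| + |γ|`. -/
def size (p : Index) : ℕ := p.1.1 + p.1.2 + p.2.1 + p.2.2

/-- `k_{α,γ} = (α_1 - γ_1) k_1 + (α_2 - γ_2) k_2`. -/
def freq (k₁ k₂ : ℤ) (p : Index) : ℤ :=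
  ((p.1.1 : ℤ) - p.2.1) * k₁ + ((p.1.2 : ℤ) - p.2.2) * k₂

/-- The ordered `m`-tuples of pairs of multi-indices with sum `p`. -/
def decompositions (m : ℕ) (p : Index) : Finset (Fin m → Index) :=
  (Fintype.piFinset fun _ => Finset.Iic p).filter fun q => ∑ i, q i = p

open Classical in
/-- The symbol of `L(μ)⁻¹ P_W`: it is `1 / l_μ(k)` off `K_{μ₀}` and `0` on `K_{μ₀}`. -/
def ell (μ₀ μ : Param d) (k : ℤ) : ℝ :=
  if k ∈ E.kernelSet μ₀ then 0 else (E.l μ k)⁻¹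

/-- The coefficients `û_{α,γ}(μ)` in `u = ∑ û_{α,γ} r^{α+γ} E^{α-γ}`, where `u = v + w`,
`v = r_1 cos(k_1(x+θ_1)) + r_2 cos(k_2(x+θ_2))` and `w = -L(μ)⁻¹ P_W N(μ, v + w)`.
Only terms whose parts are all smaller than `p` occur, since `û_{0,0} = 0`; see `uhat_eq`. -/
def uhat (μ₀ : Param d) (k₁ k₂ : ℤ) (μ : Param d) (p : Index) : ℝ :=
  if size p = 0 then 0
  else if size p = 1 then 1 / 2
  else -(E.ell μ₀ μ (freq k₁ k₂ p) *
    ∑ m ∈ Finset.Icc 2 (size p), ∑ q ∈ decompositions m p,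
      E.n m μ (fun i => freq k₁ k₂ (q i)) *
        ∏ i, if _h : size (q i) < size p then uhat μ₀ k₁ k₂ μ (q i) else 0)
termination_by size p

/-- The coefficients `n̂_{α,γ}(μ)` in `N(μ,u) = ∑ n̂_{α,γ} r^{α+γ} E^{α-γ}`. -/
def nhat (μ₀ : Param d) (k₁ k₂ : ℤ) (μ : Param d) (p : Index) : ℝ :=
  ∑ m ∈ Finset.Icc 2 (size p), ∑ q ∈ decompositions m p,
    E.n m μ (fun i => freq k₁ k₂ (q i)) * ∏ i, E.uhat μ₀ k₁ k₂ μ (q i)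

theorem size_sum {m : ℕ} (q : Fin m → Index) : size (∑ i, q i) = ∑ i, size (q i) := by
  simp only [size, Prod.fst_sum, Prod.snd_sum, Finset.sum_add_distrib]

/-- The recursion for `û` without the size restriction. -/
theorem uhat_eq (μ₀ : Param d) (k₁ k₂ : ℤ) (μ : Param d) (p : Index) (hp : 2 ≤ size p) :
    E.uhat μ₀ k₁ k₂ μ p = -(E.ell μ₀ μ (freq k₁ k₂ p) * E.nhat μ₀ k₁ k₂ μ p) := by
  rw [uhat, if_neg (by omega), if_neg (by omega), nhat]
  congr 2
  refine Finset.sum_congr rfl fun m hm => Finset.sum_congr rfl fun q hq => ?_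
  congr 1
  have hsum : ∑ i, size (q i) = size p := by
    rw [← size_sum, (Finset.mem_filter.mp hq).2]
  by_cases hall : ∀ i, size (q i) < size p
  · exact Finset.prod_congr rfl fun i _ => by rw [dif_pos (hall i)]
  · push Not at hall
    obtain ⟨i, hi⟩ := hall
    have h2 : 2 ≤ m := (Finset.mem_Icc.mp hm).1
    have : Nontrivial (Fin m) := Fin.nontrivial_iff_two_le.mpr h2
    obtain ⟨j, hj⟩ := exists_ne i
    have hle : size (q i) + size (q j) ≤ ∑ i, size (q i) := by
      rw [← Finset.sum_pair (f := fun t => size (q t)) hj.symm]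
      exact Finset.sum_le_sum_of_subset (Finset.subset_univ _)
    have hj0 : size (q j) = 0 := by omega
    rw [Finset.prod_eq_zero (Finset.mem_univ i) (dif_neg (by omega)),
      Finset.prod_eq_zero (Finset.mem_univ j) (by rw [uhat, if_pos hj0])]

/-- The resonant coefficient `n̂_{(0,k_1),(k_2-1,0)}(μ)`. -/
def resonant (μ₀ : Param d) (k₁ k₂ : ℕ) (μ : Param d) : ℝ :=
  E.nhat μ₀ k₁ k₂ μ ((0, k₁), (k₂ - 1, 0))

/-- The Jacobian determinant of `(l_μ(k_1), l_μ(k_2), n̂_{(0,k_1),(k_2-1,0)}(μ))` with respect to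
the first three parameters `(μ_1, μ_2, μ_3)`, at `μ = μ₀`. -/
def jacobian (hd : 3 ≤ d) (μ₀ : Param d) (k₁ k₂ : ℕ) : ℝ :=
  Matrix.det (Matrix.of fun i j : Fin 3 =>
    fderiv ℝ ((![fun μ => E.l μ k₁, fun μ => E.l μ k₂, E.resonant μ₀ k₁ k₂] :
      Fin 3 → Param d → ℝ) i) μ₀ (EuclideanSpace.single (Fin.castLE hd j) 1))

/-- There are no small asymmetric solutions for `μ` near `μ₀`. -/
def NoSmallAsymmetricSolutions (μ₀ : Param d) : Prop :=
  ∃ ε > 0, ∀ μ ∈ E.M, ‖μ - μ₀‖ < ε → ∀ u : X, ‖u‖ < ε → E.F μ u = 0 →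
    ¬ IsAsymmetric (asFun u)

end PeriodicEquation

end Equations

/-- The function `r_1 cos(k_1(x+θ_1)) + r_2 cos(k_2(x+θ_2))`, with `p = (r, θ)`. -/
def twoModes (k₁ k₂ : ℤ) (p : (ℝ × ℝ) × (ℝ × ℝ)) (x : Torus) : ℝ :=
  p.1.1 * cosMode k₁ (x + (p.2.1 : Torus)) + p.1.2 * cosMode k₂ (x + (p.2.2 : Torus))

end

/-! The equation is reduced to finitely many amplitudes, and the symmetries of the reduced equation
are strong enough to decide both parts.

Lyapunov-Schmidt: replacing the modes of `F` in the kernel set `K` by the modes of `u` gives the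
`augmented` map, whose linearization at `(μ₀, 0)` is bijective (`bijective_augmentedL`; index zero
is needed here). A small solution is therefore an analytic function `reducedSol` of `μ` and of the
complex amplitudes `z = (z₁, z₂)` of the modes `k₁, k₂`, and what remains is the vanishing of the
Fourier coefficients `f₁, f₂` of `F` at `k₁, k₂`. Neither space is assumed to be invariant under
translations or reflections, so equivariance cannot be obtained by acting on the equation. Instead
the Taylor coefficients of the reduction along rays are computed: they are the numbers `û` and `n̂`,
real and attached to the right frequencies. Analyticity along segments then gives `f₁(μ, rotate z) =
e^{ik₁a} f₁(μ, z)` and `f₁(μ, z̄) = conj f₁(μ, z)`.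

Invariant theory: because `k₁, k₂` are coprime, these two symmetries force `f₁ = A₁ z₁ + B₁
z̄₁^{k₂-1} z₂^{k₁}`, where `A₁, B₁` are real-valued and analytic in `μ` and in the invariants
`|z₁|²`, `|z₂|²`, `ζ = z₁^{k₂} z̄₂^{k₁}` (`exists_equivariant_decomposition`). At zero amplitude `A₁
= l_μ(k₁)/2`, and `B₁` is the resonant coefficient `n̂`. The analogous formula holds for `f₂`. A
reduced solution is symmetric exactly when `Im ζ = 0`, since then, by Bézout, one translation makes
both amplitudes real.

Part (a): `Im(z̄₁ f₁) = -B₁ Im ζ`, so if `B₁` does not vanish at `(μ₀, 0)`, every small solution has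
`Im ζ = 0`. With a single pair of modes the one phase can always be rotated away, and with an empty
kernel only `u = 0` remains.

Part (b): a functional with gradient `F` returns to its initial value along the closed orbit of
rotated amplitudes, whence `k₁ Im(f₁ z̄₁) + k₂ Im(f₂ z̄₂) = 0`, that is, `(k₁B₁ - k₂B₂) Im ζ = 0`.
The points with `Im ζ ≠ 0` are dense, so `k₁B₁ = k₂B₂`. The four real equations thus follow from the
three equations `A₁ = A₂ = B₁ = 0`, which the Jacobian condition solves for three parameters as
functions of the invariants. All small `z` are then amplitudes of solutions, and `z_j = r_j
e^{ik_jθ_j}` is the required parametrization. -/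

open scoped ComplexConjugate

set_option linter.unusedSectionVars false

/-! ### Fourier coefficients on the circle and in the function spaces -/

theorem ae_haar_iff_ae_volume {p : Torus → Prop} :
    (∀ᵐ x ∂(AddCircle.haarAddCircle : Measure Torus), p x) ↔ ∀ᵐ x : Torus, p x := by
  rw [AddCircle.volume_eq_smul_haarAddCircle,
    Measure.ae_ennreal_smul_measure_iff (by simpa using Real.pi_pos)]

/-- A square integrable function on the circle is determined by its Fourier coefficients. -/
theorem ae_eq_of_fourierCoeff_eq {f g : Torus → ℂ} (hf : MemLp f 2 volume)
    (hg : MemLp g 2 volume) (h : ∀ k, fourierCoeff f k = fourierCoeff g k) :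
    ∀ᵐ x : Torus, f x = g x := by
  rw [← ae_haar_iff_ae_volume]
  have hf' := hf.haarAddCircle
  have hg' := hg.haarAddCircle
  have key : hf'.toLp f = hg'.toLp g := by
    refine (hasSum_fourier_series_L2 _).unique ?_
    convert hasSum_fourier_series_L2 (hg'.toLp g) using 3 with i
    rw [fourierCoeff_congr_ae hf'.coeFn_toLp, fourierCoeff_congr_ae hg'.coeFn_toLp, h]
  have := (MemLp.toLp_eq_toLp_iff hf' hg').1 key
  exact this

/-- Fourier coefficients of a translate. -/
theorem fourierCoeff_comp_add (f : Torus → ℂ) (a : Torus) (k : ℤ) :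
    fourierCoeff (fun x => f (x + a)) k = fourier k a * fourierCoeff f k := by
  rw [fourierCoeff, fourierCoeff, ← integral_const_mul]
  have := integral_add_right_eq_self (μ := (AddCircle.haarAddCircle : Measure Torus))
    (fun x => fourier k a * (fourier (-k) x • f x)) a
  rw [← this]
  refine integral_congr_ae (ae_of_all _ fun x => ?_)
  have h : fourier k a * fourier (-k) (x + a) = fourier (-k) x := by
    rw [fourier_neg, fourier_neg, fourier_apply, fourier_apply, fourier_apply, smul_add,
      AddCircle.toCircle_add, Circle.coe_mul, map_mul, mul_comm ((starRingEnd ℂ) _), ← mul_assoc,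
      Complex.mul_conj, Circle.normSq_coe]
    simp
  simp only [smul_eq_mul]
  rw [← h]; ring

theorem fourierCoeff_comp_neg (f : Torus → ℂ) (k : ℤ) :
    fourierCoeff (fun x => f (-x)) k = fourierCoeff f (-k) := by
  rw [fourierCoeff, fourierCoeff]
  have := integral_neg_eq_self (μ := (AddCircle.haarAddCircle : Measure Torus))
    (fun x => fourier (- -k) x • f x)
  rw [← this]
  refine integral_congr_ae (ae_of_all _ fun x => ?_)
  simp only [fourier_apply, neg_neg, smul_neg, neg_smul]

theorem fourierCoeff_ofReal_neg (f : Torus → ℝ) (k : ℤ) :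
    fourierCoeff (fun x => (f x : ℂ)) (-k) = conj (fourierCoeff (fun x => (f x : ℂ)) k) := by
  rw [fourierCoeff, fourierCoeff, ← integral_conj]
  refine integral_congr_ae (ae_of_all _ fun x => ?_)
  simp only [smul_eq_mul, map_mul, Complex.conj_ofReal]
  rw [← fourier_neg]

theorem cosMode_ofReal (k : ℤ) (x : Torus) :
    (cosMode k x : ℂ) = (fourier k x + fourier (-k) x) / 2 := by
  rw [cosMode, fourier_neg, Complex.re_eq_add_conj]

theorem sinMode_ofReal (k : ℤ) (x : Torus) :
    (sinMode k x : ℂ) = (fourier k x - fourier (-k) x) / (2 * Complex.I) := by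
  rw [sinMode, fourier_neg, Complex.im_eq_sub_conj]

theorem cosMode_neg (k : ℤ) (x : Torus) : cosMode (-k) x = cosMode k x := by
  rw [cosMode, cosMode, fourier_neg, Complex.conj_re]

theorem sinMode_neg (k : ℤ) (x : Torus) : sinMode (-k) x = -sinMode k x := by
  rw [sinMode, sinMode, fourier_neg, Complex.conj_im]

theorem integrable_fourier (k : ℤ) :
    Integrable (fun x => (fourier k x : ℂ)) (AddCircle.haarAddCircle : Measure Torus) :=
  (map_continuous (fourier k)).integrable_of_hasCompactSupport
    (HasCompactSupport.of_compactSpace _)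

theorem fourierCoeff_fourier_apply (k m : ℤ) :
    fourierCoeff (fun x : Torus => (fourier k x : ℂ)) m = if m = k then 1 else 0 := by
  have := congrFun (fourierCoeff_fourier (T := 2 * Real.pi) k) m
  rw [Pi.single_apply] at this
  exact this

theorem fourierCoeff_cosMode (k m : ℤ) :
    fourierCoeff (fun x => (cosMode k x : ℂ)) m =
      (if m = k then 1 / 2 else 0) + if m = -k then 1 / 2 else 0 := by
  have h : (fun x => (cosMode k x : ℂ)) =
      ((1 / 2 : ℂ) • fun x : Torus => (fourier k x : ℂ)) +
        ((1 / 2 : ℂ) • fun x : Torus => (fourier (-k) x : ℂ)) := by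
    funext x
    simp only [cosMode_ofReal, Pi.add_apply, Pi.smul_apply, smul_eq_mul]
    ring
  rw [h, fourierCoeff.add ((integrable_fourier k).smul _) ((integrable_fourier _).smul _),
    Pi.add_apply, fourierCoeff.const_smul, fourierCoeff.const_smul, fourierCoeff_fourier_apply,
    fourierCoeff_fourier_apply]
  simp

theorem fourierCoeff_sinMode (k m : ℤ) :
    fourierCoeff (fun x => (sinMode k x : ℂ)) m =
      (if m = k then -Complex.I / 2 else 0) + if m = -k then Complex.I / 2 else 0 := by
  have h : (fun x => (sinMode k x : ℂ)) =
      ((-Complex.I / 2 : ℂ) • fun x : Torus => (fourier k x : ℂ)) +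
        ((Complex.I / 2 : ℂ) • fun x : Torus => (fourier (-k) x : ℂ)) := by
    funext x
    simp only [sinMode_ofReal, Pi.add_apply, Pi.smul_apply, smul_eq_mul]
    field_simp
    rw [Complex.I_sq]
    ring
  rw [h, fourierCoeff.add ((integrable_fourier k).smul _) ((integrable_fourier _).smul _),
    Pi.add_apply, fourierCoeff.const_smul, fourierCoeff.const_smul, fourierCoeff_fourier_apply,
    fourierCoeff_fourier_apply]
  simp

section Coefficients

variable {X : Type*} [NormedAddCommGroup X] [NormedSpace ℝ X] [PeriodicSpace X]

theorem asFun_memLp (u : X) : MemLp (asFun u) 2 volume := Lp.memLp _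

theorem asFun_ofReal_memLp (u : X) : MemLp (fun x => (asFun u x : ℂ)) 2 volume :=
  (asFun_memLp u).ofReal

theorem asFun_ofReal_integrable (u : X) :
    Integrable (fun x => (asFun u x : ℂ)) AddCircle.haarAddCircle :=
  (asFun_ofReal_memLp u).haarAddCircle.integrable (by norm_num)

theorem asFun_add (u v : X) : ∀ᵐ x : Torus, asFun (u + v) x = asFun u x + asFun v x := by
  simp only [asFun, map_add]
  exact Lp.coeFn_add _ _

theorem asFun_smul (c : ℝ) (u : X) : ∀ᵐ x : Torus, asFun (c • u) x = c * asFun u x := by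
  simp only [asFun, map_smul]
  exact Lp.coeFn_smul _ _

theorem coeff_eq_of_represents {u : X} {f : Torus → ℝ} (h : Represents u f) (k : ℤ) :
    coeff u k = fourierCoeff (fun x => (f x : ℂ)) k := by
  rw [coeff]
  refine congrFun (fourierCoeff_congr_ae ?_) k
  have := ae_haar_iff_ae_volume.2 h
  filter_upwards [this] with x hx
  rw [hx]

theorem coeff_add (u v : X) (k : ℤ) : coeff (u + v) k = coeff u k + coeff v k := by
  rw [coeff_eq_of_represents (asFun_add u v), coeff, coeff, ← Pi.add_apply, ← fourierCoeff.add
    (asFun_ofReal_integrable u) (asFun_ofReal_integrable v)]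
  simp [Pi.add_def]

theorem coeff_smul (c : ℝ) (u : X) (k : ℤ) : coeff (c • u) k = c * coeff u k := by
  rw [coeff_eq_of_represents (asFun_smul c u), coeff, ← fourierCoeff.const_mul]
  simp

theorem norm_coeff_le (k : ℤ) : ∃ C : ℝ, ∀ u : X, ‖coeff u k‖ ≤ C * ‖u‖ := by
  have h1 : ∀ u : X, ‖coeff u k‖ ≤ ‖PeriodicSpace.toL2 u‖ := by
    intro u
    set f := (asFun_ofReal_memLp u).haarAddCircle.toLp _ with hf
    have h2 := hasSum_sq_fourierCoeff f
    have h3 : ‖fourierCoeff f k‖ ^ 2 ≤ ∫ t : Torus, ‖f t‖ ^ 2 ∂AddCircle.haarAddCircle :=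
      h2.tsum_eq ▸ h2.summable.le_tsum k fun _ _ => by positivity
    have h4 : fourierCoeff f k = coeff u k :=
      congrFun (fourierCoeff_congr_ae (MemLp.coeFn_toLp _)) k
    -- Parseval is stated for the measure of mass one, the norm of the space for the measure of mass
    -- `2π`; the factor between them is at most one.
    have h5 : ∫ t : Torus, ‖f t‖ ^ 2 ∂AddCircle.haarAddCircle =
        (2 * Real.pi)⁻¹ * ‖PeriodicSpace.toL2 u‖ ^ 2 := by
      rw [AddCircle.integral_haarAddCircle, smul_eq_mul, ← real_inner_self_eq_norm_sq,
        L2.inner_def]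
      congr 1
      refine integral_congr_ae ?_
      have := ae_haar_iff_ae_volume.1 (MemLp.coeFn_toLp (asFun_ofReal_memLp u).haarAddCircle)
      filter_upwards [this] with x hx
      rw [hf, hx]
      simp [asFun, pow_two]
    rw [h4, h5] at h3
    refine le_of_sq_le_sq ?_ (norm_nonneg _)
    refine h3.trans (mul_le_of_le_one_left (by positivity) (inv_le_one_of_one_le₀ ?_))
    linarith [Real.pi_gt_three]
  exact ⟨‖(PeriodicSpace.toL2 : X →L[ℝ] _)‖, fun u => (h1 u).trans
    (ContinuousLinearMap.le_opNorm _ _)⟩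

/-- The `k`-th Fourier coefficient as a continuous real-linear functional. -/
noncomputable def coeffL (k : ℤ) : X →L[ℝ] ℂ :=
  LinearMap.mkContinuousOfExistsBound
    { toFun := fun u => coeff u k
      map_add' := fun u v => coeff_add u v k
      map_smul' := fun c u => by simpa using coeff_smul c u k } (norm_coeff_le k)

@[simp]
theorem coeffL_apply (k : ℤ) (u : X) : coeffL k u = coeff u k := rfl

theorem coeff_zero (k : ℤ) : coeff (0 : X) k = 0 := map_zero (coeffL (X := X) k)

theorem coeff_sub (u v : X) (k : ℤ) : coeff (u - v) k = coeff u k - coeff v k :=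
  map_sub (coeffL (X := X) k) u v

theorem coeff_sum {ι : Type*} (s : Finset ι) (u : ι → X) (k : ℤ) :
    coeff (∑ i ∈ s, u i) k = ∑ i ∈ s, coeff (u i) k := map_sum (coeffL (X := X) k) u s

theorem coeff_neg_index (u : X) (k : ℤ) : coeff u (-k) = conj (coeff u k) :=
  fourierCoeff_ofReal_neg _ k

/-- Completeness of the Fourier system in `L²` and injectivity of the embedding. Most identities
between elements of the spaces below are checked through this, coefficient by coefficient. -/
theorem eq_of_coeff_eq {u v : X} (h : ∀ k, coeff u k = coeff v k) : u = v := by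
  refine PeriodicSpace.toL2_injective (Lp.ext ?_)
  filter_upwards [ae_eq_of_fourierCoeff_eq (asFun_ofReal_memLp u) (asFun_ofReal_memLp v) h]
    with x hx
  exact_mod_cast hx

theorem mem_modes_of_coeff_ne_zero {u : X} {k : ℤ} (h : coeff u k ≠ 0) : k ∈ modes X :=
  PeriodicSpace.exists_mode u k h

theorem coeff_eq_zero_of_notMem_modes {k : ℤ} (h : k ∉ modes X) (u : X) : coeff u k = 0 :=
  not_not.1 fun hne => h (mem_modes_of_coeff_ne_zero hne)

theorem neg_mem_modes {k : ℤ} (h : k ∈ modes X) : -k ∈ modes X := by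
  obtain ⟨⟨c, hc⟩, s, hs⟩ := h
  refine ⟨⟨c, ?_⟩, -s, ?_⟩
  · filter_upwards [hc] with x hx
    rw [hx, cosMode_neg]
  · have : ∀ᵐ x : Torus, asFun (-s) x = - asFun s x := by
      simp only [asFun, map_neg]
      exact Lp.coeFn_neg _
    filter_upwards [hs, this] with x hx hx'
    rw [hx', hx, sinMode_neg]

theorem neg_mem_modes_iff {k : ℤ} : -k ∈ modes X ↔ k ∈ modes X :=
  ⟨fun h => by simpa using neg_mem_modes h, neg_mem_modes⟩

/-- Symmetry in terms of Fourier coefficients: up to a translation they are real. -/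
theorem isSymmetric_iff (u : X) :
    IsSymmetric (asFun u) ↔
      ∃ a : ℝ, ∀ k : ℤ, (fourier k (a : Torus) * coeff u k).im = 0 := by
  have key : ∀ a : Torus, (∀ᵐ x : Torus, asFun u (x + a) = asFun u (-x + a)) ↔
      ∀ k : ℤ, (fourier k a * coeff u k).im = 0 := by
    intro a
    have h1 : ∀ k, fourierCoeff (fun x => (asFun u (x + a) : ℂ)) k = fourier k a * coeff u k :=
      fourierCoeff_comp_add (fun x => (asFun u x : ℂ)) a
    have h2 : ∀ k, fourierCoeff (fun x => (asFun u (-x + a) : ℂ)) k =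
        conj (fourier k a * coeff u k) := by
      intro k
      rw [fourierCoeff_comp_neg (fun x => (asFun u (x + a) : ℂ)), h1, map_mul, fourier_neg,
        coeff_neg_index]
    have m1 : MemLp (fun x => (asFun u (x + a) : ℂ)) 2 volume :=
      (asFun_ofReal_memLp u).comp_measurePreserving (measurePreserving_add_right volume a)
    have m2 : MemLp (fun x => (asFun u (-x + a) : ℂ)) 2 volume :=
      m1.comp_measurePreserving (Measure.measurePreserving_neg volume)
    constructor
    · intro h k
      rw [← Complex.conj_eq_iff_im, ← h2, ← h1]
      refine congrFun (fourierCoeff_congr_ae ?_) k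
      filter_upwards [ae_haar_iff_ae_volume.2 h] with x hx
      rw [hx]
    · intro h
      filter_upwards [ae_eq_of_fourierCoeff_eq m1 m2 fun k => by
        rw [h1, h2, Complex.conj_eq_iff_im.2 (h k)]] with x hx
      exact_mod_cast hx
  constructor
  · rintro ⟨a, ha⟩
    induction a using QuotientAddGroup.induction_on with
    | H a => exact ⟨a, (key a).1 ha⟩
  · rintro ⟨a, ha⟩
    exact ⟨a, (key a).2 ha⟩

end Coefficients

/-! ### Complexification and complex-multilinear extension -/

/-- The complexification of a real vector space: the pair `(a, b)` stands for `a + i b`. -/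
def Complexified (V : Type*) : Type _ := V × V

namespace Complexified

variable {V : Type*} [AddCommGroup V] [Module ℝ V]

instance : AddCommGroup (Complexified V) := inferInstanceAs (AddCommGroup (V × V))

instance : SMul ℂ (Complexified V) :=
  ⟨fun z u => (z.re • u.1 - z.im • u.2, z.re • u.2 + z.im • u.1)⟩

@[ext]
theorem ext {u v : Complexified V} (h1 : u.1 = v.1) (h2 : u.2 = v.2) : u = v := Prod.ext h1 h2

@[simp] theorem fst_add (u v : Complexified V) : (u + v).1 = u.1 + v.1 := rfl
@[simp] theorem snd_add (u v : Complexified V) : (u + v).2 = u.2 + v.2 := rfl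
@[simp] theorem fst_zero : (0 : Complexified V).1 = 0 := rfl
@[simp] theorem snd_zero : (0 : Complexified V).2 = 0 := rfl
@[simp] theorem fst_sub (u v : Complexified V) : (u - v).1 = u.1 - v.1 := rfl
@[simp] theorem snd_sub (u v : Complexified V) : (u - v).2 = u.2 - v.2 := rfl
@[simp] theorem fst_smul (z : ℂ) (u : Complexified V) :
    (z • u).1 = z.re • u.1 - z.im • u.2 := rfl
@[simp] theorem snd_smul (z : ℂ) (u : Complexified V) :
    (z • u).2 = z.re • u.2 + z.im • u.1 := rfl

instance : Module ℂ (Complexified V) where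
  one_smul u := by ext <;> simp
  mul_smul z w u := by
    ext <;> simp only [fst_smul, snd_smul, Complex.mul_re, Complex.mul_im] <;> module
  smul_zero z := by ext <;> simp
  smul_add z u v := by ext <;> simp <;> module
  add_smul z w u := by ext <;> simp <;> module
  zero_smul u := by ext <;> simp

/-- The vector `a + i b`. -/
def mk (a b : V) : Complexified V := (a, b)

@[simp] theorem fst_mk (a b : V) : (mk a b).1 = a := rfl
@[simp] theorem snd_mk (a b : V) : (mk a b).2 = b := rfl

/-- The real vectors. -/
def ofReal (a : V) : Complexified V := mk a 0

@[simp] theorem fst_ofReal (a : V) : (ofReal a).1 = a := rfl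
@[simp] theorem snd_ofReal (a : V) : (ofReal a).2 = 0 := rfl

variable (V) in
/-- The real part as an additive map. -/
def fstHom : Complexified V →+ V := ⟨⟨fun u => u.1, rfl⟩, fun _ _ => rfl⟩

variable (V) in
/-- The imaginary part as an additive map. -/
def sndHom : Complexified V →+ V := ⟨⟨fun u => u.2, rfl⟩, fun _ _ => rfl⟩

theorem fst_sum {ι : Type*} (s : Finset ι) (u : ι → Complexified V) :
    (∑ i ∈ s, u i).1 = ∑ i ∈ s, (u i).1 := map_sum (fstHom V) u s

theorem snd_sum {ι : Type*} (s : Finset ι) (u : ι → Complexified V) :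
    (∑ i ∈ s, u i).2 = ∑ i ∈ s, (u i).2 := map_sum (sndHom V) u s

/-- The complex-linear extension of a functional. -/
noncomputable def extendLin (l : V →ₗ[ℝ] ℂ) : Complexified V →ₗ[ℂ] ℂ where
  toFun u := l u.1 + Complex.I * l u.2
  map_add' u v := by simp; ring
  map_smul' z u := by
    simp only [fst_smul, snd_smul, map_add, map_sub, map_smul, RingHom.id_apply, smul_eq_mul,
      Complex.real_smul]
    nth_rw 5 [← Complex.re_add_im z]
    linear_combination -(z.im : ℂ) * l u.2 * Complex.I_sq

theorem extendLin_apply (l : V →ₗ[ℝ] ℂ) (u : Complexified V) :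
    extendLin l u = l u.1 + Complex.I * l u.2 := rfl

@[simp] theorem extendLin_ofReal (l : V →ₗ[ℝ] ℂ) (a : V) : extendLin l (ofReal a) = l a := by
  simp [extendLin_apply]

variable {m : ℕ}

/-- Each `S` without `j` is paired with `insert j S`. The two terms combine to a complex-linear
function of the `j`-th argument, which makes linearity in that argument evident. -/
theorem sum_piecewise_update (T : MultilinearMap ℝ (fun _ : Fin m => V) ℂ)
    (u : Fin m → Complexified V) (j : Fin m) (w : Complexified V) :
    ∑ S : Finset (Fin m), Complex.I ^ S.card * T (S.piecewise
        (fun i => (Function.update u j w i).2) (fun i => (Function.update u j w i).1)) =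
      ∑ S ∈ (Finset.univ.erase j).powerset, Complex.I ^ S.card * extendLin
        (T.toLinearMap (S.piecewise (fun i => (u i).2) (fun i => (u i).1)) j) w := by
  have hu : (Finset.univ : Finset (Finset (Fin m))) =
      (insert j (Finset.univ.erase j)).powerset := by
    rw [Finset.insert_erase (Finset.mem_univ j), Finset.powerset_univ]
  rw [hu, Finset.sum_powerset_insert (Finset.notMem_erase j _), ← Finset.sum_add_distrib]
  refine Finset.sum_congr rfl fun S hS => ?_
  have hj : j ∉ S := fun h => Finset.notMem_erase j _ (Finset.mem_powerset.1 hS h)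
  rw [Finset.card_insert_of_notMem hj, extendLin_apply]
  have e1 : S.piecewise (fun i => (Function.update u j w i).2)
      (fun i => (Function.update u j w i).1) =
      Function.update (S.piecewise (fun i => (u i).2) (fun i => (u i).1)) j w.1 := by
    funext i
    by_cases hi : i = j
    · subst hi; simp [hj]
    · by_cases hS : i ∈ S <;> simp [hi, hS]
  have e2 : (insert j S).piecewise (fun i => (Function.update u j w i).2)
      (fun i => (Function.update u j w i).1) =
      Function.update (S.piecewise (fun i => (u i).2) (fun i => (u i).1)) j w.2 := by
    funext i
    by_cases hi : i = j
    · subst hi; simp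
    · by_cases hS : i ∈ S <;> simp [hi, hS]
  rw [e1, e2, MultilinearMap.toLinearMap_apply, MultilinearMap.toLinearMap_apply]
  ring

/-- The complex-multilinear extension of a real-multilinear form. -/
noncomputable def extendMultilinear (T : MultilinearMap ℝ (fun _ : Fin m => V) ℂ) :
    MultilinearMap ℂ (fun _ : Fin m => Complexified V) ℂ :=
  MultilinearMap.mk' (fun u => ∑ S : Finset (Fin m), Complex.I ^ S.card *
      T (S.piecewise (fun i => (u i).2) (fun i => (u i).1)))
    (fun u j v w => by
      simp only [sum_piecewise_update, map_add, mul_add, Finset.sum_add_distrib])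
    (fun u j z w => by
      simp only [sum_piecewise_update, map_smul, smul_eq_mul, Finset.mul_sum]
      exact Finset.sum_congr rfl fun _ _ => by ring)

theorem extendMultilinear_apply (T : MultilinearMap ℝ (fun _ : Fin m => V) ℂ)
    (u : Fin m → Complexified V) :
    extendMultilinear T u = ∑ S : Finset (Fin m), Complex.I ^ S.card *
      T (S.piecewise (fun i => (u i).2) (fun i => (u i).1)) := rfl

theorem extendMultilinear_ofReal (T : MultilinearMap ℝ (fun _ : Fin m => V) ℂ)
    (a : Fin m → V) : extendMultilinear T (fun i => ofReal (a i)) = T a := by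
  rw [extendMultilinear_apply, Finset.sum_eq_single ∅]
  · simp
  · intro S _ hS
    obtain ⟨i, hi⟩ := Finset.nonempty_iff_ne_empty.2 hS
    rw [T.map_coord_zero i (by simp [hi]), mul_zero]
  · simp

theorem norm_extendMultilinear_le (T : MultilinearMap ℝ (fun _ : Fin m => V) ℂ)
    (u : Fin m → Complexified V) (C : ℝ)
    (hC : ∀ S : Finset (Fin m), ‖T (S.piecewise (fun i => (u i).2) (fun i => (u i).1))‖ ≤ C) :
    ‖extendMultilinear T u‖ ≤ 2 ^ m * C := by
  rw [extendMultilinear_apply]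
  refine (norm_sum_le _ _).trans ?_
  refine (Finset.sum_le_card_nsmul _ _ C fun S _ => ?_).trans_eq ?_
  · simpa using hC S
  · simp

end Complexified

open Complexified

/-! ### Exponentials in the complexified spaces and projections on modes -/

section ModeVectors

variable {X : Type*} [NormedAddCommGroup X] [NormedSpace ℝ X] [PeriodicSpace X]

open Classical in
variable (X) in
/-- The element `e^{ikx}` of the complexification of `X`, if it exists, and `0` otherwise. -/
noncomputable def modeVec (k : ℤ) : Complexified X :=
  if h : k ∈ modes X then Complexified.mk h.1.choose h.2.choose else 0

theorem represents_modeVec_fst {k : ℤ} (h : k ∈ modes X) :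
    Represents (modeVec X k).1 (cosMode k) := by
  rw [modeVec, dif_pos h]
  exact h.1.choose_spec

theorem represents_modeVec_snd {k : ℤ} (h : k ∈ modes X) :
    Represents (modeVec X k).2 (sinMode k) := by
  rw [modeVec, dif_pos h]
  exact h.2.choose_spec

theorem modeVec_of_notMem {k : ℤ} (h : k ∉ modes X) : modeVec X k = 0 := by
  rw [modeVec, dif_neg h]

/-- The Fourier coefficients on the complexification. -/
noncomputable def coeffC (k : ℤ) : Complexified X →ₗ[ℂ] ℂ :=
  extendLin (coeffL k : X →L[ℝ] ℂ).toLinearMap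

theorem coeffC_apply (k : ℤ) (u : Complexified X) :
    coeffC k u = coeff u.1 k + Complex.I * coeff u.2 k := rfl

@[simp] theorem coeffC_ofReal (k : ℤ) (u : X) : coeffC k (ofReal u) = coeff u k :=
  extendLin_ofReal _ _

theorem coeffC_modeVec {k : ℤ} (h : k ∈ modes X) (m : ℤ) :
    coeffC m (modeVec X k) = if m = k then 1 else 0 := by
  rw [coeffC_apply, coeff_eq_of_represents (represents_modeVec_fst h),
    coeff_eq_of_represents (represents_modeVec_snd h), fourierCoeff_cosMode,
    fourierCoeff_sinMode]
  have hI : Complex.I * (-Complex.I / 2) = 1 / 2 := by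
    linear_combination -(1 / 2 : ℂ) * Complex.I_sq
  have hI' : Complex.I * (Complex.I / 2) = -(1 / 2) := by
    linear_combination (1 / 2 : ℂ) * Complex.I_sq
  split_ifs <;> simp only [mul_add, hI, hI', mul_zero] <;> norm_num

theorem eq_of_coeffC_eq {u v : Complexified X} (h : ∀ k, coeffC k u = coeffC k v) : u = v := by
  have h0 : ∀ k, coeff (u - v).1 k + Complex.I * coeff (u - v).2 k = 0 := fun k => by
    rw [← coeffC_apply, map_sub, h, sub_self]
  -- The coefficients of real elements at `k` and `-k` are conjugate, so the vanishing of `a + ib`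
  -- at `-k` is that of `a - ib` at `k`; together they separate real and imaginary parts.
  have h1 : ∀ k, coeff (u - v).1 k - Complex.I * coeff (u - v).2 k = 0 := fun k => by
    have := congrArg conj (h0 (-k))
    simpa [coeff_neg_index, sub_eq_add_neg] using this
  have e1 : (u - v).1 = 0 := eq_of_coeff_eq fun k => by
    rw [coeff_zero]; linear_combination (h0 k + h1 k) / 2
  have e2 : (u - v).2 = 0 := eq_of_coeff_eq fun k => by
    rw [coeff_zero]
    have : Complex.I * coeff (u - v).2 k = 0 := by linear_combination (h0 k - h1 k) / 2
    simpa using this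
  exact sub_eq_zero.1 (Complexified.ext e1 e2)

/-- A vector with conjugation-symmetric coefficients is real. -/
theorem snd_eq_zero_of_coeffC (u : Complexified X)
    (h : ∀ k, coeffC (-k) u = conj (coeffC k u)) : u.2 = 0 := by
  refine eq_of_coeff_eq fun k => ?_
  have := h k
  simp only [coeffC_apply, coeff_neg_index, map_add, map_mul, Complex.conj_I] at this
  have h2 : Complex.I * conj (coeff u.2 k) = 0 := by linear_combination this / 2
  rw [coeff_zero]
  simpa using h2

/-- The real element `Re (w e^{ikx})` of `X`. -/
noncomputable def realMode (w : ℂ) (k : ℤ) : X := (w • modeVec X k).1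

theorem realMode_eq (w : ℂ) (k : ℤ) :
    (realMode w k : X) = w.re • (modeVec X k).1 - w.im • (modeVec X k).2 := rfl

theorem coeff_realMode {k : ℤ} (h : k ∈ modes X) (w : ℂ) (m : ℤ) :
    coeff (realMode w k : X) m =
      ((if m = k then w else 0) + if m = -k then conj w else 0) / 2 := by
  rw [realMode_eq, coeff_sub, coeff_smul, coeff_smul,
    coeff_eq_of_represents (represents_modeVec_fst h),
    coeff_eq_of_represents (represents_modeVec_snd h), fourierCoeff_cosMode,
    fourierCoeff_sinMode]
  have e1 : w = w.re + w.im * Complex.I := (Complex.re_add_im w).symm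
  have e2 : conj w = w.re - w.im * Complex.I := by
    apply Complex.ext <;> simp
  rw [e2]
  nth_rw 3 [e1]
  split_ifs <;> ring

/-- The projection on the modes in `K`, with values in a possibly different space. -/
noncomputable def modeProj (Z : Type*) [NormedAddCommGroup Z] [NormedSpace ℝ Z]
    [PeriodicSpace Z] (K : Finset ℤ) : X →L[ℝ] Z :=
  ∑ k ∈ K, ((Complex.reCLM.comp (coeffL k)).smulRight (modeVec Z k).1 -
    (Complex.imCLM.comp (coeffL k)).smulRight (modeVec Z k).2)

variable {Z : Type*} [NormedAddCommGroup Z] [NormedSpace ℝ Z] [PeriodicSpace Z]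

theorem modeProj_apply (K : Finset ℤ) (u : X) :
    modeProj Z K u = ∑ k ∈ K, realMode (coeff u k) k := by
  simp [modeProj, realMode_eq]

theorem coeff_modeProj {K : Finset ℤ} (hK : ∀ k ∈ K, k ∈ modes Z) (hneg : ∀ k ∈ K, -k ∈ K)
    (u : X) (m : ℤ) : coeff (modeProj Z K u) m = if m ∈ K then coeff u m else 0 := by
  rw [modeProj_apply, coeff_sum]
  have h : ∀ k ∈ K, coeff (realMode (coeff u k) k : Z) m =
      (if m = k then coeff u m / 2 else 0) + if -m = k then coeff u m / 2 else 0 := by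
    intro k hk
    rw [coeff_realMode (hK k hk), add_div, ite_div, ite_div, zero_div]
    congr 1
    · split_ifs with h <;> simp [h]
    · by_cases h : m = -k
      · subst h; simp [coeff_neg_index]
      · rw [if_neg h, if_neg fun h' => h (by omega)]
  rw [Finset.sum_congr rfl h, Finset.sum_add_distrib, Finset.sum_ite_eq, Finset.sum_ite_eq]
  by_cases hm : m ∈ K
  · rw [if_pos hm, if_pos (hneg m hm), if_pos hm]; ring
  · rw [if_neg hm, if_neg fun h' => hm (by simpa using hneg _ h'), if_neg hm]; ring

end ModeVectors

/-! ### The multilinear terms on exponentials -/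

section ComplexEval

variable {d : ℕ} {X Y : Type*} [NormedAddCommGroup X] [NormedSpace ℝ X] [PeriodicSpace X]
  [NormedAddCommGroup Y] [NormedSpace ℝ Y] [PeriodicSpace Y]

theorem fourierCoeff_complexEval {m : ℕ} (T : MultilinearMap ℝ (fun _ : Fin m => X) Y)
    (a b : Fin m → X) (k : ℤ) :
    fourierCoeff (PeriodicEquation.complexEval T a b) k =
      extendMultilinear ((coeffL k : Y →L[ℝ] ℂ).toLinearMap.compMultilinearMap T)
        (fun i => Complexified.mk (a i) (b i)) := by
  have : PeriodicEquation.complexEval T a b = ∑ S : Finset (Fin m), (Complex.I ^ S.card) •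
      fun x : Torus => ((asFun (T (S.piecewise b a)) x : ℝ) : ℂ) := by
    funext x
    simp [PeriodicEquation.complexEval]
  rw [this, fourierCoeff.sum _ _ fun S _ => (asFun_ofReal_integrable _).smul _,
    Finset.sum_apply, extendMultilinear_apply]
  refine Finset.sum_congr rfl fun S _ => ?_
  rw [fourierCoeff.const_smul]
  rfl

variable (E : PeriodicEquation d X Y)

open Classical in
/-- The action of the multilinear terms on the modes. -/
theorem extendMultilinear_modeVec (h2 : E.MultilinearFourierSeries) {μ : Param d} (hμ : μ ∈ E.M)
    {m : ℕ} (hm : 2 ≤ m) (κ : Fin m → ℤ) (hκ : ∀ j, κ j ∈ modes X) (k : ℤ) :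
    extendMultilinear ((coeffL k : Y →L[ℝ] ℂ).toLinearMap.compMultilinearMap (E.Nterm m μ))
      (fun i => modeVec X (κ i)) = if k = ∑ i, κ i then (E.n m μ κ : ℂ) else 0 := by
  have h := (h2 μ hμ).2.1 m hm κ (fun i => (modeVec X (κ i)).1) (fun i => (modeVec X (κ i)).2)
    (fun j => represents_modeVec_fst (hκ j)) (fun j => represents_modeVec_snd (hκ j))
  have h' := fourierCoeff_complexEval (E.Nterm m μ) (fun i => (modeVec X (κ i)).1)
    (fun i => (modeVec X (κ i)).2) k
  rw [fourierCoeff_congr_ae (ae_haar_iff_ae_volume.2 h), fourierCoeff.const_mul,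
    fourierCoeff_fourier_apply] at h'
  refine Eq.trans h'.symm ?_
  split_ifs <;> simp

/-- The symbol is the Fourier coefficient of a combination of elements of `Y` at a frequency at
which all elements of `Y` have coefficient zero. -/
theorem symbol_eq_zero_of_notMem_modes (h2 : E.MultilinearFourierSeries) {μ : Param d}
    (hμ : μ ∈ E.M) {m : ℕ} (hm : 2 ≤ m) (κ : Fin m → ℤ) (hκ : ∀ j, κ j ∈ modes X)
    (hY : ∑ i, κ i ∉ modes Y) : E.n m μ κ = 0 := by
  have h := extendMultilinear_modeVec E h2 hμ hm κ hκ (∑ i, κ i)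
  rw [if_pos rfl, extendMultilinear_apply, Finset.sum_eq_zero] at h
  · exact_mod_cast h.symm
  · intro S _
    simp [coeff_eq_zero_of_notMem_modes hY]

end ComplexEval

/-! ### Analytic functions and absolutely convergent series of monomials -/

section Monomials

/-- An analytic complex-valued function has an absolutely convergent expansion in words in any
finite system of complex coordinates. -/
theorem AnalyticAt.exists_hasSum_words {V J : Type*} [NormedAddCommGroup V] [NormedSpace ℝ V]
    [Fintype J] (X : J → V → ℂ) (e : J → Complexified V)
    (hX : ∀ v, ofReal v = ∑ j, X j v • e j) (hX' : ∀ j v, ‖X j v‖ ≤ ‖v‖)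
    (he : ∀ j, ‖(e j).1‖ ≤ 1 ∧ ‖(e j).2‖ ≤ 1)
    {f : V → ℂ} {x₀ : V} (hf : AnalyticAt ℝ f x₀) :
    ∃ R > 0, ∃ c : (Σ n : ℕ, (Fin n → J)) → ℂ, Summable (fun s => ‖c s‖ * R ^ s.1) ∧
      ∀ v, ‖v‖ ≤ R → HasSum (fun s => c s * ∏ i, X (s.2 i) v) (f (x₀ + v)) := by
  obtain ⟨p, r, hp⟩ := hf
  obtain ⟨ρ, hρ0, hρr⟩ := ENNReal.lt_iff_exists_nnreal_btwn.1 hp.r_pos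
  have hρ : 0 < ρ := by exact_mod_cast hρ0
  obtain ⟨C, hC, hpC⟩ := p.norm_mul_pow_le_of_lt_radius (hρr.trans_le hp.r_le)
  set N : ℝ := (Fintype.card J : ℝ) with hN
  have hN0 : 0 ≤ N := by positivity
  have hρ' : (0 : ℝ) < ρ := hρ
  -- There are `N ^ n` words of length `n`, and complexifying the `n`-linear term costs a factor `2
  -- ^ n`. This radius makes the series over the degree geometric with ratio `2NR/ρ ≤ 1/2`.
  set R : ℝ := ρ / (4 * (N + 1)) with hR
  have hR0 : 0 < R := by positivity
  have hRρ : R < ρ := by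
    rw [hR, div_lt_iff₀ (by positivity)]; nlinarith
  have hq : 2 * N * R / ρ ≤ 1 / 2 := by
    have : 2 * N * R / (ρ : ℝ) = N / (2 * (N + 1)) := by
      rw [hR]; field_simp; ring
    rw [this, div_le_div_iff₀ (by positivity) (by positivity)]; linarith
  let c : (Σ n : ℕ, (Fin n → J)) → ℂ := fun s =>
    extendMultilinear (p s.1).toMultilinearMap (fun i => e (s.2 i))
  have hc : ∀ s, ‖c s‖ ≤ 2 ^ s.1 * ‖p s.1‖ := fun s => by
    refine norm_extendMultilinear_le _ _ _ fun S => ?_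
    refine ((p s.1).le_opNorm _).trans (mul_le_of_le_one_right (norm_nonneg _) ?_)
    refine Finset.prod_le_one (fun _ _ => norm_nonneg _) fun i _ => ?_
    by_cases hi : i ∈ S
    · simpa [hi] using (he _).2
    · simpa [hi] using (he _).1
  have hs : Summable (fun s : (Σ n : ℕ, (Fin n → J)) => ‖c s‖ * R ^ s.1) := by
    rw [summable_sigma_of_nonneg fun s => by positivity]
    refine ⟨fun n => (hasSum_fintype _).summable, ?_⟩
    refine Summable.of_nonneg_of_le (fun n => tsum_nonneg fun s => by positivity) (fun n => ?_)
      ((summable_geometric_two).mul_left C)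
    rw [tsum_fintype]
    calc ∑ s : Fin n → J, ‖c ⟨n, s⟩‖ * R ^ n
        ≤ ∑ _s : Fin n → J, (2 ^ n * ‖p n‖) * R ^ n := by
          gcongr with s; exact hc ⟨n, s⟩
      _ = (‖p n‖ * ρ ^ n) * (2 * N * R / ρ) ^ n := by
          have h1 : (2 * N * R / ρ) ^ n * (ρ : ℝ) ^ n = (2 * N * R) ^ n := by
            rw [← mul_pow, div_mul_cancel₀ _ hρ'.ne']
          have h2 : Fintype.card (Fin n → J) • ((2 ^ n * ‖p n‖) * R ^ n) =
              ‖p n‖ * (2 * N * R) ^ n := by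
            rw [Fintype.card_fun, Fintype.card_fin, nsmul_eq_mul, Nat.cast_pow, ← hN, mul_pow,
              mul_pow]
            ring
          rw [Finset.sum_const, Finset.card_univ, h2, ← h1]
          ring
      _ ≤ C * (1 / 2) ^ n := mul_le_mul (hpC n) (pow_le_pow_left₀ (by positivity) hq n)
          (by positivity) hC.le
  refine ⟨R, hR0, c, hs, fun v hv => ?_⟩
  have hvr : v ∈ Metric.eball (0 : V) r := by
    rw [Metric.mem_eball, edist_zero_right]
    refine lt_of_le_of_lt ?_ hρr
    rw [← ofReal_norm, ← ENNReal.ofReal_coe_nnreal]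
    exact ENNReal.ofReal_le_ofReal (hv.trans hRρ.le)
  refine HasSum.sigma_of_hasSum (hp.hasSum hvr) (fun n => ?_) ?_
  · have : p n (fun _ => v) = ∑ s : Fin n → J, c ⟨n, s⟩ * ∏ i, X (s i) v := by
      have h1 := extendMultilinear_ofReal (p n).toMultilinearMap (fun _ => v)
      simp only [hX] at h1
      rw [MultilinearMap.map_sum] at h1
      refine h1.symm.trans (Finset.sum_congr rfl fun s _ => ?_)
      rw [MultilinearMap.map_smul_univ, smul_eq_mul, mul_comm]
    rw [this]
    exact hasSum_fintype _
  · refine Summable.of_norm_bounded hs fun s => ?_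
    rw [norm_mul, norm_prod]
    gcongr
    refine (Finset.prod_le_prod (fun _ _ => norm_nonneg _) fun i _ =>
      (hX' _ v).trans hv).trans_eq ?_
    simp

theorem prod_word_eq_prod_pow {J : Type*} [Fintype J] [DecidableEq J] {n : ℕ} (s : Fin n → J)
    (x : J → ℂ) : ∏ i, x (s i) = ∏ j, x j ^ (Fintype.card {i // s i = j}) := by
  rw [← Fintype.prod_fiberwise' s x]
  simp

theorem sum_card_word {J : Type*} [Fintype J] [DecidableEq J] {n : ℕ} (s : Fin n → J) :
    ∑ j, Fintype.card {i // s i = j} = n := by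
  rw [← Fintype.card_sigma, Fintype.card_congr (Equiv.sigmaFiberEquiv s), Fintype.card_fin]

theorem exists_word {J : Type*} [Fintype J] {n : ℕ} (b : J → ℕ) (hb : ∑ j, b j = n) :
    ∃ s : Fin n → J, ∀ x : J → ℂ, ∏ i, x (s i) = ∏ j, x j ^ b j := by
  have hcard : Fintype.card (Σ j, Fin (b j)) = n := by simp [hb]
  let φ := (Fintype.equivFinOfCardEq hcard).symm
  refine ⟨fun i => (φ i).1, fun x => ?_⟩
  rw [φ.prod_comp (fun y => x y.1), Fintype.prod_sigma]
  simp

/-- The monomial given by a word, as a multilinear map. -/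
noncomputable def wordMap {J : Type*} [Fintype J] {n : ℕ} (s : Fin n → J) :
    ContinuousMultilinearMap ℂ (fun _ : Fin n => J → ℂ) ℂ :=
  (ContinuousMultilinearMap.mkPiAlgebra ℂ (Fin n) ℂ).compContinuousLinearMap
    fun i => ContinuousLinearMap.proj (s i)

theorem wordMap_apply {J : Type*} [Fintype J] {n : ℕ} (s : Fin n → J) (x : Fin n → J → ℂ) :
    wordMap s x = ∏ i, x i (s i) := by
  simp [wordMap]

theorem norm_wordMap_le {J : Type*} [Fintype J] {n : ℕ} (s : Fin n → J) :
    ‖wordMap s‖ ≤ 1 := by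
  refine ContinuousMultilinearMap.opNorm_le_bound zero_le_one fun x => ?_
  rw [wordMap_apply, norm_prod, one_mul]
  exact Finset.prod_le_prod (fun _ _ => norm_nonneg _) fun i _ => norm_le_pi_norm (x i) (s i)

theorem norm_monomial_le {J : Type*} [Fintype J] (b : J → ℕ) (x : J → ℂ) {R : ℝ}
    (hx : ‖x‖ ≤ R) : ‖∏ j, x j ^ b j‖ ≤ R ^ (∑ j, b j) := by
  rw [norm_prod, ← Finset.prod_pow_eq_pow_sum]
  refine Finset.prod_le_prod (fun _ _ => norm_nonneg _) fun j _ => ?_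
  rw [norm_pow]
  exact pow_le_pow_left₀ (norm_nonneg _) ((norm_le_pi_norm x j).trans hx) _

theorem summable_monomials {I J : Type*} [Fintype J] {c : I → ℂ} {b : I → J → ℕ} {R : ℝ}
    (hs : Summable fun i => ‖c i‖ * R ^ (∑ j, b i j)) {x : J → ℂ} (hx : ‖x‖ ≤ R) :
    Summable fun i => c i * ∏ j, x j ^ b i j := by
  refine Summable.of_norm_bounded hs fun i => ?_
  rw [norm_mul]
  gcongr
  exact norm_monomial_le _ x hx

/-- An absolutely convergent series of monomials is analytic. -/
theorem analyticAt_tsum_monomials {I J : Type*} [Fintype J] {c : I → ℂ} {b : I → J → ℕ} {R : ℝ}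
    (hR : 0 < R) (hs : Summable fun i => ‖c i‖ * R ^ (∑ j, b i j)) :
    AnalyticAt ℂ (fun x : J → ℂ => ∑' i, c i * ∏ j, x j ^ b i j) 0 := by
  choose s hsw using fun (n : ℕ) (i : {i : I // ∑ j, b i j = n}) => exists_word (b i) i.2
  let T : ∀ n, {i : I // ∑ j, b i j = n} → ContinuousMultilinearMap ℂ (fun _ : Fin n => J → ℂ) ℂ :=
    fun n i => c i • wordMap (s n i)
  have hT : ∀ n i, ‖T n i‖ ≤ ‖c i‖ := fun n i => by
    rw [norm_smul]
    exact mul_le_of_le_one_right (norm_nonneg _) (norm_wordMap_le _)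
  have hfib : ∀ n, Summable fun i : {i : I // ∑ j, b i j = n} => ‖c i‖ * R ^ n := fun n =>
    (hs.comp_injective Subtype.val_injective).congr fun i => by simp [i.2]
  have hfib' : ∀ n, Summable fun i : {i : I // ∑ j, b i j = n} => ‖c i‖ := fun n => by
    simpa [hR.ne'] using (hfib n).mul_right (R ^ n)⁻¹
  have hTs : ∀ n, Summable (T n) := fun n => Summable.of_norm_bounded (hfib' n) (hT n)
  -- The term of degree `n` gathers all monomials of total degree `n`, each written as a product
  -- over a word of length `n`.
  let p : FormalMultilinearSeries ℂ (J → ℂ) ℂ := fun n => ∑' i, T n i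
  have hpb : ∀ n, ‖p n‖ * R ^ n ≤ ∑' i, ‖c i‖ * R ^ (∑ j, b i j) := fun n => by
    have h1 : ‖p n‖ ≤ ∑' i : {i : I // ∑ j, b i j = n}, ‖c i‖ :=
      tsum_of_norm_bounded (hfib' n).hasSum (hT n)
    calc ‖p n‖ * R ^ n ≤ (∑' i : {i : I // ∑ j, b i j = n}, ‖c i‖) * R ^ n := by gcongr
      _ = ∑' i : {i : I // ∑ j, b i j = n}, ‖c i‖ * R ^ n := tsum_mul_right.symm
      _ = ∑' i : {i : I // ∑ j, b i j = n}, ‖c i‖ * R ^ (∑ j, b i j) :=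
          tsum_congr fun i => by rw [i.2]
      _ ≤ ∑' i, ‖c i‖ * R ^ (∑ j, b i j) :=
          Summable.tsum_subtype_le (fun i => ‖c i‖ * R ^ (∑ j, b i j)) {i | ∑ j, b i j = n}
            (fun i => by positivity) hs
  have hball : HasFPowerSeriesOnBall (fun x : J → ℂ => ∑' i, c i * ∏ j, x j ^ b i j) p 0
      (ENNReal.ofReal R) := by
    refine ⟨?_, by simpa using hR, fun {y} hy => ?_⟩
    · have := p.le_radius_of_bound (r := R.toNNReal) (∑' i, ‖c i‖ * R ^ (∑ j, b i j)) fun n => by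
        rw [Real.coe_toNNReal R hR.le]; exact hpb n
      exact this
    · have hy' : ‖y‖ ≤ R := by
        rw [Metric.mem_eball, edist_zero_right, ← ofReal_norm,
          ENNReal.ofReal_lt_ofReal_iff hR] at hy
        exact hy.le
      rw [zero_add]
      have h1 := (summable_monomials hs hy').hasSum
      have h2 := ((Equiv.sigmaFiberEquiv fun i => ∑ j, b i j).hasSum_iff).2 h1
      refine h2.sigma fun n => ?_
      have h3 : HasSum (fun i => T n i fun _ => y) (p n fun _ => y) :=
        ContinuousMultilinearMap.hasSum_eval (hTs n).hasSum _
      have h4 : ∀ i : {i : I // ∑ j, b i j = n},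
          T n i (fun _ => y) = c i * ∏ j, y j ^ b i j := fun i => by
        rw [← hsw, ← wordMap_apply (s n i) fun _ => y]
        rfl
      simp only [h4] at h3
      exact h3
  exact hball.analyticAt

end Monomials

theorem HasSum.of_eq {I M : Type*} [AddCommMonoid M] [TopologicalSpace M] {f g : I → M} {a b : M}
    (h : HasSum f a) (hfg : ∀ i, g i = f i) (hab : b = a) : HasSum g b := by
  rw [hab, show g = f from funext hfg]
  exact h

/-! ### Real and imaginary parts of a power series with real coefficients -/

section RealDecomposition

variable {I J : Type*} [Fintype J]

/-- The letters `y`, `x` and `conj x`. -/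
noncomputable def conjLetters (J : Type*) [Fintype J] : (J → ℝ) × ℂ →L[ℝ] (J ⊕ Fin 2 → ℂ) :=
  ContinuousLinearMap.pi (Sum.elim
    (fun j => Complex.ofRealCLM.comp ((ContinuousLinearMap.proj j).comp
      (ContinuousLinearMap.fst ℝ (J → ℝ) ℂ)))
    ![ContinuousLinearMap.snd ℝ (J → ℝ) ℂ,
      (Complex.conjCLE : ℂ →L[ℝ] ℂ).comp (ContinuousLinearMap.snd ℝ (J → ℝ) ℂ)])

theorem norm_conjLetters_le (p : (J → ℝ) × ℂ) : ‖conjLetters J p‖ ≤ ‖p‖ := by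
  refine (pi_norm_le_iff_of_nonneg (norm_nonneg _)).2 fun j => ?_
  rcases j with j | j
  · simpa [conjLetters] using (norm_le_pi_norm p.1 j).trans (norm_fst_le p)
  · fin_cases j
    · simpa [conjLetters] using norm_snd_le p
    · simpa [conjLetters] using norm_snd_le p

/-- The numbers `x` and `conj x` are treated as independent complex variables. The series is
holomorphic in these, and `S` is its composition with the real-linear map `conjLetters`. -/
theorem exists_analyticAt_hasSum_conj {c : I → ℂ} {β : I → J → ℕ} {a b : I → ℕ} {R : ℝ}
    (hR : 0 < R) (hs : Summable fun i => ‖c i‖ * R ^ (∑ j, β i j + (a i + b i))) :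
    ∃ S : (J → ℝ) × ℂ → ℂ, AnalyticAt ℝ S 0 ∧ ∀ p : (J → ℝ) × ℂ, ‖p‖ ≤ R →
      HasSum (fun i => c i * (∏ j, (p.1 j : ℂ) ^ β i j) * (p.2 ^ a i * conj p.2 ^ b i)) (S p) := by
  let γ : I → J ⊕ Fin 2 → ℕ := fun i => Sum.elim (β i) ![a i, b i]
  have hs' : Summable fun i => ‖c i‖ * R ^ (∑ j, γ i j) := by
    simpa [γ, Fintype.sum_sum_type] using hs
  have h1 := analyticAt_tsum_monomials hR hs'
  refine ⟨_, AnalyticAt.fun_comp (g := fun x : J ⊕ Fin 2 → ℂ => ∑' i, c i * ∏ j, x j ^ γ i j)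
    (f := conjLetters J) ?_ ((conjLetters J).analyticAt 0), fun p hp => ?_⟩
  · rw [map_zero]; exact h1.restrictScalars
  · have h2 := (summable_monomials hs' ((norm_conjLetters_le p).trans hp)).hasSum
    have h3 : ∀ i, c i * ∏ j, (conjLetters J p) j ^ γ i j =
        c i * (∏ j, (p.1 j : ℂ) ^ β i j) * (p.2 ^ a i * conj p.2 ^ b i) := fun i => by
      simp [γ, conjLetters, Fintype.prod_sum_type, mul_assoc]
    simp only [h3] at h2
    simp only [h3]
    exact h2

/-- Separation of the real part and of the factor `Im x` of the imaginary part of a power series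
with real coefficients. -/
theorem exists_real_decomposition {c : I → ℝ} {β : I → J → ℕ} {t : I → ℕ} {R : ℝ} (hR : 0 < R)
    (hs : Summable fun i => ‖c i‖ * R ^ (∑ j, β i j + t i)) :
    ∃ G₀ G₁ : (J → ℝ) × ℂ → ℝ, AnalyticAt ℝ G₀ 0 ∧ AnalyticAt ℝ G₁ 0 ∧
      ∃ δ > 0, ∀ p : (J → ℝ) × ℂ, ‖p‖ ≤ δ →
        HasSum (fun i => (c i : ℂ) * (∏ j, (p.1 j : ℂ) ^ β i j) * p.2 ^ t i)
          (G₀ p + Complex.I * p.2.im * G₁ p) := by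
  obtain ⟨S, hS, hSsum⟩ := exists_analyticAt_hasSum_conj (c := fun i => (c i : ℂ)) (β := β)
    (a := t) (b := fun _ => 0) hR (by simpa using hs)
  -- These are the coefficients of the quotient in `x ^ t - x̄ ^ t = (x - x̄) ∑ x ^ s x̄ ^ (t - 1 -
  -- s)`, the sum being over `s < t`. Halving the radius pays for the `t` terms, as `t ≤ 2 ^ t`.
  let c' : (Σ i, Fin (t i)) → ℂ := fun s => c s.1
  have hs' : Summable fun s : (Σ i, Fin (t i)) => ‖c' s‖ *
      (R / 2) ^ (∑ j, β s.1 j + ((s.2 : ℕ) + (t s.1 - 1 - s.2))) := by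
    rw [summable_sigma_of_nonneg fun s => by positivity]
    refine ⟨fun n => (hasSum_fintype _).summable, ?_⟩
    refine Summable.of_nonneg_of_le (fun n => tsum_nonneg fun s => by positivity) (fun i => ?_)
      (hs.mul_left (2 / R))
    rw [tsum_fintype]
    have h1 : ∀ s : Fin (t i), ‖c' ⟨i, s⟩‖ *
        (R / 2) ^ (∑ j, β i j + ((s : ℕ) + (t i - 1 - s))) =
        ‖c i‖ * ((2 / R) * (R / 2) ^ (∑ j, β i j + t i)) := fun s => by
      have : ∑ j, β i j + t i = (∑ j, β i j + ((s : ℕ) + (t i - 1 - s))) + 1 := by omega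
      rw [this, pow_succ]
      simp only [c', Complex.norm_real]
      field_simp
    simp only [h1, Finset.sum_const, Finset.card_univ, Fintype.card_fin, nsmul_eq_mul]
    have h2 : (t i : ℝ) * (R / 2) ^ (∑ j, β i j + t i) ≤ R ^ (∑ j, β i j + t i) := by
      have h3 : (t i : ℝ) ≤ 2 ^ (∑ j, β i j + t i) := by
        have : t i < 2 ^ (t i) := Nat.lt_two_pow_self
        have h4 : 2 ^ (t i) ≤ 2 ^ (∑ j, β i j + t i) :=
          Nat.pow_le_pow_right (by norm_num) (by omega)
        exact_mod_cast this.le.trans h4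
      rw [div_pow, mul_div_assoc', div_le_iff₀ (by positivity), mul_comm]
      gcongr
    calc (t i : ℝ) * (‖c i‖ * (2 / R * (R / 2) ^ (∑ j, β i j + t i)))
        = 2 / R * (‖c i‖ * ((t i : ℝ) * (R / 2) ^ (∑ j, β i j + t i))) := by ring
      _ ≤ 2 / R * (‖c i‖ * R ^ (∑ j, β i j + t i)) := by gcongr
  obtain ⟨D, hD, hDsum⟩ := exists_analyticAt_hasSum_conj (c := c') (β := fun s => β s.1)
    (a := fun s => (s.2 : ℕ)) (b := fun s => t s.1 - 1 - s.2) (half_pos hR) hs'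
  refine ⟨fun p => (S p).re, fun p => (D p).re, (Complex.reCLM.analyticAt _).comp hS,
    (Complex.reCLM.analyticAt _).comp hD, R / 2, half_pos hR, fun p hp => ?_⟩
  have h1 : HasSum (fun i => (c i : ℂ) * (∏ j, (p.1 j : ℂ) ^ β i j) * p.2 ^ t i) (S p) := by
    simpa using hSsum p (hp.trans (half_le_self hR.le))
  have h2 : HasSum (fun i => (c i : ℂ) * (∏ j, (p.1 j : ℂ) ^ β i j) * conj p.2 ^ t i)
      (conj (S p)) := by
    have := h1.map (starRingEnd ℂ) Complex.continuous_conj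
    simpa [Function.comp_def, map_prod] using this
  have h3 : HasSum (fun i => (c i : ℂ) * (∏ j, (p.1 j : ℂ) ^ β i j) *
      (p.2 ^ t i - conj p.2 ^ t i)) ((p.2 - conj p.2) * D p) := by
    have := ((hDsum p hp).sigma fun i => hasSum_fintype _).mul_left (p.2 - conj p.2)
    refine this.of_eq (fun i => ?_) rfl
    have hg := (Commute.all p.2 (conj p.2)).geom_sum₂_mul (t i)
    rw [← hg, Finset.sum_range, mul_comm (∑ _, _) (p.2 - conj p.2), Finset.mul_sum,
      Finset.mul_sum, Finset.mul_sum]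
    refine Finset.sum_congr rfl fun s _ => ?_
    simp only [c']
    ring
  have h4 : S p - conj (S p) = (p.2 - conj p.2) * D p := by
    refine (h1.sub h2).unique ?_
    simpa [mul_sub] using h3
  -- Both `S - conj S` and `x - conj x` are purely imaginary, so only the real part of the quotient
  -- `D` matters.
  have h5 : (S p).im = p.2.im * (D p).re := by
    have := congrArg Complex.im h4
    simp at this
    linarith
  have h6 : S p = (S p).re + Complex.I * p.2.im * (D p).re := by
    apply Complex.ext <;> simp [h5]
  rw [← h6]
  exact h1

end RealDecomposition

/-! ### Expansion of equivariant functions -/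

section Expansion

variable {d : ℕ}

/-- A function of `(μ, z)` expands in the monomials `ν^β z₁^a z̄₁^b z₂^c z̄₂^d`. -/
theorem AnalyticAt.exists_hasSum_conj_monomials {f : Param d × (ℂ × ℂ) → ℂ}
    {x₀ : Param d × (ℂ × ℂ)} (hf : AnalyticAt ℝ f x₀) :
    ∃ (I : Type) (_ : Countable I) (c : I → ℂ) (β : I → Fin d → ℕ) (q : I → Fin 4 → ℕ),
      ∃ R > 0, Summable (fun i => ‖c i‖ * R ^ (∑ j, β i j + ∑ j, q i j)) ∧
      ∀ v : Param d × (ℂ × ℂ), ‖v‖ ≤ R → HasSum (fun i => c i * (∏ j, (v.1 j : ℂ) ^ β i j) *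
        (v.2.1 ^ q i 0 * conj v.2.1 ^ q i 1 * v.2.2 ^ q i 2 * conj v.2.2 ^ q i 3))
          (f (x₀ + v)) := by
  classical
  let X : Fin d ⊕ Fin 4 → Param d × (ℂ × ℂ) → ℂ := Sum.elim (fun j v => (v.1 j : ℂ))
    ![fun v => v.2.1, fun v => conj v.2.1, fun v => v.2.2, fun v => conj v.2.2]
  -- The last four vectors are dual to the coordinates `z₁, z̄₁, z₂, z̄₂`: they are the Wirtinger
  -- directions `(∂ₓ ∓ i∂ᵧ)/2`.
  let e : Fin d ⊕ Fin 4 → Complexified (Param d × (ℂ × ℂ)) := Sum.elim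
    (fun j => ofReal (EuclideanSpace.single j 1, 0))
    ![Complexified.mk (0, (1 / 2, 0)) (0, (-Complex.I / 2, 0)),
      Complexified.mk (0, (1 / 2, 0)) (0, (Complex.I / 2, 0)),
      Complexified.mk (0, (0, 1 / 2)) (0, (0, -Complex.I / 2)),
      Complexified.mk (0, (0, 1 / 2)) (0, (0, Complex.I / 2))]
  have hX : ∀ v, ofReal v = ∑ j, X j v • e j := by
    intro v
    rw [Fintype.sum_sum_type, Fin.sum_univ_four]
    apply Complexified.ext
    · simp only [X, e, fst_add, fst_sum, fst_smul]
      apply Prod.ext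
      · ext i
        simp [Prod.fst_sum, Pi.single_apply]
      · apply Prod.ext <;> apply Complex.ext <;> simp [Prod.snd_sum] <;> ring
    · simp only [X, e, snd_add, snd_sum, snd_smul]
      apply Prod.ext
      · ext i
        simp
      · apply Prod.ext <;> apply Complex.ext <;> simp <;> ring
  have hX' : ∀ j v, ‖X j v‖ ≤ ‖v‖ := by
    intro j v
    have h1 : ‖v.2.1‖ ≤ ‖v‖ := (norm_fst_le _).trans (norm_snd_le _)
    have h2 : ‖v.2.2‖ ≤ ‖v‖ := (norm_snd_le _).trans (norm_snd_le _)
    rcases j with j | j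
    · simpa [X] using (PiLp.norm_apply_le v.1 j).trans (norm_fst_le _)
    · fin_cases j <;> simpa [X]
  have he : ∀ j, ‖(e j).1‖ ≤ 1 ∧ ‖(e j).2‖ ≤ 1 := by
    intro j
    rcases j with j | j
    · simp [e, Prod.norm_def]
    · fin_cases j <;> constructor <;> simp [e, Prod.norm_def] <;> norm_num
  obtain ⟨R, hR, c, hs, hsum⟩ := hf.exists_hasSum_words X e hX hX' he
  refine ⟨Σ n : ℕ, (Fin n → Fin d ⊕ Fin 4), inferInstance, c,
    fun s j => Fintype.card {i // s.2 i = Sum.inl j},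
    fun s j => Fintype.card {i // s.2 i = Sum.inr j}, R, hR, ?_, fun v hv => ?_⟩
  · refine hs.congr fun s => ?_
    rw [← Fintype.sum_sum_type (fun j => Fintype.card {i // s.2 i = j}), sum_card_word]
  · refine (hsum v hv).of_eq (fun s => ?_) rfl
    rw [prod_word_eq_prod_pow s.2 fun j => X j v, Fintype.prod_sum_type, Fin.prod_univ_four,
      mul_assoc]
    rfl

/-- The action of the translation by `a` on the amplitudes `(z₁, z₂)` of the modes `k₁, k₂`. -/
noncomputable def rotate (k₁ k₂ : ℤ) (a : Torus) (z : ℂ × ℂ) : ℂ × ℂ :=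
  (fourier k₁ a * z.1, fourier k₂ a * z.2)

theorem norm_fourier_apply (k : ℤ) (a : Torus) : ‖(fourier k a : ℂ)‖ = 1 := by
  rw [fourier_apply, Circle.norm_coe]

theorem norm_rotate (k₁ k₂ : ℤ) (a : Torus) (z : ℂ × ℂ) : ‖rotate k₁ k₂ a z‖ = ‖z‖ := by
  simp only [rotate, Prod.norm_def, norm_mul, norm_fourier_apply, one_mul]

theorem fourier_pow (k : ℤ) (n : ℕ) (a : Torus) :
    (fourier k a : ℂ) ^ n = fourier (n * k) a := by
  induction n with
  | zero => simp
  | succ n ih => rw [pow_succ, ih, ← fourier_add]; congr 2; push_cast; ring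

theorem integral_fourier (k : ℤ) :
    ∫ a : Torus, (fourier k a : ℂ) ∂AddCircle.haarAddCircle = if k = 0 then 1 else 0 := by
  have := fourierCoeff_fourier_apply k 0
  simp only [fourierCoeff, neg_zero, fourier_zero, one_smul] at this
  rw [this]
  simp [eq_comm]

/-- The frequency of `z₁^a z̄₁^b z₂^c z̄₂^d`. -/
def monomialFreq (k₁ k₂ : ℤ) (q : Fin 4 → ℕ) : ℤ :=
  ((q 0 : ℤ) - q 1) * k₁ + ((q 2 : ℤ) - q 3) * k₂

/-- The monomial `z₁^a z̄₁^b z₂^c z̄₂^d`. -/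
noncomputable def conjMonomial (q : Fin 4 → ℕ) (z : ℂ × ℂ) : ℂ :=
  z.1 ^ q 0 * conj z.1 ^ q 1 * z.2 ^ q 2 * conj z.2 ^ q 3

theorem conjMonomial_rotate (k₁ k₂ : ℤ) (a : Torus) (q : Fin 4 → ℕ) (z : ℂ × ℂ) :
    conjMonomial q (rotate k₁ k₂ a z) =
      fourier (monomialFreq k₁ k₂ q) a * conjMonomial q z := by
  have h : monomialFreq k₁ k₂ q =
      q 0 * k₁ + q 1 * (-k₁) + q 2 * k₂ + q 3 * (-k₂) := by
    rw [monomialFreq]; ring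
  rw [h, fourier_add, fourier_add, fourier_add, ← fourier_pow, ← fourier_pow, ← fourier_pow,
    ← fourier_pow, fourier_neg, fourier_neg]
  simp only [conjMonomial, rotate, map_mul, mul_pow]
  ring

theorem conjMonomial_conj (q : Fin 4 → ℕ) (z : ℂ × ℂ) :
    conjMonomial q (conj z.1, conj z.2) = conj (conjMonomial q z) := by
  simp [conjMonomial]

/-- An equivariant function expands in equivariant monomials, with real coefficients. -/
theorem exists_hasSum_equivariant {k₁ k₂ : ℤ} {f : Param d × (ℂ × ℂ) → ℂ} {μ₀ : Param d}
    (hf : AnalyticAt ℝ f (μ₀, 0))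
    (hrot : ∀ᶠ p in 𝓝 (μ₀, (0 : ℂ × ℂ)), ∀ a : Torus,
      f (p.1, rotate k₁ k₂ a p.2) = fourier k₁ a * f p)
    (hconj : ∀ᶠ p in 𝓝 (μ₀, (0 : ℂ × ℂ)), f (p.1, (conj p.2.1, conj p.2.2)) = conj (f p)) :
    ∃ (I : Type) (c : I → ℝ) (β : I → Fin d → ℕ) (q : I → Fin 4 → ℕ),
      (∀ i, monomialFreq k₁ k₂ (q i) = k₁) ∧
      ∃ R > 0, Summable (fun i => ‖c i‖ * R ^ (∑ j, β i j + ∑ j, q i j)) ∧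
      ∀ v : Param d × (ℂ × ℂ), ‖v‖ ≤ R →
        HasSum (fun i => (c i : ℂ) * (∏ j, (v.1 j : ℂ) ^ β i j) * conjMonomial (q i) v.2)
          (f (μ₀ + v.1, v.2)) := by
  obtain ⟨I, hI, c, β, q, R, hR, hs, hsum⟩ := hf.exists_hasSum_conj_monomials
  have hev := hrot.and hconj
  rw [Metric.eventually_nhds_iff] at hev
  obtain ⟨δ, hδ, hev⟩ := hev
  set r := min R (δ / 2) with hr
  have hr0 : 0 < r := lt_min hR (half_pos hδ)
  have hsr : Summable fun i => ‖c i‖ * r ^ (∑ j, β i j + ∑ j, q i j) := by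
    refine Summable.of_nonneg_of_le (fun i => by positivity) (fun i => ?_) hs
    gcongr
    exact min_le_left _ _
  have hsum' : ∀ v : Param d × (ℂ × ℂ), ‖v‖ ≤ r → HasSum (fun i => c i *
      (∏ j, (v.1 j : ℂ) ^ β i j) * conjMonomial (q i) v.2) (f (μ₀ + v.1, v.2)) := by
    intro v hv
    have := hsum v (hv.trans (min_le_left _ _))
    simpa [conjMonomial, Prod.add_def] using this
  have hsym : ∀ v : Param d × (ℂ × ℂ), ‖v‖ ≤ r →
      (∀ a : Torus, f (μ₀ + v.1, rotate k₁ k₂ a v.2) = fourier k₁ a * f (μ₀ + v.1, v.2)) ∧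
      f (μ₀ + v.1, (conj v.2.1, conj v.2.2)) = conj (f (μ₀ + v.1, v.2)) := by
    intro v hv
    refine hev (y := (μ₀ + v.1, v.2)) ?_
    have : ((μ₀ + v.1, v.2) : Param d × (ℂ × ℂ)) = (μ₀, 0) + v := by simp [Prod.add_def]
    rw [this, dist_eq_norm, add_sub_cancel_left]
    exact (hv.trans (min_le_right _ _)).trans_lt (half_lt_self hδ)
  -- averaging over the rotations
  have havg : ∀ v : Param d × (ℂ × ℂ), ‖v‖ ≤ r → HasSum (fun i => (c i *
      (∏ j, (v.1 j : ℂ) ^ β i j) * conjMonomial (q i) v.2) *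
        if monomialFreq k₁ k₂ (q i) = k₁ then 1 else 0) (f (μ₀ + v.1, v.2)) := by
    intro v hv
    let G : I → Torus → ℂ := fun i a => (c i * (∏ j, (v.1 j : ℂ) ^ β i j) *
      conjMonomial (q i) v.2) * fourier (monomialFreq k₁ k₂ (q i) - k₁) a
    have hG : ∀ a, HasSum (fun i => G i a) (f (μ₀ + v.1, v.2)) := by
      intro a
      have h1 := (hsum' (v.1, rotate k₁ k₂ a v.2) (by
        rw [Prod.norm_def] at hv ⊢
        simpa only [norm_rotate] using hv)).mul_left (fourier (-k₁) a : ℂ)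
      rw [(hsym v hv).1 a, ← mul_assoc, ← fourier_add, neg_add_cancel, fourier_zero,
        one_mul] at h1
      refine h1.of_eq (fun i => ?_) rfl
      simp only [G]
      rw [conjMonomial_rotate, sub_eq_neg_add, fourier_add]
      ring
    have hn : ∀ i a, ‖G i a‖ = ‖(c i * (∏ j, (v.1 j : ℂ) ^ β i j) * conjMonomial (q i) v.2)‖ :=
      fun i a => by rw [norm_mul, norm_fourier_apply, mul_one]
    have h2 := hasSum_integral_of_summable_integral_norm (F := G)
      (μ := (AddCircle.haarAddCircle : Measure Torus))
      (fun i => (integrable_fourier _).const_mul _) (by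
        simp only [hn, integral_const, probReal_univ, one_smul]
        exact (hsum' v hv).summable.norm)
    simp only [(hG _).tsum_eq, integral_const, probReal_univ, one_smul] at h2
    refine h2.of_eq (fun i => ?_) rfl
    rw [integral_const_mul, integral_fourier]
    simp [sub_eq_zero]
  refine ⟨{i : I // monomialFreq k₁ k₂ (q i) = k₁}, fun i => (c i).re, fun i => β i,
    fun i => q i, fun i => i.2, r, hr0, ?_, fun v hv => ?_⟩
  · refine Summable.of_nonneg_of_le (fun i => by positivity) (fun i => ?_)
      (hsr.comp_injective Subtype.val_injective)
    simp only [Function.comp_apply]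
    gcongr
    exact Complex.abs_re_le_norm _
  · have h3 : ∀ v : Param d × (ℂ × ℂ), ‖v‖ ≤ r →
        HasSum (fun i : {i : I // monomialFreq k₁ k₂ (q i) = k₁} => c i *
          (∏ j, (v.1 j : ℂ) ^ β i j) * conjMonomial (q i) v.2) (f (μ₀ + v.1, v.2)) := by
      intro v hv
      have h := havg v hv
      rw [← hasSum_subtype_iff_of_support_subset
        (s := {i : I | monomialFreq k₁ k₂ (q i) = k₁})] at h
      · refine h.of_eq (fun i => ?_) rfl
        have : monomialFreq k₁ k₂ (q i) = k₁ := i.2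
        simp [this]
      · intro i hi
        by_contra hne
        exact hi (by simp [show ¬ monomialFreq k₁ k₂ (q i) = k₁ from hne])
    have h4 := h3 (v.1, (conj v.2.1, conj v.2.2)) (by
      simpa [Prod.norm_def] using hv)
    rw [(hsym v hv).2] at h4
    have h5 := h4.map (starRingEnd ℂ) Complex.continuous_conj
    rw [Complex.conj_conj] at h5
    -- The mean of the series and of the conjugate of its value at the conjugate point has
    -- coefficients `Re c`, and both represent `f`.
    have h6 := ((h3 v hv).add h5).mul_left (1 / 2 : ℂ)
    refine h6.of_eq (fun i => ?_) (by ring)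
    · simp only [Function.comp_apply, map_mul, map_prod, map_pow, Complex.conj_ofReal,
        conjMonomial_conj, Complex.conj_conj]
      rw [Complex.re_eq_add_conj]
      ring

end Expansion

/-! ### Normal form of equivariant functions in terms of invariants -/

section EquivariantDecomposition

variable {d : ℕ}

/-- The invariants `|z₁|²`, `|z₂|²` and `z₁^{k₂} z̄₂^{k₁}` of the rotation action. -/
noncomputable def invariants (k₁ k₂ : ℕ) (z : ℂ × ℂ) : ℝ × ℝ × ℂ :=
  (Complex.normSq z.1, Complex.normSq z.2, z.1 ^ k₂ * conj z.2 ^ k₁)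

/-- The monomial `z̄₁^{k₂-1} z₂^{k₁}`. -/
noncomputable def resonantMonomial (k₁ k₂ : ℕ) (z : ℂ × ℂ) : ℂ :=
  conj z.1 ^ (k₂ - 1) * z.2 ^ k₁

theorem conj_mul_resonantMonomial {k₁ k₂ : ℕ} (h₂ : 0 < k₂) (z : ℂ × ℂ) :
    conj z.1 * resonantMonomial k₁ k₂ z = conj (invariants k₁ k₂ z).2.2 := by
  obtain ⟨n, rfl⟩ : ∃ n, k₂ = n + 1 := ⟨k₂ - 1, by omega⟩
  simp only [resonantMonomial, invariants, map_mul, map_pow, Complex.conj_conj,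
    Nat.add_sub_cancel]
  ring

/-- The shape of an equivariant monomial. -/
theorem equivariant_monomial {k₁ k₂ : ℕ} (h₂ : 0 < k₂) (hc : Nat.Coprime k₁ k₂)
    (q : Fin 4 → ℕ) (hq : monomialFreq k₁ k₂ q = k₁) :
    (∃ t, q 0 = q 1 + 1 + t * k₂ ∧ q 3 = q 2 + t * k₁) ∨
      ∃ t, q 1 + 1 = q 0 + (t + 1) * k₂ ∧ q 2 = q 3 + (t + 1) * k₁ := by
  have h : ((q 0 : ℤ) - q 1 - 1) * k₁ = ((q 3 : ℤ) - q 2) * k₂ := by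
    rw [monomialFreq] at hq; linarith
  have hdvd : (k₂ : ℤ) ∣ (q 0 : ℤ) - q 1 - 1 :=
    (Nat.isCoprime_iff_coprime.2 hc.symm).dvd_of_dvd_mul_right ⟨(q 3 : ℤ) - q 2, by linarith⟩
  obtain ⟨t, ht⟩ := hdvd
  have ht' : (q 3 : ℤ) - q 2 = t * k₁ := by
    have : (k₂ : ℤ) ≠ 0 := by exact_mod_cast h₂.ne'
    apply mul_right_cancel₀ this
    rw [← h, ht]; ring
  -- For `t ≥ 0` the monomial is `z₁` times invariants with the power `ζ ^ t`. For `t < 0` it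
  -- contains one factor `z̄₁^{k₂-1} z₂^{k₁}`, and `-t - 1` powers of `conj ζ` are left over.
  rcases le_or_gt 0 t with h0 | h0
  · obtain ⟨n, rfl⟩ := Int.eq_ofNat_of_zero_le h0
    refine Or.inl ⟨n, ?_, ?_⟩
    · zify; linarith
    · zify; linarith
  · obtain ⟨n, hn⟩ := Int.eq_ofNat_of_zero_le (show 0 ≤ -t - 1 by omega)
    obtain rfl : t = -(n + 1) := by omega
    refine Or.inr ⟨n, ?_, ?_⟩
    · zify; linarith
    · zify; linarith

theorem conjMonomial_eq_pos {k₁ k₂ : ℕ} (q : Fin 4 → ℕ) (t : ℕ)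
    (h0 : q 0 = q 1 + 1 + t * k₂) (h3 : q 3 = q 2 + t * k₁) (z : ℂ × ℂ) :
    conjMonomial q z = z.1 * ((Complex.normSq z.1 : ℂ) ^ q 1 * (Complex.normSq z.2 : ℂ) ^ q 2 *
      (invariants k₁ k₂ z).2.2 ^ t) := by
  rw [conjMonomial, h0, h3, ← Complex.mul_conj, ← Complex.mul_conj]
  simp only [invariants, mul_pow, pow_add, pow_one, ← pow_mul, mul_comm t]
  ring

theorem conjMonomial_eq_neg {k₁ k₂ : ℕ} (h₂ : 0 < k₂) (q : Fin 4 → ℕ) (t : ℕ)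
    (h1 : q 1 + 1 = q 0 + (t + 1) * k₂) (h2 : q 2 = q 3 + (t + 1) * k₁) (z : ℂ × ℂ) :
    conjMonomial q z = resonantMonomial k₁ k₂ z * ((Complex.normSq z.1 : ℂ) ^ q 0 *
      (Complex.normSq z.2 : ℂ) ^ q 3 * conj (invariants k₁ k₂ z).2.2 ^ t) := by
  obtain ⟨n, rfl⟩ : ∃ n, k₂ = n + 1 := ⟨k₂ - 1, by omega⟩
  have h1' : q 1 = q 0 + n + t * (n + 1) := by
    have : (t + 1) * (n + 1) = n + t * (n + 1) + 1 := by ring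
    omega
  have h2' : q 2 = q 3 + k₁ + t * k₁ := by rw [h2]; ring
  rw [conjMonomial, h1', h2', ← Complex.mul_conj, ← Complex.mul_conj]
  simp only [invariants, resonantMonomial, map_mul, map_pow, Complex.conj_conj, mul_pow, pow_add,
    ← pow_mul, mul_comm t, Nat.add_sub_cancel]
  ring

/-- With `ζ` the third invariant, `i Im ζ` equals both `Re ζ - conj ζ` and `ζ - Re ζ`; moreover
`conj ζ * z₁` is `|z₁|²` times the resonant monomial, and `ζ` times the resonant monomial is a real
invariant times `z₁`. Hence imaginary parts of coefficients can be absorbed, leaving real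
coefficients. -/
theorem I_mul_im_invariants {k₁ k₂ : ℕ} (h₂ : 0 < k₂) (z : ℂ × ℂ) :
    Complex.I * (invariants k₁ k₂ z).2.2.im * z.1 = (invariants k₁ k₂ z).2.2.re * z.1 -
        (invariants k₁ k₂ z).1 * resonantMonomial k₁ k₂ z ∧
    Complex.I * (invariants k₁ k₂ z).2.2.im * resonantMonomial k₁ k₂ z =
      (invariants k₁ k₂ z).1 ^ (k₂ - 1) * (invariants k₁ k₂ z).2.1 ^ k₁ * z.1 -
        (invariants k₁ k₂ z).2.2.re * resonantMonomial k₁ k₂ z := by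
  obtain ⟨n, rfl⟩ : ∃ n, k₂ = n + 1 := ⟨k₂ - 1, by omega⟩
  rw [Complex.re_eq_add_conj, Complex.im_eq_sub_conj]
  simp only [invariants, resonantMonomial, ← Complex.mul_conj, map_mul, map_pow,
    Complex.conj_conj, mul_pow, Nat.add_sub_cancel, pow_succ]
  constructor
  · field_simp
    ring
  · field_simp
    ring

theorem exists_real_decomposition_param {I : Type} {c : I → ℝ} {β : I → Fin d → ℕ}
    {a b t : I → ℕ} {R : ℝ} (hR : 0 < R)
    (hs : Summable fun i => ‖c i‖ * R ^ (∑ j, β i j + (a i + b i) + t i)) :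
    ∃ G₀ G₁ : Param d × (ℝ × ℝ × ℂ) → ℝ, AnalyticAt ℝ G₀ 0 ∧ AnalyticAt ℝ G₁ 0 ∧
      ∀ᶠ p in 𝓝 (0 : Param d × (ℝ × ℝ × ℂ)),
        HasSum (fun i => (c i : ℂ) * (∏ j, (p.1 j : ℂ) ^ β i j) *
          ((p.2.1 : ℂ) ^ a i * (p.2.2.1 : ℂ) ^ b i * p.2.2.2 ^ t i))
          (G₀ p + Complex.I * p.2.2.2.im * G₁ p) := by
  let γ : I → Fin d ⊕ Fin 2 → ℕ := fun i => Sum.elim (β i) ![a i, b i]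
  obtain ⟨G₀, G₁, h0, h1, δ, hδ, hsum⟩ := exists_real_decomposition (c := c) (β := γ) (t := t) hR
    (by simpa [γ, Fintype.sum_sum_type] using hs)
  let Λ : Param d × (ℝ × ℝ × ℂ) →L[ℝ] (Fin d ⊕ Fin 2 → ℝ) × ℂ :=
    (ContinuousLinearMap.pi (Sum.elim
      (fun j => (EuclideanSpace.proj j : Param d →L[ℝ] ℝ).comp (ContinuousLinearMap.fst ℝ _ _))
      ![(ContinuousLinearMap.fst ℝ ℝ (ℝ × ℂ)).comp (ContinuousLinearMap.snd ℝ _ _),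
        ((ContinuousLinearMap.fst ℝ ℝ ℂ).comp (ContinuousLinearMap.snd ℝ _ _)).comp
          (ContinuousLinearMap.snd ℝ _ _)])).prod
      (((ContinuousLinearMap.snd ℝ ℝ ℂ).comp (ContinuousLinearMap.snd ℝ _ _)).comp
          (ContinuousLinearMap.snd ℝ _ _))
  refine ⟨fun p => G₀ (Λ p), fun p => G₁ (Λ p), AnalyticAt.fun_comp (by rwa [map_zero])
    (Λ.analyticAt 0), AnalyticAt.fun_comp (by rwa [map_zero]) (Λ.analyticAt 0), ?_⟩
  have hΛ : ∀ᶠ p in 𝓝 (0 : Param d × (ℝ × ℝ × ℂ)), ‖Λ p‖ < δ := by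
    have : Tendsto (fun p => ‖Λ p‖) (𝓝 0) (𝓝 ‖Λ 0‖) := (Λ.continuous.norm).tendsto 0
    rw [map_zero, norm_zero] at this
    exact this.eventually_lt_const hδ
  filter_upwards [hΛ] with p hp
  refine (hsum (Λ p) hp.le).of_eq (fun i => ?_) rfl
  simp [Λ, γ, Fintype.prod_sum_type, mul_assoc]

theorem continuous_invariants (k₁ k₂ : ℕ) : Continuous (invariants k₁ k₂) := by
  unfold invariants
  have h1 : Continuous fun z : ℂ × ℂ => Complex.normSq z.1 :=
    Complex.continuous_normSq.comp continuous_fst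
  have h2 : Continuous fun z : ℂ × ℂ => Complex.normSq z.2 :=
    Complex.continuous_normSq.comp continuous_snd
  have h3 : Continuous fun z : ℂ × ℂ => z.1 ^ k₂ * conj z.2 ^ k₁ :=
    (continuous_fst.pow _).mul ((Complex.continuous_conj.comp continuous_snd).pow _)
  exact h1.prodMk (h2.prodMk h3)

theorem invariants_zero {k₁ k₂ : ℕ} (h₂ : 0 < k₂) : invariants k₁ k₂ 0 = 0 := by
  simp [invariants, h₂.ne', Prod.ext_iff]

open Classical in
/-- An equivariant real-analytic function is a combination of `z₁` and `z̄₁^{k₂-1} z₂^{k₁}` with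
coefficients that are real-valued and analytic in the invariants. -/
theorem exists_equivariant_decomposition {k₁ k₂ : ℕ} (h₁ : 0 < k₁) (h₂ : 0 < k₂)
    (hc : Nat.Coprime k₁ k₂) {f : Param d × (ℂ × ℂ) → ℂ} {μ₀ : Param d}
    (hf : AnalyticAt ℝ f (μ₀, 0))
    (hrot : ∀ᶠ p in 𝓝 (μ₀, (0 : ℂ × ℂ)), ∀ a : Torus,
      f (p.1, rotate k₁ k₂ a p.2) = fourier k₁ a * f p)
    (hconj : ∀ᶠ p in 𝓝 (μ₀, (0 : ℂ × ℂ)), f (p.1, (conj p.2.1, conj p.2.2)) = conj (f p)) :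
    ∃ A B : Param d × (ℝ × ℝ × ℂ) → ℝ, AnalyticAt ℝ A (μ₀, 0) ∧ AnalyticAt ℝ B (μ₀, 0) ∧
      ∀ᶠ p in 𝓝 (μ₀, (0 : ℂ × ℂ)), f p = A (p.1, invariants k₁ k₂ p.2) * p.2.1 +
        B (p.1, invariants k₁ k₂ p.2) * resonantMonomial k₁ k₂ p.2 := by
  obtain ⟨I, c, β, q, hq, R₀, hR₀, hs₀, hsum₀⟩ := exists_hasSum_equivariant hf hrot hconj
  set R := min R₀ 1 with hRdef
  have hR : 0 < R := lt_min hR₀ one_pos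
  have hR1 : R ≤ 1 := min_le_right _ _
  have hs : Summable (fun i => ‖c i‖ * R ^ (∑ j, β i j + ∑ j, q i j)) :=
    Summable.of_nonneg_of_le (fun i => by positivity)
      (fun i => by gcongr; exact min_le_left _ _) hs₀
  have hsum : ∀ v : Param d × (ℂ × ℂ), ‖v‖ ≤ R →
      HasSum (fun i => (c i : ℂ) * (∏ j, (v.1 j : ℂ) ^ β i j) * conjMonomial (q i) v.2)
        (f (μ₀ + v.1, v.2)) := fun v hv => hsum₀ v (hv.trans (min_le_left _ _))
  let P : I → Prop := fun i => ∃ t, q i 0 = q i 1 + 1 + t * k₂ ∧ q i 3 = q i 2 + t * k₁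
  have hN : ∀ i, ¬ P i → ∃ t, q i 1 + 1 = q i 0 + (t + 1) * k₂ ∧
      q i 2 = q i 3 + (t + 1) * k₁ := fun i hi =>
    (equivariant_monomial h₂ hc (q i) (hq i)).resolve_left hi
  let t : I → ℕ := fun i => if h : P i then h.choose else (hN i h).choose
  have htP : ∀ i, P i → q i 0 = q i 1 + 1 + t i * k₂ ∧ q i 3 = q i 2 + t i * k₁ := by
    intro i h
    simp only [t, dif_pos h]
    exact h.choose_spec
  have htN : ∀ i, ¬ P i → q i 1 + 1 = q i 0 + (t i + 1) * k₂ ∧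
      q i 2 = q i 3 + (t i + 1) * k₁ := by
    intro i h
    simp only [t, dif_neg h]
    exact (hN i h).choose_spec
  let cP : I → ℝ := fun i => if P i then c i else 0
  let cN : I → ℝ := fun i => if P i then 0 else c i
  let a : I → ℕ := fun i => if P i then q i 1 else q i 0
  let b : I → ℕ := fun i => if P i then q i 2 else q i 3
  -- The degree in `z, z̄` is at most `k₁ + k₂` times the degree in the invariants, up to a
  -- constant. As `R ≤ 1`, the series in the invariants therefore converges absolutely for the
  -- radius `R ^ (k₁ + k₂)`.
  have hdeg : ∀ i, ∑ j, β i j + ∑ j, q i j ≤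
      (k₁ + k₂) * (∑ j, β i j + (a i + b i) + t i) + (k₁ + k₂) := by
    intro i
    rw [Fin.sum_univ_four]
    have hk : 2 ≤ k₁ + k₂ := by omega
    have hβ : ∑ j, β i j ≤ (k₁ + k₂) * ∑ j, β i j := Nat.le_mul_of_pos_left _ (by omega)
    have ha : 2 * a i ≤ (k₁ + k₂) * a i := Nat.mul_le_mul_right _ hk
    have hb : 2 * b i ≤ (k₁ + k₂) * b i := Nat.mul_le_mul_right _ hk
    rw [mul_add, mul_add, mul_add]
    by_cases h : P i
    · obtain ⟨e1, e2⟩ := htP i h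
      simp only [a, b, if_pos h] at ha hb ⊢
      have : (k₁ + k₂) * t i = t i * k₁ + t i * k₂ := by ring
      omega
    · obtain ⟨e1, e2⟩ := htN i h
      simp only [a, b, if_neg h] at ha hb ⊢
      have : (k₁ + k₂) * t i = t i * k₁ + t i * k₂ := by ring
      rw [add_mul, one_mul] at e1 e2
      omega
  set r := R ^ (k₁ + k₂) with hr
  have hr0 : 0 < r := by positivity
  have hsr : Summable fun i => ‖c i‖ * r ^ (∑ j, β i j + (a i + b i) + t i) := by
    refine Summable.of_nonneg_of_le (fun i => by positivity) (fun i => ?_)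
      (hs.mul_right (r⁻¹))
    rw [mul_assoc]
    gcongr
    rw [← div_eq_mul_inv, le_div_iff₀ hr0, hr, ← pow_mul, ← pow_add]
    exact pow_le_pow_of_le_one hR.le hR1 (hdeg i)
  have hle : ∀ (i) (x : ℝ), ‖(if P i then x else 0)‖ ≤ ‖x‖ ∧ ‖(if P i then 0 else x)‖ ≤ ‖x‖ := by
    intro i x
    split_ifs <;> simp
  obtain ⟨A₀, A₁, hA₀, hA₁, hA⟩ := exists_real_decomposition_param (c := cP) (β := β) (a := a)
    (b := b) (t := t) hr0 (Summable.of_nonneg_of_le (fun i => by positivity)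
      (fun i => by gcongr; exact (hle i _).1) hsr)
  obtain ⟨B₀, B₁, hB₀, hB₁, hB⟩ := exists_real_decomposition_param (c := cN) (β := β) (a := a)
    (b := b) (t := t) hr0 (Summable.of_nonneg_of_le (fun i => by positivity)
      (fun i => by gcongr; exact (hle i _).2) hsr)
  -- The monomials with the resonant factor carry powers of `conj ζ` instead of `ζ`.
  let J : Param d × (ℝ × ℝ × ℂ) →L[ℝ] Param d × (ℝ × ℝ × ℂ) :=
    (ContinuousLinearMap.id ℝ (Param d)).prodMap ((ContinuousLinearMap.id ℝ ℝ).prodMap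
      ((ContinuousLinearMap.id ℝ ℝ).prodMap (Complex.conjCLE : ℂ →L[ℝ] ℂ)))
  have hJ : ∀ p, J p = (p.1, p.2.1, p.2.2.1, conj p.2.2.2) := fun p => rfl
  let S : Param d × (ℝ × ℝ × ℂ) → Param d × (ℝ × ℝ × ℂ) := fun p => p - (μ₀, 0)
  have hS : AnalyticAt ℝ S (μ₀, 0) := analyticAt_id.sub analyticAt_const
  have hS0 : S (μ₀, 0) = 0 := sub_self _
  have hcomp : ∀ G : Param d × (ℝ × ℝ × ℂ) → ℝ, AnalyticAt ℝ G 0 →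
      AnalyticAt ℝ (fun p => G (S p)) (μ₀, 0) := fun G hG =>
    AnalyticAt.fun_comp (by rwa [hS0]) hS
  have hcompJ : ∀ G : Param d × (ℝ × ℝ × ℂ) → ℝ, AnalyticAt ℝ G 0 →
      AnalyticAt ℝ (fun p => G (J (S p))) (μ₀, 0) := fun G hG =>
    AnalyticAt.fun_comp (f := fun p => J (S p)) (by rwa [hS0, map_zero])
      ((J.analyticAt _).fun_comp hS)
  have hx : AnalyticAt ℝ (fun p : Param d × (ℝ × ℝ × ℂ) => p.2.2.2.re) (μ₀, 0) :=
    (Complex.reCLM.analyticAt _).fun_comp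
      (analyticAt_snd.fun_comp (analyticAt_snd.fun_comp analyticAt_snd))
  have hρ₁ : AnalyticAt ℝ (fun p : Param d × (ℝ × ℝ × ℂ) => p.2.1) (μ₀, 0) :=
    analyticAt_fst.fun_comp analyticAt_snd
  have hρ₂ : AnalyticAt ℝ (fun p : Param d × (ℝ × ℝ × ℂ) => p.2.2.1) (μ₀, 0) :=
    analyticAt_fst.fun_comp (analyticAt_snd.fun_comp analyticAt_snd)
  -- The coefficients found so far are `A₀ + i Im ζ A₁` and `B₀ - i Im ζ B₁`; the imaginary terms
  -- are redistributed between the two generators by `I_mul_im_invariants`.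
  refine ⟨fun p => A₀ (S p) + p.2.2.2.re * A₁ (S p) -
      p.2.1 ^ (k₂ - 1) * p.2.2.1 ^ k₁ * B₁ (J (S p)),
    fun p => B₀ (J (S p)) + p.2.2.2.re * B₁ (J (S p)) - p.2.1 * A₁ (S p),
    ((hcomp _ hA₀).add (hx.mul (hcomp _ hA₁))).sub
      (((hρ₁.pow _).mul (hρ₂.pow _)).mul (hcompJ _ hB₁)),
    ((hcompJ _ hB₀).add (hx.mul (hcompJ _ hB₁))).sub (hρ₁.mul (hcomp _ hA₁)), ?_⟩
  have hΦ : Tendsto (fun p : Param d × (ℂ × ℂ) => S (p.1, invariants k₁ k₂ p.2))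
      (𝓝 (μ₀, 0)) (𝓝 0) := by
    have : Continuous (fun p : Param d × (ℂ × ℂ) => S (p.1, invariants k₁ k₂ p.2)) :=
      (continuous_fst.prodMk ((continuous_invariants k₁ k₂).comp continuous_snd)).sub
        continuous_const
    have h := this.tendsto (μ₀, 0)
    rwa [invariants_zero h₂, hS0] at h
  have hΦJ : Tendsto (fun p : Param d × (ℂ × ℂ) => J (S (p.1, invariants k₁ k₂ p.2)))
      (𝓝 (μ₀, 0)) (𝓝 0) := by
    have := (J.continuous.tendsto 0).comp hΦ
    rwa [map_zero] at this
  have hball : ∀ᶠ p in 𝓝 (μ₀, (0 : ℂ × ℂ)), ‖p - (μ₀, 0)‖ ≤ R := by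
    filter_upwards [Metric.ball_mem_nhds (μ₀, (0 : ℂ × ℂ)) hR] with p hp
    rw [← dist_eq_norm]; exact (Metric.mem_ball.1 hp).le
  filter_upwards [hΦ.eventually hA, hΦJ.eventually hB, hball] with p hpA hpB hp
  obtain ⟨μ, z⟩ := p
  have h1 := hsum _ hp
  simp only [Prod.mk_sub_mk, sub_zero, add_sub_cancel] at h1
  set ζ : ℂ := (invariants k₁ k₂ z).2.2 with hζ
  have hA' := hpA.mul_left z.1
  have hB' := hpB.mul_left (resonantMonomial k₁ k₂ z)
  have h2 := h1.unique ((hA'.add hB').of_eq (fun i => ?_) rfl)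
  · rw [h2]
    obtain ⟨e1, e2⟩ := I_mul_im_invariants (k₁ := k₁) h₂ z
    have hJim : (J (S (μ, invariants k₁ k₂ z))).2.2.2.im = -(invariants k₁ k₂ z).2.2.im := by
      simp [hJ, S]
    have hSim : (S (μ, invariants k₁ k₂ z)).2.2.2.im = (invariants k₁ k₂ z).2.2.im := by
      simp [S]
    rw [hJim, hSim]
    push_cast
    linear_combination (A₁ (S (μ, invariants k₁ k₂ z)) : ℂ) * e1 -
      (B₁ (J (S (μ, invariants k₁ k₂ z))) : ℂ) * e2
  · have hSρ : (S (μ, invariants k₁ k₂ z)) = (μ - μ₀, invariants k₁ k₂ z) := by simp [S]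
    rw [hJ, hSρ]
    by_cases h : P i
    · obtain ⟨g1, g2⟩ := htP i h
      rw [conjMonomial_eq_pos (q i) (t i) g1 g2]
      simp only [cP, cN, a, b, if_pos h, invariants]
      push_cast
      ring
    · obtain ⟨g1, g2⟩ := htN i h
      rw [conjMonomial_eq_neg h₂ (q i) (t i) g1 g2]
      simp only [cP, cN, a, b, if_neg h, invariants]
      push_cast
      ring

end EquivariantDecomposition

/-! ### Analytic implicit functions and flatness along segments -/

section ImplicitFunction

/-- The analytic implicit function theorem, with the right-hand side as a parameter. -/
theorem AnalyticAt.exists_implicit_solution {E X Y : Type*} [NormedAddCommGroup E]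
    [NormedSpace ℝ E] [CompleteSpace E] [NormedAddCommGroup X] [NormedSpace ℝ X]
    [CompleteSpace X] [NormedAddCommGroup Y] [NormedSpace ℝ Y] [CompleteSpace Y]
    {f : E × X → Y} {a : E} {b : X} (hf : AnalyticAt ℝ f (a, b))
    (hbij : Function.Bijective fun x => fderiv ℝ f (a, b) (0, x)) :
    ∃ Φ : E × Y → X, AnalyticAt ℝ Φ (a, f (a, b)) ∧
      (∀ᶠ p in 𝓝 (a, f (a, b)), f (p.1, Φ p) = p.2) ∧
      ∀ᶠ p in 𝓝 (a, b), Φ (p.1, f p) = p.2 := by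
  -- Carrying the parameter along turns the problem into a local inversion; `Φ` is the second
  -- component of the inverse.
  let Ψ : E × X → E × Y := fun p => (p.1, f p)
  have hΨ : AnalyticAt ℝ Ψ (a, b) := analyticAt_fst.prod hf
  have hadd : ∀ (e : E) (x : X), fderiv ℝ f (a, b) (e, x) =
      fderiv ℝ f (a, b) (e, 0) + fderiv ℝ f (a, b) (0, x) := fun e x => by
    rw [← map_add]; simp
  let D : E × X →L[ℝ] E × Y := (ContinuousLinearMap.fst ℝ E X).prod (fderiv ℝ f (a, b))
  have hinj : D.ker = ⊥ := by
    rw [LinearMap.ker_eq_bot']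
    rintro ⟨e, x⟩ h
    have h1 : e = 0 := congrArg Prod.fst h
    have h2 : fderiv ℝ f (a, b) (e, x) = 0 := congrArg Prod.snd h
    subst h1
    have : x = 0 := hbij.1 (a₂ := 0) (by
      simp only [Prod.mk_zero_zero, map_zero]; exact h2)
    rw [this]; rfl
  have hsurj : D.range = ⊤ := by
    rw [LinearMap.range_eq_top]
    rintro ⟨e, y⟩
    obtain ⟨x, hx⟩ := hbij.2 (y - fderiv ℝ f (a, b) (e, 0))
    refine ⟨(e, x), Prod.ext rfl ?_⟩
    change fderiv ℝ f (a, b) (e, x) = y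
    rw [hadd]
    simp only at hx
    rw [hx]; abel
  let i : (E × X) ≃L[ℝ] (E × Y) := ContinuousLinearEquiv.ofBijective D hinj hsurj
  obtain ⟨p, hp⟩ := hΨ
  have hD : (continuousMultilinearCurryFin1 ℝ (E × X) (E × Y)) (p 1) = (i : E × X →L[ℝ] E × Y) := by
    refine hp.hasFDerivAt.unique ?_
    exact hasFDerivAt_fst.prodMk hf.differentiableAt.hasFDerivAt
  have hstrict : HasStrictFDerivAt Ψ (i : E × X →L[ℝ] E × Y) (a, b) := hD ▸ hp.hasStrictFDerivAt
  let G := hstrict.toOpenPartialHomeomorph Ψ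
  have hG : ⇑G = Ψ := hstrict.toOpenPartialHomeomorph_coe
  have hsource : (a, b) ∈ G.source := hstrict.mem_toOpenPartialHomeomorph_source
  have hsymm : AnalyticAt ℝ G.symm (G (a, b)) := by
    refine ⟨_, G.hasFPowerSeriesAt_symm hsource (i := i) (by rwa [hG]) ?_⟩
    rw [← hD, LinearIsometryEquiv.symm_apply_apply]
  have htarget : G (a, b) ∈ G.target := G.map_source hsource
  have hGab : G (a, b) = (a, f (a, b)) := by rw [hG]
  rw [hGab] at hsymm htarget
  refine ⟨fun q => (G.symm q).2, analyticAt_snd.fun_comp hsymm, ?_, ?_⟩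
  · filter_upwards [G.open_target.mem_nhds htarget] with q hq
    have h := G.right_inv hq
    rw [hG] at h
    have h1 : (G.symm q).1 = q.1 := congrArg Prod.fst h
    have h2 : f (G.symm q) = q.2 := congrArg Prod.snd h
    rw [← h1, ← h2]
  · filter_upwards [G.open_source.mem_nhds hsource] with q hq
    have h := G.left_inv hq
    rw [hG] at h
    exact congrArg Prod.snd h

/-- An analytic function which is flat at the origin of a segment vanishes at its other end. -/
theorem eq_zero_of_isBigO_pow_along_segment {V F : Type*} [NormedAddCommGroup V]
    [NormedSpace ℝ V] [NormedAddCommGroup F] [NormedSpace ℝ F] {g : V → F} {v : V}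
    (hg : ∀ t ∈ Set.Icc (0 : ℝ) 1, AnalyticAt ℝ g (t • v))
    (hflat : ∀ n : ℕ, (fun t : ℝ => g (t • v)) =O[𝓝 0] fun t => t ^ n) : g v = 0 := by
  let φ : ℝ → F := fun t => g (t • v)
  have hφ : AnalyticOnNhd ℝ φ (Set.Icc 0 1) := fun t ht =>
    AnalyticAt.fun_comp (f := fun t : ℝ => t • v) (hg t ht)
      ((ContinuousLinearMap.toSpanSingleton ℝ v).analyticAt t)
  -- Otherwise `φ = t ^ n h` near `0` with `h 0 ≠ 0`, and the bound of order `n + 1` forces `h 0 =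
  -- 0`.
  have h0 : φ =ᶠ[𝓝 0] 0 := by
    by_contra hne
    obtain ⟨n, h, hh, hh0, heq⟩ := ((hφ 0 (by simp)).exists_eventuallyEq_pow_smul_nonzero_iff).2
      hne
    have h1 : h =O[𝓝[≠] 0] fun t : ℝ => t := by
      obtain ⟨C, hC⟩ := (hflat (n + 1)).bound
      refine Asymptotics.IsBigO.of_bound C ?_
      filter_upwards [(hC.and heq).filter_mono nhdsWithin_le_nhds, self_mem_nhdsWithin]
        with t ht ht0
      obtain ⟨ht1, ht2⟩ := ht
      simp only [φ, sub_zero] at ht2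
      rw [ht2, norm_smul, pow_succ, norm_mul] at ht1
      have : 0 < ‖t ^ n‖ := norm_pos_iff.2 (pow_ne_zero _ ht0)
      refine le_of_mul_le_mul_left ?_ this
      linarith
    have h2 : Tendsto h (𝓝[≠] 0) (𝓝 0) :=
      h1.trans_tendsto (tendsto_id.mono_left nhdsWithin_le_nhds)
    exact hh0 (tendsto_nhds_unique (hh.continuousAt.tendsto.mono_left nhdsWithin_le_nhds) h2)
  have := hφ.eqOn_zero_of_preconnected_of_eventuallyEq_zero (convex_Icc 0 1).isPreconnected
    (show (0 : ℝ) ∈ Set.Icc (0 : ℝ) 1 by simp) h0 (show (1 : ℝ) ∈ Set.Icc (0 : ℝ) 1 by simp)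
  simpa [φ] using this

end ImplicitFunction

/-! ### Taylor expansion of the nonlinearity -/

namespace PeriodicEquation

variable {d : ℕ} {X Y : Type*} [NormedAddCommGroup X] [NormedSpace ℝ X] [PeriodicSpace X]
  [NormedAddCommGroup Y] [NormedSpace ℝ Y] [PeriodicSpace Y] (E : PeriodicEquation d X Y)

section Taylor

variable {E} {μ : Param d}

theorem N_zero (h2 : E.MultilinearFourierSeries) (hμ : μ ∈ E.M) : E.N μ 0 = 0 := by
  have h := (h2 μ hμ).1.self_of_nhds
  have h0 : ∀ j : ℕ, E.Nterm (j + 2) μ (fun _ => (0 : X)) = 0 := fun j =>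
    (E.Nterm (j + 2) μ).map_coord_zero 0 rfl
  simp only [h0] at h
  exact h.unique hasSum_zero

theorem F_zero (h2 : E.MultilinearFourierSeries) (hμ : μ ∈ E.M) : E.F μ 0 = 0 := by
  rw [F, N_zero h2 hμ, map_zero, add_zero]

theorem analyticAt_N (h4 : E.Analytic) (hμ : μ ∈ E.M) : AnalyticAt ℝ (E.N μ) 0 := by
  have h1 : AnalyticAt ℝ (fun u : X => E.F μ u) 0 :=
    AnalyticAt.fun_comp (g := fun p : Param d × X => E.F p.1 p.2) (f := fun u : X => (μ, u))
      (h4 μ hμ) (analyticAt_const.prod analyticAt_id)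
  have h2 := h1.sub ((E.L μ).analyticAt 0)
  refine h2.congr (Eventually.of_forall fun u => ?_)
  simp [F]

/-- The terms `Nterm` are not assumed continuous or symmetric, so they cannot serve as the power
series itself. Only diagonal values agree, and this follows from uniqueness of one-variable power
series along each line `t ↦ t u`. -/
theorem exists_hasFPowerSeriesAt_N (h2 : E.MultilinearFourierSeries) (h4 : E.Analytic)
    (hμ : μ ∈ E.M) : ∃ p : FormalMultilinearSeries ℝ X Y, HasFPowerSeriesAt (E.N μ) p 0 ∧ ∀ᶠ u in 𝓝 (0 : X),
      p 0 (fun _ => u) = 0 ∧ p 1 (fun _ => u) = 0 ∧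
        ∀ m, p (m + 2) (fun _ => u) = E.Nterm (m + 2) μ (fun _ => u) := by
  obtain ⟨p, hp⟩ := analyticAt_N h4 hμ
  refine ⟨p, hp, ?_⟩
  have hev := hp.eventually_hasSum.and (h2 μ hμ).1
  obtain ⟨δ, hδ, hball⟩ := Metric.eventually_nhds_iff_ball.1 hev
  refine Metric.eventually_nhds_iff_ball.2 ⟨δ, hδ, fun u hu => ?_⟩
  let a : ℕ → Y := fun n => p n fun _ => u
  let b : ℕ → Y := fun n => match n with
    | 0 => 0
    | 1 => 0
    | m + 2 => E.Nterm (m + 2) μ fun _ => u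
  let S : (ℕ → Y) → FormalMultilinearSeries ℝ ℝ Y := fun c n =>
    ContinuousMultilinearMap.mkPiRing ℝ (Fin n) (c n)
  have hS : ∀ c n, (S c).coeff n = c n := fun c n => by
    simp [S, FormalMultilinearSeries.coeff]
  have hsmall : ∀ᶠ t : ℝ in 𝓝 0, t • u ∈ Metric.ball (0 : X) δ := by
    have : Tendsto (fun t : ℝ => t • u) (𝓝 0) (𝓝 ((0 : ℝ) • u)) :=
      (continuous_id.smul continuous_const).tendsto 0
    rw [zero_smul] at this
    exact this.eventually (Metric.ball_mem_nhds _ hδ)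
  have hA : HasFPowerSeriesAt (fun t : ℝ => E.N μ (t • u)) (S a) 0 := by
    rw [hasFPowerSeriesAt_iff]
    filter_upwards [hsmall] with t ht
    have := (hball _ ht).1
    simp only [zero_add] at this ⊢
    refine this.of_eq (fun n => ?_) rfl
    rw [hS, ContinuousMultilinearMap.map_smul_univ]
    simp [a]
  have hB : HasFPowerSeriesAt (fun t : ℝ => E.N μ (t • u)) (S b) 0 := by
    rw [hasFPowerSeriesAt_iff]
    filter_upwards [hsmall] with t ht
    have := (hball _ ht).2
    rw [zero_add, ← hasSum_nat_add_iff' 2]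
    simp only [Finset.sum_range_succ, Finset.sum_range_zero, hS, b, smul_zero, add_zero, sub_zero]
    refine this.of_eq (fun n => ?_) rfl
    rw [MultilinearMap.map_smul_univ]
    simp
  have hab : ∀ n, a n = b n := fun n => by
    rw [← hS a, ← hS b, hA.eq_formalMultilinearSeries hB]
  exact ⟨hab 0, hab 1, fun m => hab (m + 2)⟩

/-- The nonlinearity has no linear term: `p 1` vanishes on small vectors, hence on all vectors by
homogeneity. -/
theorem hasFDerivAt_F (h2 : E.MultilinearFourierSeries) (h4 : E.Analytic) (hμ : μ ∈ E.M) :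
    HasFDerivAt (fun u => E.F μ u) (E.L μ) 0 := by
  obtain ⟨p, hp, hpN⟩ := exists_hasFPowerSeriesAt_N h2 h4 hμ
  have h1 := hp.hasFDerivAt
  have h0 : continuousMultilinearCurryFin1 ℝ X Y (p 1) = 0 := by
    ext u
    have hsmall : Tendsto (fun t : ℝ => t • u) (𝓝[≠] 0) (𝓝 0) := by
      have : Tendsto (fun t : ℝ => t • u) (𝓝 0) (𝓝 ((0 : ℝ) • u)) :=
        (continuous_id.smul continuous_const).tendsto 0
      rw [zero_smul] at this
      exact this.mono_left nhdsWithin_le_nhds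
    obtain ⟨t, ht, ht0⟩ := ((hsmall.eventually hpN).and self_mem_nhdsWithin).exists
    have h3 := ht.2.1
    rw [(p 1).map_smul_univ] at h3
    simp only [Finset.prod_const, Finset.card_univ, Fintype.card_fin, pow_one, smul_eq_zero] at h3
    have h4 : p 1 (fun _ => u) = 0 := h3.resolve_left ht0
    rw [continuousMultilinearCurryFin1_apply]
    refine Eq.trans (congrArg (p 1) (funext fun i => ?_)) h4
    obtain rfl : i = 0 := Fin.ext (by have := i.2; omega)
    rfl
  rw [h0] at h1
  have := (E.L μ).hasFDerivAt (x := (0 : X)) |>.add h1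
  rw [add_zero] at this
  exact this

/-- Truncation of the expansion of `N`. -/
theorem N_sub_sum_isBigO (h2 : E.MultilinearFourierSeries) (h4 : E.Analytic) (hμ : μ ∈ E.M)
    (n : ℕ) : (fun u : X => E.N μ u - ∑ m ∈ Finset.Icc 2 n, E.Nterm m μ (fun _ => u)) =O[𝓝 0]
      fun u => ‖u‖ ^ (n + 1) := by
  obtain ⟨p, hp, hpN⟩ := exists_hasFPowerSeriesAt_N h2 h4 hμ
  refine (hp.isBigO_sub_partialSum_pow (n + 1)).congr' ?_ EventuallyEq.rfl
  filter_upwards [hpN] with u hu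
  rw [zero_add, FormalMultilinearSeries.partialSum]
  congr 1
  have h1 : ∀ m, 2 ≤ m → p m (fun _ => u) = E.Nterm m μ fun _ => u := fun m hm => by
    obtain ⟨k, rfl⟩ := Nat.exists_eq_add_of_le' hm
    exact hu.2.2 k
  symm
  rw [← Finset.sum_congr rfl fun m hm => h1 m (Finset.mem_Icc.1 hm).1]
  refine Finset.sum_subset (fun m hm => ?_) fun m hm hm' => ?_
  · rw [Finset.mem_range]; have := (Finset.mem_Icc.1 hm).2; omega
  · rw [Finset.mem_range] at hm
    rw [Finset.mem_Icc] at hm'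
    have : m = 0 ∨ m = 1 := by omega
    rcases this with rfl | rfl
    · exact hu.1
    · exact hu.2.1

end Taylor

/-! ### Lyapunov-Schmidt reduction -/

section Reduction

variable {E} {μ₀ : Param d} {K : Finset ℤ}

/-- The map `F - P_K F + P_K`, which has an invertible derivative at `(μ₀, 0)`. -/
noncomputable def augmented (E : PeriodicEquation d X Y) (K : Finset ℤ) (p : Param d × X) : Y :=
  E.F p.1 p.2 - modeProj Y K (E.F p.1 p.2) + modeProj Y K p.2

theorem neg_mem_kernelSet (h1 : E.FredholmMultiplier) (hμ₀ : μ₀ ∈ E.M) {k : ℤ}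
    (hk : k ∈ E.kernelSet μ₀) : -k ∈ E.kernelSet μ₀ :=
  ⟨neg_mem_modes hk.1, by rw [(h1 μ₀ hμ₀).2.2.2 k hk.1]; exact hk.2⟩

theorem coeff_augmented (hK : ∀ k ∈ K, k ∈ modes Y) (hneg : ∀ k ∈ K, -k ∈ K)
    (p : Param d × X) (k : ℤ) : coeff (augmented E K p) k =
      if k ∈ K then coeff p.2 k else coeff (E.F p.1 p.2) k := by
  rw [augmented, coeff_add, coeff_sub, coeff_modeProj hK hneg, coeff_modeProj hK hneg]
  split_ifs <;> ring

theorem augmented_analyticAt (h4 : E.Analytic) (hμ₀ : μ₀ ∈ E.M) :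
    AnalyticAt ℝ (augmented E K) (μ₀, 0) :=
  ((h4 μ₀ hμ₀).sub (((modeProj Y K : Y →L[ℝ] Y).analyticAt _).fun_comp (h4 μ₀ hμ₀))).add
    (((modeProj Y K : X →L[ℝ] Y).analyticAt _).fun_comp analyticAt_snd)

/-- The linearization of the augmented map. -/
noncomputable def augmentedL (E : PeriodicEquation d X Y) (K : Finset ℤ) (μ : Param d) :
    X →L[ℝ] Y :=
  E.L μ - (modeProj Y K).comp (E.L μ) + modeProj Y K

theorem hasFDerivAt_augmented (h2 : E.MultilinearFourierSeries) (h4 : E.Analytic) {μ : Param d}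
    (hμ : μ ∈ E.M) : HasFDerivAt (fun u => augmented E K (μ, u)) (augmentedL E K μ) 0 :=
  ((hasFDerivAt_F h2 h4 hμ).sub
    ((modeProj Y K : Y →L[ℝ] Y).hasFDerivAt.comp 0 (hasFDerivAt_F h2 h4 hμ))).add
    (modeProj Y K : X →L[ℝ] Y).hasFDerivAt

theorem coeff_augmentedL (h1 : E.FredholmMultiplier) (hK : ∀ k ∈ K, k ∈ modes Y)
    (hneg : ∀ k ∈ K, -k ∈ K) {μ : Param d} (hμ : μ ∈ E.M) (u : X) (k : ℤ) :
    coeff (augmentedL E K μ u) k =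
      if k ∈ K then coeff u k else (E.l μ k : ℂ) * coeff u k := by
  have : augmentedL E K μ u = E.L μ u - modeProj Y K (E.L μ u) + modeProj Y K u := rfl
  rw [this, coeff_add, coeff_sub, coeff_modeProj hK hneg, coeff_modeProj hK hneg,
    (h1 μ hμ).2.2.1]
  split_ifs <;> ring

/-- Injectivity is read off the coefficients: those in `K` are kept, the others are multiplied by
nonzero symbols. For surjectivity no bound on the inverse symbols is available, and the index is
used instead: elements of the range of `L` have no modes in `K`, so the kernel injects into the
cokernel, and equal dimensions make this map onto. -/
theorem bijective_augmentedL (hmodes : modes X = modes Y) (h1 : E.FredholmMultiplier)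
    (hμ₀ : μ₀ ∈ E.M) (hK : (K : Set ℤ) = E.kernelSet μ₀) :
    Function.Bijective (augmentedL E K μ₀) := by
  have hmem : ∀ k, k ∈ K ↔ k ∈ E.kernelSet μ₀ := fun k => by rw [← hK]; rfl
  have hKX : ∀ k ∈ K, k ∈ modes X := fun k hk => ((hmem k).1 hk).1
  have hKY : ∀ k ∈ K, k ∈ modes Y := fun k hk => hmodes ▸ hKX k hk
  have hneg : ∀ k ∈ K, -k ∈ K := fun k hk =>
    (hmem _).2 (neg_mem_kernelSet h1 hμ₀ ((hmem k).1 hk))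
  have hl : ∀ k ∈ K, E.l μ₀ k = 0 := fun k hk => ((hmem k).1 hk).2
  obtain ⟨hfred, hindex, hmult, -⟩ := h1 μ₀ hμ₀
  have := hfred.finite_ker
  have : FiniteDimensional ℝ (Y ⧸ (E.L μ₀).range) := hfred.finite_coker
  have hPL : ∀ u : X, modeProj Y K (E.L μ₀ u) = (0 : Y) := fun u => eq_of_coeff_eq fun k => by
    rw [coeff_modeProj hKY hneg, hmult, coeff_zero]
    split_ifs with hk
    · rw [hl k hk]; simp
    · rfl
  have hcoef : ∀ (u : X) (k : ℤ), k ∉ K → coeff (E.L μ₀ u) k = 0 → coeff u k = 0 := by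
    intro u k hk h
    by_cases hkX : k ∈ modes X
    · rw [hmult, mul_eq_zero] at h
      refine h.resolve_left fun h0 => hk ((hmem k).2 ⟨hkX, by exact_mod_cast h0⟩)
    · exact coeff_eq_zero_of_notMem_modes hkX u
  constructor
  · rw [injective_iff_map_eq_zero]
    intro u hu
    refine eq_of_coeff_eq fun k => ?_
    have h := coeff_augmentedL h1 hKY hneg hμ₀ u k
    rw [hu, coeff_zero] at h
    rw [coeff_zero]
    split_ifs at h with hk
    · exact h.symm
    · rw [← hmult] at h
      exact hcoef u k hk h.symm
  · have happ : ∀ u : X, augmentedL E K μ₀ u = E.L μ₀ u + modeProj Y K u := fun u => by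
      have : augmentedL E K μ₀ u = E.L μ₀ u - modeProj Y K (E.L μ₀ u) + modeProj Y K u := rfl
      rw [this, hPL, sub_zero]
    -- the kernel maps isomorphically onto the cokernel
    let q : (E.L μ₀).ker →ₗ[ℝ] Y ⧸ (E.L μ₀).range :=
      (Submodule.mkQ (E.L μ₀).range).comp
        ((modeProj Y K : X →L[ℝ] Y).toLinearMap.comp (Submodule.subtype _))
    have hq : Function.Injective q := by
      rw [injective_iff_map_eq_zero]
      rintro ⟨u, hu⟩ h
      obtain ⟨x, hx⟩ := (Submodule.Quotient.mk_eq_zero _).1 h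
      have hx' : E.L μ₀ x = modeProj Y K u := hx
      have hu' : E.L μ₀ u = 0 := hu
      refine Subtype.ext (eq_of_coeff_eq fun k => ?_)
      change coeff u k = coeff (0 : X) k
      rw [coeff_zero]
      by_cases hk : k ∈ K
      · have := congrArg (fun y => coeff y k) hx'
        simp only [hmult, hl k hk, coeff_modeProj hKY hneg, if_pos hk] at this
        simpa using this.symm
      · exact hcoef u k hk (by rw [hu', coeff_zero])
    have hqs : Function.Surjective q :=
      (LinearMap.injective_iff_surjective_of_finrank_eq_finrank hindex).1 hq
    intro y
    obtain ⟨⟨u, hu⟩, hqu⟩ := hqs (Submodule.Quotient.mk y)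
    have hu' : E.L μ₀ u = 0 := hu
    obtain ⟨x, hx⟩ := (Submodule.Quotient.eq _).1 hqu.symm
    have hx' : E.L μ₀ x = y - modeProj Y K u := hx
    -- Removing the modes in `K` from `x` leaves `L x` unchanged and avoids a second contribution of
    -- the projection.
    refine ⟨u + (x - modeProj X K x), ?_⟩
    have e1 : E.L μ₀ (modeProj X K x) = 0 := eq_of_coeff_eq fun k => by
      rw [hmult, coeff_modeProj hKX hneg, coeff_zero]
      split_ifs with hk
      · rw [hl k hk]; simp
      · simp
    have e2 : modeProj Y K (modeProj X K x : X) = (modeProj Y K x : Y) :=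
      eq_of_coeff_eq fun k => by
        rw [coeff_modeProj hKY hneg, coeff_modeProj hKX hneg, coeff_modeProj hKY hneg]
        split_ifs <;> rfl
    rw [happ, map_add, map_add, map_sub, map_sub, e1, e2, hu', hx']
    abel

theorem augmented_zero (h2 : E.MultilinearFourierSeries) {μ : Param d} (hμ : μ ∈ E.M) :
    augmented E K (μ, 0) = 0 := by
  simp [augmented, F_zero h2 hμ]

/-- Lyapunov-Schmidt reduction: the local inverse of the augmented map. -/
theorem exists_reduction [CompleteSpace X] [CompleteSpace Y] (hmodes : modes X = modes Y)
    (h1 : E.FredholmMultiplier) (h2 : E.MultilinearFourierSeries) (h4 : E.Analytic)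
    (hμ₀ : μ₀ ∈ E.M) (hK : (K : Set ℤ) = E.kernelSet μ₀) :
    ∃ Φ : Param d × Y → X, AnalyticAt ℝ Φ (μ₀, 0) ∧
      (∀ᶠ p in 𝓝 (μ₀, (0 : Y)), augmented E K (p.1, Φ p) = p.2) ∧
      ∀ᶠ p in 𝓝 (μ₀, (0 : X)), Φ (p.1, augmented E K p) = p.2 := by
  have han : AnalyticAt ℝ (augmented E K) (μ₀, 0) := augmented_analyticAt h4 hμ₀
  have hder : ∀ x, fderiv ℝ (augmented E K) (μ₀, 0) (0, x) = augmentedL E K μ₀ x := by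
    intro x
    have e1 := (han.differentiableAt.hasFDerivAt).comp (0 : X)
      ((hasFDerivAt_const μ₀ (0 : X)).prodMk (hasFDerivAt_id (0 : X)))
    have := e1.unique (hasFDerivAt_augmented h2 h4 hμ₀)
    rw [← this]
    simp
  have := han.exists_implicit_solution (by
    simp only [hder]
    exact bijective_augmentedL hmodes h1 hμ₀ hK)
  rwa [augmented_zero h2 hμ₀] at this

end Reduction

end PeriodicEquation

namespace PeriodicEquation

/-! ### Combinatorics of the indices -/

section IndexCombinatorics

theorem freq_sum (k₁ k₂ : ℤ) {m : ℕ} (q : Fin m → Index) :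
    freq k₁ k₂ (∑ i, q i) = ∑ i, freq k₁ k₂ (q i) := by
  simp only [freq, Prod.fst_sum, Prod.snd_sum, Finset.sum_add_distrib, ← Finset.sum_mul,
    Finset.sum_sub_distrib, Nat.cast_sum]

theorem freq_swap (k₁ k₂ : ℤ) (p : Index) : freq k₁ k₂ p.swap = -freq k₁ k₂ p := by
  simp only [freq, Prod.fst_swap, Prod.snd_swap]
  ring

theorem size_swap (p : Index) : size p.swap = size p := by
  simp only [size, Prod.fst_swap, Prod.snd_swap]
  ring

theorem mem_decompositions {m : ℕ} {p : Index} {q : Fin m → Index} :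
    q ∈ decompositions m p ↔ ∑ i, q i = p := by
  rw [decompositions, Finset.mem_filter, Fintype.mem_piFinset, and_iff_right_iff_imp]
  rintro rfl i
  rw [Finset.mem_Iic]
  exact Finset.single_le_sum (f := q) (fun j _ => zero_le) (Finset.mem_univ i)

/-- With at least two parts, a part of full size leaves nothing for the others. As `û` vanishes at
size zero, every nonzero term of the recursion has only smaller parts, which permits induction on
the size. -/
theorem size_lt_or_exists_zero {m : ℕ} (hm : 2 ≤ m) {p : Index} {q : Fin m → Index}
    (hq : q ∈ decompositions m p) : (∀ i, size (q i) < size p) ∨ ∃ i, size (q i) = 0 := by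
  by_contra! h
  obtain ⟨⟨i, hi⟩, h0⟩ := h
  have : Nontrivial (Fin m) := Fin.nontrivial_iff_two_le.mpr hm
  obtain ⟨j, hj⟩ := exists_ne i
  have hsum : ∑ i, size (q i) = size p := by rw [← size_sum, mem_decompositions.1 hq]
  have hle : size (q i) + size (q j) ≤ ∑ i, size (q i) := by
    rw [← Finset.sum_pair (f := fun t => size (q t)) hj.symm]
    exact Finset.sum_le_sum_of_subset (Finset.subset_univ _)
  have := h0 j
  omega

/-- The monomial `z^α z̄^γ`. -/
noncomputable def indexMonomial (p : Index) (z : ℂ × ℂ) : ℂ :=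
  z.1 ^ p.1.1 * z.2 ^ p.1.2 * conj z.1 ^ p.2.1 * conj z.2 ^ p.2.2

theorem indexMonomial_sum {m : ℕ} (q : Fin m → Index) (z : ℂ × ℂ) :
    indexMonomial (∑ i, q i) z = ∏ i, indexMonomial (q i) z := by
  simp only [indexMonomial, Prod.fst_sum, Prod.snd_sum, Finset.prod_mul_distrib,
    Finset.prod_pow_eq_pow_sum]

theorem indexMonomial_swap (p : Index) (z : ℂ × ℂ) :
    indexMonomial p.swap z = conj (indexMonomial p z) := by
  simp only [indexMonomial, Prod.fst_swap, Prod.snd_swap, map_mul, map_pow, Complex.conj_conj]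
  ring

theorem indexMonomial_conj (p : Index) (z : ℂ × ℂ) :
    indexMonomial p (conj z.1, conj z.2) = conj (indexMonomial p z) := by
  simp only [indexMonomial, map_mul, map_pow, Complex.conj_conj]

theorem indexMonomial_rotate (k₁ k₂ : ℤ) (a : Torus) (p : Index) (z : ℂ × ℂ) :
    indexMonomial p (rotate k₁ k₂ a z) = fourier (freq k₁ k₂ p) a * indexMonomial p z := by
  have := conjMonomial_rotate k₁ k₂ a ![p.1.1, p.2.1, p.1.2, p.2.2] z
  simp only [conjMonomial, monomialFreq, Matrix.cons_val] at this
  rw [freq]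
  simp only [indexMonomial]
  linear_combination this

/-- The indices of size at most `n`. -/
def indexBox (n : ℕ) : Finset Index := (Finset.Iic ((n, n), (n, n))).filter fun p => size p ≤ n

theorem mem_indexBox {n : ℕ} {p : Index} : p ∈ indexBox n ↔ size p ≤ n := by
  rw [indexBox, Finset.mem_filter, Finset.mem_Iic, and_iff_right_iff_imp]
  intro h
  simp only [size] at h
  exact ⟨⟨by simp only; omega, by simp only; omega⟩, ⟨by simp only; omega, by simp only; omega⟩⟩

theorem sum_indexBox_swap {M : Type*} [AddCommMonoid M] (n : ℕ) (g : Index → M) :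
    ∑ p ∈ indexBox n, g p.swap = ∑ p ∈ indexBox n, g p := by
  refine Finset.sum_nbij' Prod.swap Prod.swap ?_ ?_ ?_ ?_ ?_
  · intro p hp; rw [mem_indexBox] at *; rwa [size_swap]
  · intro p hp; rw [mem_indexBox] at *; rwa [size_swap]
  · intro p _; exact Prod.swap_swap p
  · intro p _; exact Prod.swap_swap p
  · intro p _; rfl

theorem size_eq_one_iff (p : Index) : size p = 1 ↔
    p = ((1, 0), (0, 0)) ∨ p = ((0, 1), (0, 0)) ∨ p = ((0, 0), (1, 0)) ∨ p = ((0, 0), (0, 1)) := by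
  obtain ⟨⟨a, b⟩, c, e⟩ := p
  simp only [size, Prod.mk.injEq]
  omega

end IndexCombinatorics

variable {d : ℕ} {X Y : Type*} [NormedAddCommGroup X] [NormedSpace ℝ X] [PeriodicSpace X]
  [NormedAddCommGroup Y] [NormedSpace ℝ Y] [PeriodicSpace Y] {E : PeriodicEquation d X Y}

/-! ### Vanishing and symmetry of the coefficients -/

section Coefficients

variable {μ₀ μ : Param d} {k₁ k₂ : ℤ}

theorem uhat_of_size_zero {p : Index} (h : size p = 0) : E.uhat μ₀ k₁ k₂ μ p = 0 := by
  rw [uhat, if_pos h]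

theorem uhat_of_size_one {p : Index} (h : size p = 1) : E.uhat μ₀ k₁ k₂ μ p = 1 / 2 := by
  rw [uhat, if_neg (by omega), if_pos h]

theorem nhat_of_size_lt {p : Index} (h : size p < 2) : E.nhat μ₀ k₁ k₂ μ p = 0 := by
  rw [nhat, Finset.Icc_eq_empty (by omega), Finset.sum_empty]

theorem freq_mem_of_size_one {S : Set ℤ} (hS : ∀ k ∈ S, -k ∈ S) (h₁ : k₁ ∈ S) (h₂ : k₂ ∈ S)
    {p : Index} (hp : size p = 1) : freq k₁ k₂ p ∈ S := by
  rcases (size_eq_one_iff p).1 hp with rfl | rfl | rfl | rfl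
  · simpa [freq] using h₁
  · simpa [freq] using h₂
  · simpa [freq] using hS _ h₁
  · simpa [freq] using hS _ h₂

/-- This justifies the convention on wavenumbers outside the spaces: either a factor `û` has such a
frequency, or all parts are modes of `X` and the symbol at their sum is zero. -/
theorem nhat_eq_zero_aux (hmodes : modes X = modes Y) (h2 : E.MultilinearFourierSeries)
    (hμ : μ ∈ E.M) {p : Index} (ih : ∀ q : Index, size q < size p → freq k₁ k₂ q ∉ modes X →
      E.uhat μ₀ k₁ k₂ μ q = 0) (hp : freq k₁ k₂ p ∉ modes X) : E.nhat μ₀ k₁ k₂ μ p = 0 := by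
  refine Finset.sum_eq_zero fun m hm => Finset.sum_eq_zero fun q hq => ?_
  have hm2 := (Finset.mem_Icc.1 hm).1
  rcases size_lt_or_exists_zero hm2 hq with h | ⟨i, hi⟩
  · by_cases hall : ∀ i, freq k₁ k₂ (q i) ∈ modes X
    · rw [symbol_eq_zero_of_notMem_modes E h2 hμ hm2 _ hall, zero_mul]
      rwa [← freq_sum, mem_decompositions.1 hq, ← hmodes]
    · push Not at hall
      obtain ⟨i, hi⟩ := hall
      rw [Finset.prod_eq_zero (Finset.mem_univ i) (ih _ (h i) hi), mul_zero]
  · rw [Finset.prod_eq_zero (Finset.mem_univ i) (uhat_of_size_zero hi), mul_zero]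

theorem uhat_eq_zero_of_notMem_modes (hmodes : modes X = modes Y)
    (h2 : E.MultilinearFourierSeries) (hμ : μ ∈ E.M) (hk₁ : k₁ ∈ modes X) (hk₂ : k₂ ∈ modes X)
    (p : Index) (hp : freq k₁ k₂ p ∉ modes X) : E.uhat μ₀ k₁ k₂ μ p = 0 := by
  induction hn : size p using Nat.strong_induction_on generalizing p with
  | _ n ih =>
    rcases Nat.lt_or_ge (size p) 2 with h | h
    · have : size p ≠ 1 := fun h1 =>
        hp (freq_mem_of_size_one (fun k => neg_mem_modes) hk₁ hk₂ h1)
      exact uhat_of_size_zero (by omega)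
    · rw [uhat_eq _ _ _ _ _ _ h, nhat_eq_zero_aux hmodes h2 hμ
        (fun q hq hf => ih _ (hn ▸ hq) q hf rfl) hp, mul_zero, neg_zero]

theorem nhat_eq_zero_of_notMem_modes (hmodes : modes X = modes Y)
    (h2 : E.MultilinearFourierSeries) (hμ : μ ∈ E.M) (hk₁ : k₁ ∈ modes X) (hk₂ : k₂ ∈ modes X)
    (p : Index) (hp : freq k₁ k₂ p ∉ modes X) : E.nhat μ₀ k₁ k₂ μ p = 0 :=
  nhat_eq_zero_aux hmodes h2 hμ
    (fun q _ hf => uhat_eq_zero_of_notMem_modes hmodes h2 hμ hk₁ hk₂ q hf) hp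

/-- Exchanging `α` and `γ` negates all frequencies. The symbols are even only on the modes of `X`,
but a tuple with any other frequency has a vanishing factor `û`. -/
theorem nhat_swap_aux (h2 : E.MultilinearFourierSeries) (hμ : μ ∈ E.M)
    (hzero : ∀ p, freq k₁ k₂ p ∉ modes X → E.uhat μ₀ k₁ k₂ μ p = 0) {p : Index}
    (ih : ∀ q, size q < size p → E.uhat μ₀ k₁ k₂ μ q.swap = E.uhat μ₀ k₁ k₂ μ q) :
    E.nhat μ₀ k₁ k₂ μ p.swap = E.nhat μ₀ k₁ k₂ μ p := by
  rw [nhat, nhat, size_swap]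
  refine Finset.sum_congr rfl fun m hm => ?_
  have hm2 := (Finset.mem_Icc.1 hm).1
  refine Finset.sum_nbij' (fun q i => (q i).swap) (fun q i => (q i).swap) ?_ ?_ ?_ ?_ ?_
  · intro q hq
    rw [mem_decompositions] at hq ⊢
    rw [← Prod.swap_swap p, ← hq]
    simp only [Prod.ext_iff, Prod.fst_sum, Prod.snd_sum, Prod.fst_swap, Prod.snd_swap,
      and_self]
  · intro q hq
    rw [mem_decompositions] at hq ⊢
    rw [← hq]
    simp only [Prod.ext_iff, Prod.fst_sum, Prod.snd_sum, Prod.fst_swap, Prod.snd_swap,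
      and_self]
  · intro q _; rfl
  · intro q _; rfl
  · intro q hq
    rcases size_lt_or_exists_zero hm2 hq with hlt | ⟨i, hi⟩
    · have hu : ∀ i, E.uhat μ₀ k₁ k₂ μ (q i).swap = E.uhat μ₀ k₁ k₂ μ (q i) := fun i => by
        have := ih (q i).swap (by
          have := hlt i; rw [size_swap] at this; rwa [size_swap])
        rw [← this, Prod.swap_swap]
      simp only [hu]
      by_cases hall : ∀ i, freq k₁ k₂ (q i) ∈ modes X
      · simp only [freq_swap]
        rw [(h2 μ hμ).2.2 m hm2 _ hall]
      · push Not at hall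
        obtain ⟨i, hi⟩ := hall
        rw [Finset.prod_eq_zero (Finset.mem_univ i) (hzero _ hi), mul_zero, mul_zero]
    · rw [Finset.prod_eq_zero (Finset.mem_univ i) (uhat_of_size_zero hi),
        Finset.prod_eq_zero (i := i) (Finset.mem_univ i)
          (uhat_of_size_zero (by rw [size_swap, hi]))]
      simp
theorem uhat_swap (hmodes : modes X = modes Y) (h1 : E.FredholmMultiplier)
    (h2 : E.MultilinearFourierSeries) (hμ₀ : μ₀ ∈ E.M)
    (hμ : μ ∈ E.M) (hk₁ : k₁ ∈ modes X) (hk₂ : k₂ ∈ modes X)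
    (p : Index) : E.uhat μ₀ k₁ k₂ μ p.swap = E.uhat μ₀ k₁ k₂ μ p := by
  have hzero := uhat_eq_zero_of_notMem_modes (μ₀ := μ₀) hmodes h2 hμ hk₁ hk₂
  induction hn : size p using Nat.strong_induction_on generalizing p with
  | _ n ih =>
    by_cases hp : freq k₁ k₂ p ∈ modes X
    swap
    · rw [hzero p hp, hzero p.swap]
      rwa [freq_swap, neg_mem_modes_iff]
    rcases Nat.lt_or_ge (size p) 2 with h | h
    · rcases Nat.lt_or_ge (size p) 1 with h' | h'
      · rw [uhat_of_size_zero (p := p) (by omega), uhat_of_size_zero (by rw [size_swap]; omega)]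
      · rw [uhat_of_size_one (p := p) (by omega), uhat_of_size_one (by rw [size_swap]; omega)]
    · rw [uhat_eq _ _ _ _ _ _ h, uhat_eq _ _ _ _ _ _ (by rwa [size_swap])]
      have hell : E.ell μ₀ μ (freq k₁ k₂ p.swap) = E.ell μ₀ μ (freq k₁ k₂ p) := by
        rw [freq_swap, ell, ell, (h1 μ hμ).2.2.2 _ hp]
        have : -freq k₁ k₂ p ∈ E.kernelSet μ₀ ↔ freq k₁ k₂ p ∈ E.kernelSet μ₀ :=
          ⟨fun h => by simpa using neg_mem_kernelSet h1 hμ₀ h, neg_mem_kernelSet h1 hμ₀⟩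
        by_cases hm : freq k₁ k₂ p ∈ E.kernelSet μ₀
        · rw [if_pos (this.2 hm), if_pos hm]
        · rw [if_neg (mt this.1 hm), if_neg hm]
      rw [hell, nhat_swap_aux h2 hμ hzero fun q hq => ih _ (hn ▸ hq) q rfl]

theorem nhat_swap (hmodes : modes X = modes Y) (h1 : E.FredholmMultiplier)
    (h2 : E.MultilinearFourierSeries) (hμ₀ : μ₀ ∈ E.M)
    (hμ : μ ∈ E.M) (hk₁ : k₁ ∈ modes X) (hk₂ : k₂ ∈ modes X)
    (p : Index) : E.nhat μ₀ k₁ k₂ μ p.swap = E.nhat μ₀ k₁ k₂ μ p :=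
  nhat_swap_aux h2 hμ (uhat_eq_zero_of_notMem_modes hmodes h2 hμ hk₁ hk₂)
    fun q _ => uhat_swap hmodes h1 h2 hμ₀ hμ hk₁ hk₂ q

end Coefficients

end PeriodicEquation

/-! ### Taylor polynomials of the solution and of the nonlinearity -/

theorem isBigO_sum_pow_smul {ι V : Type*} [NormedAddCommGroup V] [NormedSpace ℝ V] (s : Finset ι)
    (e : ι → ℕ) (a : ι → V) (N : ℕ) (h : ∀ i ∈ s, e i < N → a i = 0) :
    (fun t : ℝ => ∑ i ∈ s, t ^ e i • a i) =O[𝓝 0] fun t => t ^ N := by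
  refine Asymptotics.IsBigO.fun_sum fun i hi => ?_
  rcases lt_or_ge (e i) N with hlt | hge
  · simp only [h i hi hlt, smul_zero]
    exact Asymptotics.isBigO_zero _ _
  · have h1 : (fun t : ℝ => t ^ e i) =O[𝓝 0] fun t => t ^ N :=
      Asymptotics.IsBigO.of_bound 1 <| by
        filter_upwards [Metric.ball_mem_nhds (0 : ℝ) one_pos] with t ht
        rw [one_mul, norm_pow, norm_pow]
        exact pow_le_pow_of_le_one (norm_nonneg _) (mem_ball_zero_iff.1 ht).le hge
    simpa using h1.smul (Asymptotics.isBigO_refl (fun _ : ℝ => a i) (𝓝 0)) |>.trans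
      (Asymptotics.isBigO_of_le' (c := ‖a i‖) _ fun t => by simp [norm_smul, mul_comm])

namespace PeriodicEquation

section ModeTerms

variable {Z : Type*} [NormedAddCommGroup Z] [NormedSpace ℝ Z] [PeriodicSpace Z]

theorem ofReal_smul_realMode_fst (c : ℝ) (w : ℂ) (k : ℤ) :
    c • (realMode w k : Z) = realMode (c * w) k := by
  simp only [realMode_eq, Complex.re_ofReal_mul, Complex.im_ofReal_mul, smul_sub, mul_smul]

open Classical in
theorem coeffC_smul_modeVec (w : ℂ) (j k : ℤ) :
    coeffC k (w • modeVec Z j) = if k = j ∧ j ∈ modes Z then w else 0 := by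
  rw [map_smul]
  by_cases h : j ∈ modes Z
  · rw [coeffC_modeVec h]
    by_cases hk : k = j <;> simp [hk, h]
  · simp [modeVec_of_notMem h, h]

variable (Z) in
/-- The real part of `(t z)^α conj(t z)^γ e^{i k_{α,γ} x}`. -/
noncomputable def modeTerm (k₁ k₂ : ℤ) (z : ℂ × ℂ) (t : ℝ) (p : Index) : Z :=
  t ^ size p • realMode (indexMonomial p z) (freq k₁ k₂ p)

variable {k₁ k₂ : ℤ} {z : ℂ × ℂ} {t : ℝ}

/-- The indices `p` and `p.swap` contribute conjugate exponentials with equal real coefficients, so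
the sum of complex exponentials is already real and equals the sum of the real parts. -/
theorem ofReal_sum_modeTerm (n : ℕ) (c : Index → ℝ) (hc : ∀ p, c p.swap = c p) :
    ofReal (∑ p ∈ indexBox n, c p • modeTerm Z k₁ k₂ z t p) =
      ∑ p ∈ indexBox n, ((c p * t ^ size p : ℝ) * indexMonomial p z : ℂ) •
        modeVec Z (freq k₁ k₂ p) := by
  classical
  refine Complexified.ext ?_ (Eq.symm ?_)
  · rw [fst_ofReal, fst_sum]
    refine Finset.sum_congr rfl fun p _ => ?_
    rw [modeTerm, smul_smul, ofReal_smul_realMode_fst, realMode]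
  · refine snd_eq_zero_of_coeffC _ fun k => ?_
    rw [map_sum, map_sum, map_sum, ← sum_indexBox_swap]
    refine Finset.sum_congr rfl fun p _ => ?_
    rw [coeffC_smul_modeVec, coeffC_smul_modeVec, hc, size_swap, indexMonomial_swap,
      apply_ite conj, map_mul, Complex.conj_ofReal, map_zero]
    simp only [freq_swap, neg_inj, neg_mem_modes_iff]

open Classical in
theorem coeff_sum_modeTerm (n : ℕ) (c : Index → ℝ) (hc : ∀ p, c p.swap = c p)
    (hc0 : ∀ p, freq k₁ k₂ p ∉ modes Z → c p = 0) (k : ℤ) :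
    coeff (∑ p ∈ indexBox n, c p • modeTerm Z k₁ k₂ z t p) k =
      ∑ p ∈ indexBox n, if k = freq k₁ k₂ p then
        ((c p * t ^ size p : ℝ) * indexMonomial p z : ℂ) else 0 := by
  rw [← coeffC_ofReal, ofReal_sum_modeTerm n c hc, map_sum]
  refine Finset.sum_congr rfl fun p _ => ?_
  rw [coeffC_smul_modeVec]
  by_cases hk : k = freq k₁ k₂ p
  · by_cases h : freq k₁ k₂ p ∈ modes Z
    · rw [if_pos ⟨hk, h⟩, if_pos hk]
    · rw [if_neg fun h' => h h'.2, if_pos hk, hc0 p h]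
      simp
  · rw [if_neg fun h' => hk h'.1, if_neg hk]

end ModeTerms

theorem sum_indexBox_decompositions {M : Type*} [AddCommMonoid M] (m n : ℕ)
    (g : (Fin m → Index) → M) :
    ∑ p ∈ indexBox n, ∑ q ∈ decompositions m p, g q =
      ∑ q ∈ (Fintype.piFinset fun _ : Fin m => indexBox n) with size (∑ i, q i) ≤ n, g q := by
  have h : ∀ q ∈ (Fintype.piFinset fun _ : Fin m => indexBox n).filter
      (fun q => size (∑ i, q i) ≤ n), ∑ i, q i ∈ indexBox n := fun q hq =>
    mem_indexBox.2 (Finset.mem_filter.1 hq).2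
  rw [← Finset.sum_fiberwise_of_maps_to h]
  refine Finset.sum_congr rfl fun p hp => Finset.sum_congr ?_ fun _ _ => rfl
  ext q
  rw [mem_decompositions, Finset.mem_filter, Finset.mem_filter, Fintype.mem_piFinset]
  constructor
  · rintro rfl
    refine ⟨⟨fun i => mem_indexBox.2 ?_, mem_indexBox.1 hp⟩, rfl⟩
    refine le_trans ?_ (mem_indexBox.1 hp)
    rw [size_sum]
    exact Finset.single_le_sum (f := fun i => size (q i)) (fun _ _ => zero_le) (Finset.mem_univ i)
  · exact fun h => h.2

variable {d : ℕ} {X Y : Type*} [NormedAddCommGroup X] [NormedSpace ℝ X] [PeriodicSpace X]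
  [NormedAddCommGroup Y] [NormedSpace ℝ Y] [PeriodicSpace Y] {E : PeriodicEquation d X Y}
  {μ₀ μ : Param d} {k₁ k₂ : ℤ} {z : ℂ × ℂ}

variable (E μ₀ μ k₁ k₂ z) in
/-- The Taylor polynomial of the solution of the reduced problem. -/
noncomputable def uPoly (n : ℕ) (t : ℝ) : X :=
  ∑ p ∈ indexBox n, E.uhat μ₀ k₁ k₂ μ p • modeTerm X k₁ k₂ z t p

variable (E μ₀ μ k₁ k₂ z) in
/-- The Taylor polynomial of the nonlinear term along the solution of the reduced problem. -/
noncomputable def nPoly (n : ℕ) (t : ℝ) : Y :=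
  ∑ p ∈ indexBox n, E.nhat μ₀ k₁ k₂ μ p • modeTerm Y k₁ k₂ z t p

/-- The polynomial is written as a sum of exponentials in the complexification and the multilinear
term is expanded; each product of exponentials is again an exponential, multiplied by the symbol. -/
theorem Nterm_uPoly (hmodes : modes X = modes Y) (h1 : E.FredholmMultiplier)
    (h2 : E.MultilinearFourierSeries) (hμ₀ : μ₀ ∈ E.M)
    (hμ : μ ∈ E.M) (hk₁ : k₁ ∈ modes X) (hk₂ : k₂ ∈ modes X) {m : ℕ} (hm : 2 ≤ m) (n : ℕ) (t : ℝ) :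
    E.Nterm m μ (fun _ => E.uPoly μ₀ μ k₁ k₂ z n t) =
      ∑ q ∈ Fintype.piFinset fun _ : Fin m => indexBox n,
        (E.n m μ (fun i => freq k₁ k₂ (q i)) * ∏ i, E.uhat μ₀ k₁ k₂ μ (q i)) •
          modeTerm Y k₁ k₂ z t (∑ i, q i) := by
  classical
  have hzero := uhat_eq_zero_of_notMem_modes (μ₀ := μ₀) hmodes h2 hμ hk₁ hk₂
  have key : ofReal (E.Nterm m μ (fun _ => E.uPoly μ₀ μ k₁ k₂ z n t)) =
      ∑ q ∈ Fintype.piFinset fun _ : Fin m => indexBox n,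
        (((E.n m μ (fun i => freq k₁ k₂ (q i)) * ∏ i, E.uhat μ₀ k₁ k₂ μ (q i)) *
          t ^ size (∑ i, q i) : ℝ) * indexMonomial (∑ i, q i) z : ℂ) •
          modeVec Y (freq k₁ k₂ (∑ i, q i)) := by
    refine eq_of_coeffC_eq fun k => ?_
    have e1 := extendMultilinear_ofReal
      ((coeffL k : Y →L[ℝ] ℂ).toLinearMap.compMultilinearMap (E.Nterm m μ))
      (fun _ => E.uPoly μ₀ μ k₁ k₂ z n t)
    rw [coeffC_ofReal, map_sum]
    refine Eq.trans e1.symm ?_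
    rw [uPoly, ofReal_sum_modeTerm n _ (uhat_swap hmodes h1 h2 hμ₀ hμ hk₁ hk₂),
      MultilinearMap.map_sum_finset]
    refine Finset.sum_congr rfl fun q _ => ?_
    rw [MultilinearMap.map_smul_univ, coeffC_smul_modeVec]
    by_cases hall : ∀ i, freq k₁ k₂ (q i) ∈ modes X
    · rw [extendMultilinear_modeVec E h2 hμ hm _ hall, freq_sum]
      have hprod : ∏ i, (((E.uhat μ₀ k₁ k₂ μ (q i) * t ^ size (q i) : ℝ) : ℂ) *
          indexMonomial (q i) z) = ((∏ i, E.uhat μ₀ k₁ k₂ μ (q i)) * t ^ size (∑ i, q i) : ℝ) *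
            indexMonomial (∑ i, q i) z := by
        rw [Finset.prod_mul_distrib, ← Complex.ofReal_prod, Finset.prod_mul_distrib,
          Finset.prod_pow_eq_pow_sum, indexMonomial_sum, size_sum]
      rw [hprod]
      by_cases hk : k = ∑ i, freq k₁ k₂ (q i)
      · by_cases hY : ∑ i, freq k₁ k₂ (q i) ∈ modes Y
        · rw [if_pos hk, if_pos ⟨hk, hY⟩, smul_eq_mul]
          push_cast
          ring
        · rw [if_pos hk, if_neg fun h => hY h.2,
            symbol_eq_zero_of_notMem_modes E h2 hμ hm _ hall hY]
          simp
      · rw [if_neg hk, if_neg fun h => hk h.1, smul_zero]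
    · push Not at hall
      obtain ⟨i, hi⟩ := hall
      rw [Finset.prod_eq_zero (Finset.mem_univ i) (by rw [hzero _ hi]; simp),
        Finset.prod_eq_zero (f := fun i => E.uhat μ₀ k₁ k₂ μ (q i)) (Finset.mem_univ i)
          (hzero _ hi)]
      simp
  have := congrArg Prod.fst key
  refine this.trans ?_
  refine (fst_sum _ _).trans ?_
  refine Finset.sum_congr rfl fun q _ => ?_
  rw [modeTerm, smul_smul, ofReal_smul_realMode_fst, realMode]

theorem nPoly_eq (n : ℕ) (t : ℝ) :
    E.nPoly μ₀ μ k₁ k₂ z n t = ∑ m ∈ Finset.Icc 2 n,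
      ∑ q ∈ (Fintype.piFinset fun _ : Fin m => indexBox n) with size (∑ i, q i) ≤ n,
        (E.n m μ (fun i => freq k₁ k₂ (q i)) * ∏ i, E.uhat μ₀ k₁ k₂ μ (q i)) •
          modeTerm Y k₁ k₂ z t (∑ i, q i) := by
  simp only [← sum_indexBox_decompositions]
  rw [Finset.sum_comm, nPoly]
  refine Finset.sum_congr rfl fun p hp => ?_
  have hsub : Finset.Icc 2 (size p) ⊆ Finset.Icc 2 n :=
    Finset.Icc_subset_Icc_right (mem_indexBox.1 hp)
  rw [← Finset.sum_subset hsub, nhat, Finset.sum_smul]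
  · refine Finset.sum_congr rfl fun m _ => ?_
    rw [Finset.sum_smul]
    refine Finset.sum_congr rfl fun q hq => ?_
    rw [mem_decompositions.1 hq]
  · intro m hm hm'
    refine Finset.sum_eq_zero fun q hq => ?_
    have hlt : size p < m := by
      rw [Finset.mem_Icc] at hm hm'
      omega
    -- More parts than the total size leave an empty part, so the bound `m ≤ size p` in `nhat` may
    -- be relaxed to `m ≤ n`.
    have : ∃ i, size (q i) = 0 := by
      by_contra! h
      have h' : ∑ i : Fin m, 1 ≤ ∑ i, size (q i) :=
        Finset.sum_le_sum fun i _ => Nat.one_le_iff_ne_zero.2 (h i)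
      rw [← size_sum, mem_decompositions.1 hq] at h'
      simp at h'
      omega
    obtain ⟨i, hi⟩ := this
    rw [Finset.prod_eq_zero (Finset.mem_univ i) (uhat_of_size_zero hi), mul_zero, zero_smul]

theorem uPoly_isBigO (n : ℕ) :
    (fun t => E.uPoly μ₀ μ k₁ k₂ z n t) =O[𝓝 0] fun t => t := by
  have := isBigO_sum_pow_smul (indexBox n) size (fun p => E.uhat μ₀ k₁ k₂ μ p •
    (realMode (indexMonomial p z) (freq k₁ k₂ p) : X)) 1 fun p _ h => by
      rw [uhat_of_size_zero (by omega), zero_smul]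
  simp only [pow_one] at this
  refine this.congr_left fun t => ?_
  refine Finset.sum_congr rfl fun p _ => ?_
  rw [modeTerm, smul_comm]

theorem tendsto_uPoly (n : ℕ) : Tendsto (fun t => E.uPoly μ₀ μ k₁ k₂ z n t) (𝓝 0) (𝓝 0) :=
  (uPoly_isBigO n).trans_tendsto tendsto_id

/-- There are two errors, both of order `n + 1`: the remainder of `N` at an argument of order `t`,
and the products of total degree above `n` that `nPoly` omits. -/
theorem N_uPoly_sub_isBigO (hmodes : modes X = modes Y) (h1 : E.FredholmMultiplier)
    (h2 : E.MultilinearFourierSeries) (h4 : E.Analytic) (hμ₀ : μ₀ ∈ E.M)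
    (hμ : μ ∈ E.M) (hk₁ : k₁ ∈ modes X) (hk₂ : k₂ ∈ modes X) (n : ℕ) :
    (fun t => E.N μ (E.uPoly μ₀ μ k₁ k₂ z n t) - E.nPoly μ₀ μ k₁ k₂ z n t) =O[𝓝 0]
      fun t => t ^ (n + 1) := by
  have hA := (N_sub_sum_isBigO h2 h4 hμ n).comp_tendsto (tendsto_uPoly (E := E) (μ₀ := μ₀)
    (μ := μ) (k₁ := k₁) (k₂ := k₂) (z := z) n)
  have hA' := hA.trans ((uPoly_isBigO n).norm_left.pow (n + 1))
  have hB : (fun t => ∑ m ∈ Finset.Icc 2 n, E.Nterm m μ (fun _ => E.uPoly μ₀ μ k₁ k₂ z n t) -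
      E.nPoly μ₀ μ k₁ k₂ z n t) =O[𝓝 0] fun t => t ^ (n + 1) := by
    have : ∀ m ∈ Finset.Icc 2 n, (fun t : ℝ =>
        ∑ q ∈ (Fintype.piFinset fun _ : Fin m => indexBox n) with ¬ size (∑ i, q i) ≤ n,
        (E.n m μ (fun i => freq k₁ k₂ (q i)) * ∏ i, E.uhat μ₀ k₁ k₂ μ (q i)) •
          modeTerm Y k₁ k₂ z t (∑ i, q i)) =O[𝓝 0] fun t => t ^ (n + 1) := by
      intro m _
      refine (isBigO_sum_pow_smul ((Fintype.piFinset fun _ : Fin m => indexBox n).filter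
        fun q => ¬ size (∑ i, q i) ≤ n) (fun q => size (∑ i, q i)) (fun q =>
        (E.n m μ (fun i => freq k₁ k₂ (q i)) * ∏ i, E.uhat μ₀ k₁ k₂ μ (q i)) •
          (realMode (indexMonomial (∑ i, q i) z) (freq k₁ k₂ (∑ i, q i)) : Y)) (n + 1)
          fun q hq hlt => absurd (Finset.mem_filter.1 hq).2 (by omega)).congr_left fun t => ?_
      refine Finset.sum_congr rfl fun q _ => ?_
      rw [modeTerm, smul_comm]
    refine (Asymptotics.IsBigO.fun_sum this).congr_left fun t => ?_
    rw [nPoly_eq, ← Finset.sum_sub_distrib]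
    refine Finset.sum_congr rfl fun m hm => ?_
    rw [Nterm_uPoly hmodes h1 h2 hμ₀ hμ hk₁ hk₂ (Finset.mem_Icc.1 hm).1, eq_sub_iff_add_eq',
      Finset.sum_filter_add_sum_filter_not]
  refine (hA'.add hB).congr_left fun t => ?_
  simp only [Function.comp_apply]
  abel

end PeriodicEquation

namespace PeriodicEquation

/-! ### Admissible parameters and Taylor expansion of the reduction -/

section ModeSum

variable (Z : Type*) [NormedAddCommGroup Z] [NormedSpace ℝ Z] [PeriodicSpace Z]

/-- The element `Re (z₁ e^{ik₁x} + z₂ e^{ik₂x})`. -/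
noncomputable def modeSum (k₁ k₂ : ℤ) : ℂ × ℂ →L[ℝ] Z :=
  ((Complex.reCLM.comp (.fst ℝ ℂ ℂ)).smulRight (modeVec Z k₁).1 -
    (Complex.imCLM.comp (.fst ℝ ℂ ℂ)).smulRight (modeVec Z k₁).2) +
  ((Complex.reCLM.comp (.snd ℝ ℂ ℂ)).smulRight (modeVec Z k₂).1 -
    (Complex.imCLM.comp (.snd ℝ ℂ ℂ)).smulRight (modeVec Z k₂).2)

variable {Z}

theorem modeSum_apply (k₁ k₂ : ℤ) (z : ℂ × ℂ) :
    modeSum Z k₁ k₂ z = realMode z.1 k₁ + realMode z.2 k₂ := by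
  simp [modeSum, realMode_eq]

theorem coeff_modeSum {k₁ k₂ : ℤ} (h₁ : k₁ ∈ modes Z) (h₂ : k₂ ∈ modes Z) (z : ℂ × ℂ) (k : ℤ) :
    coeff (modeSum Z k₁ k₂ z) k = ((if k = k₁ then z.1 else 0) + (if k = -k₁ then conj z.1 else 0) +
      ((if k = k₂ then z.2 else 0) + if k = -k₂ then conj z.2 else 0)) / 2 := by
  rw [modeSum_apply, coeff_add, coeff_realMode h₁, coeff_realMode h₂]
  ring

end ModeSum

variable {d : ℕ} {X Y : Type*} [NormedAddCommGroup X] [NormedSpace ℝ X] [PeriodicSpace X]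
  [NormedAddCommGroup Y] [NormedSpace ℝ Y] [PeriodicSpace Y] {E : PeriodicEquation d X Y}

/-- `Φ` is the local inverse of the augmented map at `(μ₀, 0)`, in the setting of the
Lyapunov-Schmidt reduction. -/
structure IsReduction (E : PeriodicEquation d X Y) (μ₀ : Param d) (K : Finset ℤ)
    (Φ : Param d × Y → X) : Prop where
  modes_eq : modes X = modes Y
  isOpen : IsOpen E.M
  fredholm : E.FredholmMultiplier
  series : E.MultilinearFourierSeries
  analytic : E.Analytic
  mem : μ₀ ∈ E.M
  kernel : (K : Set ℤ) = E.kernelSet μ₀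
  analyticAt : AnalyticAt ℝ Φ (μ₀, 0)
  right_inv : ∀ᶠ p in 𝓝 (μ₀, (0 : Y)), augmented E K (p.1, Φ p) = p.2
  left_inv : ∀ᶠ p in 𝓝 (μ₀, (0 : X)), Φ (p.1, augmented E K p) = p.2

/-- The parameters at which the reduction at `μ₀` may be used. -/
structure IsRegular (E : PeriodicEquation d X Y) (K : Finset ℤ) (Φ : Param d × Y → X)
    (μ : Param d) : Prop where
  mem : μ ∈ E.M
  analyticAt : AnalyticAt ℝ Φ (μ, 0)
  left_inv : ∀ᶠ u in 𝓝 (0 : X), Φ (μ, augmented E K (μ, u)) = u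
  symbol_ne_zero : ∀ k ∈ modes X, k ∉ K → E.l μ k ≠ 0

variable {μ₀ μ : Param d} {K : Finset ℤ} {Φ : Param d × Y → X} {k₁ k₂ : ℤ} {z : ℂ × ℂ}

namespace IsReduction

variable (R : IsReduction E μ₀ K Φ)
include R

theorem mem_iff {k : ℤ} : k ∈ K ↔ k ∈ E.kernelSet μ₀ := by rw [← R.kernel]; rfl

theorem mem_modes {k : ℤ} (hk : k ∈ K) : k ∈ modes X := (R.mem_iff.1 hk).1

theorem mem_modes_right {k : ℤ} (hk : k ∈ K) : k ∈ modes Y := R.modes_eq ▸ R.mem_modes hk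

theorem neg_mem {k : ℤ} (hk : k ∈ K) : -k ∈ K :=
  R.mem_iff.2 (neg_mem_kernelSet R.fredholm R.mem (R.mem_iff.1 hk))

theorem coeff_augmented (p : Param d × X) (k : ℤ) : coeff (augmented E K p) k =
    if k ∈ K then coeff p.2 k else coeff (E.F p.1 p.2) k :=
  PeriodicEquation.coeff_augmented (fun _ => R.mem_modes_right) (fun _ => R.neg_mem) p k

theorem continuousAt_augmented (hμ : μ ∈ E.M) :
    Tendsto (fun u => augmented E K (μ, u)) (𝓝 0) (𝓝 0) := by
  have := (hasFDerivAt_augmented (K := K) R.series R.analytic hμ).continuousAt.tendsto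
  rwa [augmented_zero R.series hμ] at this

/-- The delicate point is that the symbols off `K` stay nonzero for all `k` simultaneously, without
any bound on them. If one vanished, `cos kx` would lie in the kernel of the linearized augmented
map, although this map has a differentiable local left inverse at `(μ, 0)`. -/
theorem eventually_isRegular [CompleteSpace X] : ∀ᶠ μ in 𝓝 μ₀, IsRegular E K Φ μ := by
  have hY : Tendsto (fun μ : Param d => (μ, (0 : Y))) (𝓝 μ₀) (𝓝 (μ₀, 0)) :=
    Continuous.tendsto (by fun_prop) _
  have hX : Tendsto (fun μ : Param d => (μ, (0 : X))) (𝓝 μ₀) (𝓝 (μ₀, 0)) :=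
    Continuous.tendsto (by fun_prop) _
  filter_upwards [R.isOpen.mem_nhds R.mem, hY.eventually R.analyticAt.eventually_analyticAt,
    hX.eventually R.left_inv.eventually_nhds] with μ hμ han hl
  have hl' := (Continuous.tendsto' (f := fun u : X => (μ, u)) (by fun_prop) 0 _ rfl).eventually hl
  refine ⟨hμ, han, hl', fun k hk hkK hl0 => ?_⟩
  have hder : HasFDerivAt (fun y => Φ (μ, y)) ((fderiv ℝ Φ (μ, 0)).comp (.inr ℝ _ _)) (0 : Y) :=
    han.differentiableAt.hasFDerivAt.comp (0 : Y) (hasFDerivAt_prodMk_right μ (0 : Y))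
  have haug := hasFDerivAt_augmented (K := K) R.series R.analytic hμ
  have hder' : HasFDerivAt (fun y => Φ (μ, y)) ((fderiv ℝ Φ (μ, 0)).comp (.inr ℝ _ _))
      (augmented E K (μ, 0)) := by rwa [augmented_zero R.series hμ]
  have hid := (hder'.comp (0 : X) haug).congr_of_eventuallyEq (f₁ := id) (by
    filter_upwards [hl'] with u hu using hu.symm)
  have hinv := hid.unique (hasFDerivAt_id (0 : X))
  have hc := represents_modeVec_fst hk
  have hker : augmentedL E K μ (modeVec X k).1 = 0 := eq_of_coeff_eq fun j => by
    rw [coeff_augmentedL R.fredholm (fun _ => R.mem_modes_right) (fun _ => R.neg_mem) hμ,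
      coeff_eq_of_represents hc, fourierCoeff_cosMode, coeff_zero]
    have hlneg : E.l μ (-k) = 0 := by rw [(R.fredholm μ hμ).2.2.2 k hk, hl0]
    have hnegK : -k ∉ K := fun h => hkK (by simpa using R.neg_mem h)
    by_cases h1 : j = k
    · rw [if_neg (h1 ▸ hkK), h1, hl0]; simp
    · by_cases h2 : j = -k
      · rw [if_neg (h2 ▸ hnegK), h2, hlneg]; simp
      · rw [if_neg h1, if_neg h2]; simp
  have h0 : (modeVec X k).1 = 0 := by
    have := congrArg (fun T : X →L[ℝ] X => T (modeVec X k).1) hinv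
    simp only [ContinuousLinearMap.comp_apply, hker, map_zero] at this
    simpa using this.symm
  have hcos := coeff_eq_of_represents hc k
  rw [h0, coeff_zero, fourierCoeff_cosMode, if_pos rfl] at hcos
  split_ifs at hcos <;> norm_num at hcos

end IsReduction

namespace IsRegular

variable (hμ : IsRegular E K Φ μ) (R : IsReduction E μ₀ K Φ) (h₁ : k₁ ∈ K) (h₂ : k₂ ∈ K)
include hμ R

theorem apply_zero : Φ (μ, 0) = 0 := by
  have := hμ.left_inv.self_of_nhds
  rwa [augmented_zero R.series hμ.mem] at this

include h₁ h₂

theorem uhat_swap (p : Index) : E.uhat μ₀ k₁ k₂ μ p.swap = E.uhat μ₀ k₁ k₂ μ p :=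
  PeriodicEquation.uhat_swap R.modes_eq R.fredholm R.series R.mem hμ.mem (R.mem_modes h₁)
    (R.mem_modes h₂) p

theorem nhat_swap (p : Index) : E.nhat μ₀ k₁ k₂ μ p.swap = E.nhat μ₀ k₁ k₂ μ p :=
  PeriodicEquation.nhat_swap R.modes_eq R.fredholm R.series R.mem hμ.mem (R.mem_modes h₁)
    (R.mem_modes h₂) p

theorem coeff_uPoly (n : ℕ) (t : ℝ) (k : ℤ) :
    coeff (E.uPoly μ₀ μ k₁ k₂ z n t) k = ∑ p ∈ indexBox n, if k = freq k₁ k₂ p then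
      ((E.uhat μ₀ k₁ k₂ μ p * t ^ size p : ℝ) * indexMonomial p z : ℂ) else 0 := by
  classical
  rw [uPoly, coeff_sum_modeTerm n _ (hμ.uhat_swap R h₁ h₂) (uhat_eq_zero_of_notMem_modes
    R.modes_eq R.series hμ.mem (R.mem_modes h₁) (R.mem_modes h₂))]

theorem coeff_nPoly (n : ℕ) (t : ℝ) (k : ℤ) :
    coeff (E.nPoly μ₀ μ k₁ k₂ z n t) k = ∑ p ∈ indexBox n, if k = freq k₁ k₂ p then
      ((E.nhat μ₀ k₁ k₂ μ p * t ^ size p : ℝ) * indexMonomial p z : ℂ) else 0 := by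
  classical
  rw [nPoly, coeff_sum_modeTerm n _ (hμ.nhat_swap R h₁ h₂) (R.modes_eq ▸
    nhat_eq_zero_of_notMem_modes R.modes_eq R.series hμ.mem (R.mem_modes h₁) (R.mem_modes h₂))]

/-- Since `ell` vanishes on the kernel, only indices of size one contribute there; the value `û =
1/2` matches the coefficients of a real mode. -/
theorem coeff_uPoly_of_mem {n : ℕ} (hn : 1 ≤ n) (t : ℝ) {k : ℤ} (hk : k ∈ K) :
    coeff (E.uPoly μ₀ μ k₁ k₂ z n t) k = t * coeff (modeSum Y k₁ k₂ z) k := by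
  rw [hμ.coeff_uPoly R h₁ h₂, coeff_modeSum (R.mem_modes_right h₁) (R.mem_modes_right h₂)]
  have hsub : ({((1, 0), (0, 0)), ((0, 1), (0, 0)), ((0, 0), (1, 0)), ((0, 0), (0, 1))} :
      Finset Index) ⊆ indexBox n := by
    intro p hp
    simp only [Finset.mem_insert, Finset.mem_singleton] at hp
    rw [mem_indexBox, (size_eq_one_iff p).2 hp]
    exact hn
  rw [← Finset.sum_subset hsub]
  · rw [Finset.sum_insert (by decide), Finset.sum_insert (by decide),
      Finset.sum_insert (by decide), Finset.sum_singleton]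
    rw [uhat_of_size_one (by rfl), uhat_of_size_one (by rfl), uhat_of_size_one (by rfl),
      uhat_of_size_one (by rfl)]
    simp only [freq, size, indexMonomial]
    simp only [Nat.cast_zero, Nat.cast_one, sub_zero, zero_sub, zero_mul, one_mul, add_zero,
      zero_add, pow_one, pow_zero, mul_one, neg_mul]
    split_ifs <;> push_cast <;> ring
  · intro p _ hp
    simp only [Finset.mem_insert, Finset.mem_singleton] at hp
    rw [← size_eq_one_iff] at hp
    have h0 : k = freq k₁ k₂ p → E.uhat μ₀ k₁ k₂ μ p = 0 := fun h => by
      rcases Nat.lt_or_ge (size p) 2 with hlt | hge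
      · exact uhat_of_size_zero (by omega)
      · rw [uhat_eq _ _ _ _ _ _ hge, ell, if_pos (h ▸ R.mem_iff.1 hk), zero_mul, neg_zero]
    split_ifs with h
    · rw [h0 h]; simp
    · rfl

theorem coeff_modeSum_of_notMem {k : ℤ} (hk : k ∉ K) : coeff (modeSum Y k₁ k₂ z) k = 0 := by
  rw [coeff_modeSum (R.mem_modes_right h₁) (R.mem_modes_right h₂), if_neg, if_neg, if_neg, if_neg]
  · simp
  · rintro rfl; exact hk (R.neg_mem h₂)
  · rintro rfl; exact hk h₂
  · rintro rfl; exact hk (R.neg_mem h₁)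
  · rintro rfl; exact hk h₁

/-- This is the recursion `û = -ℓ n̂` multiplied by the symbol, which is nonzero on the modes off
`K` at a regular parameter. -/
theorem symbol_mul_coeff_uPoly (n : ℕ) (t : ℝ) {k : ℤ} (hk : k ∉ K) :
    (E.l μ k : ℂ) * coeff (E.uPoly μ₀ μ k₁ k₂ z n t) k = -coeff (E.nPoly μ₀ μ k₁ k₂ z n t) k := by
  rw [hμ.coeff_uPoly R h₁ h₂, hμ.coeff_nPoly R h₁ h₂, Finset.mul_sum, ← Finset.sum_neg_distrib]
  refine Finset.sum_congr rfl fun p _ => ?_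
  split_ifs with h
  swap
  · simp
  by_cases hkX : k ∈ modes X
  · have : E.nhat μ₀ k₁ k₂ μ p = -(E.l μ k * E.uhat μ₀ k₁ k₂ μ p) := by
      rcases Nat.lt_or_ge (size p) 2 with hlt | hge
      · have : size p ≠ 1 := fun h' => hk (h ▸ freq_mem_of_size_one (S := K)
          (fun _ h => R.neg_mem h) h₁ h₂ h')
        rw [nhat_of_size_lt hlt, uhat_of_size_zero (by omega)]
        simp
      · rw [uhat_eq _ _ _ _ _ _ hge, ell, if_neg (h ▸ mt R.mem_iff.2 hk), ← h]
        field_simp [hμ.symbol_ne_zero k hkX hk]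
    rw [this]
    push_cast
    ring
  · rw [uhat_eq_zero_of_notMem_modes R.modes_eq R.series hμ.mem (R.mem_modes h₁) (R.mem_modes h₂)
      p (h ▸ hkX), nhat_eq_zero_of_notMem_modes R.modes_eq R.series hμ.mem (R.mem_modes h₁)
      (R.mem_modes h₂) p (h ▸ hkX)]
    simp

/-- The Taylor polynomial solves the augmented equation with data `t v` up to the projected
truncation error of `N`. It is thus an approximate preimage, to be compared with the exact one. -/
theorem augmented_uPoly {n : ℕ} (hn : 1 ≤ n) (t : ℝ) :
    augmented E K (μ, E.uPoly μ₀ μ k₁ k₂ z n t) - t • modeSum Y k₁ k₂ z =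
      (.id ℝ Y - modeProj Y K : Y →L[ℝ] Y)
        (E.N μ (E.uPoly μ₀ μ k₁ k₂ z n t) - E.nPoly μ₀ μ k₁ k₂ z n t) := by
  refine eq_of_coeff_eq fun k => ?_
  have happ : ∀ y : Y, (.id ℝ Y - modeProj Y K : Y →L[ℝ] Y) y = y - modeProj Y K y := fun _ => rfl
  rw [happ, coeff_sub, coeff_sub, R.coeff_augmented, coeff_smul,
    coeff_modeProj (fun _ => R.mem_modes_right) (fun _ => R.neg_mem)]
  split_ifs with hk
  · rw [hμ.coeff_uPoly_of_mem R h₁ h₂ hn t hk]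
    ring
  · rw [hμ.coeff_modeSum_of_notMem R h₁ h₂ hk, F, coeff_add, (R.fredholm μ hμ.mem).2.2.1,
      hμ.symbol_mul_coeff_uPoly R h₁ h₂ n t hk, coeff_sub]
    ring

/-- The Taylor expansion of the solution of the reduced problem. -/
theorem reduction_sub_uPoly_isBigO {n : ℕ} (hn : 1 ≤ n) :
    (fun t : ℝ => Φ (μ, t • modeSum Y k₁ k₂ z) - E.uPoly μ₀ μ k₁ k₂ z n t) =O[𝓝 0]
      fun t => t ^ (n + 1) := by
  have hΦ := hμ.analyticAt.hasStrictFDerivAt.comp (0 : Y) (f := fun y : Y => (μ, y))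
    ((hasStrictFDerivAt_const μ (0 : Y)).prodMk (hasStrictFDerivAt_id (0 : Y)))
  have ht : Tendsto (fun t : ℝ => t • modeSum Y k₁ k₂ z) (𝓝 0) (𝓝 0) :=
    Continuous.tendsto' (by fun_prop) 0 _ (zero_smul _ _)
  have hu := tendsto_uPoly (E := E) (μ₀ := μ₀) (μ := μ) (k₁ := k₁) (k₂ := k₂) (z := z) n
  have ha := (R.continuousAt_augmented hμ.mem).comp hu
  -- The local inverse `Φ` is Lipschitz near zero, so the residual of the approximate solution
  -- bounds its distance from the true one.
  have h := hΦ.isBigO_sub.comp_tendsto (ht.prodMk_nhds ha)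
  have hO : (fun t => t • modeSum Y k₁ k₂ z - augmented E K (μ, E.uPoly μ₀ μ k₁ k₂ z n t))
      =O[𝓝 0] fun t : ℝ => t ^ (n + 1) := by
    have := ((.id ℝ Y - modeProj Y K : Y →L[ℝ] Y).isBigO_comp _ _).trans
      (N_uPoly_sub_isBigO (z := z) R.modes_eq R.fredholm R.series R.analytic R.mem hμ.mem
        (R.mem_modes h₁) (R.mem_modes h₂) n)
    refine this.neg_left.congr_left fun t => ?_
    rw [← hμ.augmented_uPoly R h₁ h₂ hn, neg_sub]
  refine (h.trans hO).congr' ?_ EventuallyEq.rfl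
  filter_upwards [hu.eventually hμ.left_inv] with t h
  simp only [Function.comp_apply]
  rw [h]

theorem N_reduction_sub_nPoly_isBigO {n : ℕ} (hn : 1 ≤ n) :
    (fun t : ℝ => E.N μ (Φ (μ, t • modeSum Y k₁ k₂ z)) - E.nPoly μ₀ μ k₁ k₂ z n t) =O[𝓝 0]
      fun t => t ^ (n + 1) := by
  have hN := (analyticAt_N R.analytic hμ.mem).hasStrictFDerivAt.isBigO_sub
  have ht : Tendsto (fun t : ℝ => Φ (μ, t • modeSum Y k₁ k₂ z)) (𝓝 0) (𝓝 0) := by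
    have hc : ContinuousAt (fun t : ℝ => Φ (μ, t • modeSum Y k₁ k₂ z)) 0 :=
      ContinuousAt.comp (f := fun t : ℝ => (μ, t • modeSum Y k₁ k₂ z)) (g := Φ)
        (by simpa using hμ.analyticAt.continuousAt) (by fun_prop)
    simpa [ContinuousAt, hμ.apply_zero R] using hc
  have hu := tendsto_uPoly (E := E) (μ₀ := μ₀) (μ := μ) (k₁ := k₁) (k₂ := k₂) (z := z) n
  have hA := (hN.comp_tendsto (ht.prodMk_nhds hu)).trans
    (hμ.reduction_sub_uPoly_isBigO R h₁ h₂ (z := z) hn)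
  have hB := N_uPoly_sub_isBigO (z := z) R.modes_eq R.fredholm R.series R.analytic R.mem hμ.mem
        (R.mem_modes h₁) (R.mem_modes h₂) n
  refine (hA.add hB).congr_left fun t => ?_
  simp only [Function.comp_apply]
  abel

end IsRegular

end PeriodicEquation

namespace PeriodicEquation

/-! ### From Taylor coefficients to symmetries of the reduced equation -/

section Taylor

/-- The real Taylor expansion of `g` at `0` in the monomials `z^α z̄^γ`, along rays. -/
def HasTaylorSeries (g : ℂ × ℂ → ℂ) (c : Index → ℝ) : Prop :=
  ∀ (z : ℂ × ℂ) (n : ℕ), 1 ≤ n → (fun t : ℝ => g (t • z) -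
    ∑ p ∈ indexBox n, ((c p * t ^ size p : ℝ) : ℂ) * indexMonomial p z) =O[𝓝 0]
      fun t => t ^ (n + 1)

variable {g : ℂ × ℂ → ℂ} {c : Index → ℝ}

theorem rotate_smul (k₁ k₂ : ℤ) (a : Torus) (t : ℝ) (z : ℂ × ℂ) :
    rotate k₁ k₂ a (t • z) = t • rotate k₁ k₂ a z := by
  simp [rotate, mul_left_comm]

theorem analyticAt_rotate (k₁ k₂ : ℤ) (a : Torus) (z : ℂ × ℂ) :
    AnalyticAt ℝ (rotate k₁ k₂ a) z :=
  (analyticAt_const.mul analyticAt_fst).prod (analyticAt_const.mul analyticAt_snd)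

theorem analyticAt_conj (w : ℂ) : AnalyticAt ℝ (fun w : ℂ => conj w) w :=
  Complex.conjCLE.toContinuousLinearMap.analyticAt w

theorem isBigO_pow_of_succ {f : ℝ → ℂ}
    (h : ∀ n, 1 ≤ n → f =O[𝓝 0] fun t : ℝ => t ^ (n + 1)) (n : ℕ) :
    f =O[𝓝 0] fun t : ℝ => t ^ n := by
  refine (h (n + 1) (by omega)).trans (Asymptotics.IsBigO.of_bound 1 ?_)
  filter_upwards [Metric.ball_mem_nhds (0 : ℝ) one_pos] with t ht
  rw [one_mul, norm_pow, norm_pow]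
  exact pow_le_pow_of_le_one (norm_nonneg _) (mem_ball_zero_iff.1 ht).le (by omega)

theorem norm_smul_lt_of_mem_Icc {V : Type*} [NormedAddCommGroup V] [NormedSpace ℝ V] {v : V}
    {r t : ℝ} (hv : ‖v‖ < r) (ht : t ∈ Set.Icc (0 : ℝ) 1) : ‖t • v‖ < r := by
  rw [norm_smul, Real.norm_of_nonneg ht.1]
  exact (mul_le_of_le_one_left (norm_nonneg _) ht.2).trans_lt hv

/-- All monomials that occur are multiplied by the same phase, so the difference of the two sides is
flat at `0` along the ray through `z`; analyticity on the segment carries this to `z` itself. The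
identity therefore holds on the whole ball of analyticity. -/
theorem HasTaylorSeries.apply_rotate (hg : HasTaylorSeries g c) {k k₁ k₂ : ℤ}
    (hc : ∀ p, c p ≠ 0 → freq k₁ k₂ p = k) {r : ℝ} (han : ∀ z, ‖z‖ < r → AnalyticAt ℝ g z)
    (a : Torus) {z : ℂ × ℂ} (hz : ‖z‖ < r) : g (rotate k₁ k₂ a z) = fourier k a * g z := by
  refine sub_eq_zero.1 (eq_zero_of_isBigO_pow_along_segment
    (g := fun z => g (rotate k₁ k₂ a z) - fourier k a * g z) (fun t ht => ?_)
    (isBigO_pow_of_succ fun n hn => ?_))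
  · have h := norm_smul_lt_of_mem_Icc hz ht
    exact (AnalyticAt.fun_comp (han _ (by rwa [norm_rotate])) (analyticAt_rotate k₁ k₂ a _)).sub
      (analyticAt_const.mul (han _ h))
  · refine ((hg (rotate k₁ k₂ a z) n hn).sub ((hg z n hn).const_mul_left (fourier k a))).congr_left
      fun t => ?_
    have : ∑ p ∈ indexBox n, ((c p * t ^ size p : ℝ) : ℂ) * indexMonomial p (rotate k₁ k₂ a z) =
        fourier k a * ∑ p ∈ indexBox n, ((c p * t ^ size p : ℝ) : ℂ) * indexMonomial p z := by
      rw [Finset.mul_sum]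
      refine Finset.sum_congr rfl fun p _ => ?_
      by_cases h : c p = 0
      · simp [h]
      · rw [indexMonomial_rotate, hc p h]
        ring
    rw [rotate_smul, this]
    ring

/-- The argument is as for rotations; here it is the reality of the Taylor coefficients that
matters. -/
theorem HasTaylorSeries.apply_conj (hg : HasTaylorSeries g c) {r : ℝ}
    (han : ∀ z, ‖z‖ < r → AnalyticAt ℝ g z) {z : ℂ × ℂ} (hz : ‖z‖ < r) :
    g (conj z.1, conj z.2) = conj (g z) := by
  refine sub_eq_zero.1 (eq_zero_of_isBigO_pow_along_segment
    (g := fun z : ℂ × ℂ => g (conj z.1, conj z.2) - conj (g z)) (fun t ht => ?_)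
    (isBigO_pow_of_succ fun n hn => ?_))
  · have h := norm_smul_lt_of_mem_Icc hz ht
    refine (AnalyticAt.fun_comp (f := fun z : ℂ × ℂ => (conj z.1, conj z.2)) (han _ ?_)
      (((analyticAt_conj _).fun_comp analyticAt_fst).prod
        ((analyticAt_conj _).fun_comp analyticAt_snd))).sub
      ((analyticAt_conj _).fun_comp (han _ h))
    simpa [Prod.norm_def] using h
  · have h2 : (fun t : ℝ => conj (g (t • z) - ∑ p ∈ indexBox n, ((c p * t ^ size p : ℝ) : ℂ) *
        indexMonomial p z)) =O[𝓝 0] fun t : ℝ => t ^ (n + 1) :=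
      (hg z n hn).norm_left.congr_left (fun t => (RCLike.norm_conj _).symm) |>.of_norm_left
    refine ((hg (conj z.1, conj z.2) n hn).sub h2).congr_left fun t => ?_
    simp only [map_sub, map_sum, map_mul, Complex.conj_ofReal, indexMonomial_conj]
    have : t • (conj z.1, conj z.2) = (conj (t • z).1, conj (t • z).2) := by
      simp
    rw [this]
    ring

end Taylor

variable {d : ℕ} {X Y : Type*} [NormedAddCommGroup X] [NormedSpace ℝ X] [PeriodicSpace X]
  [NormedAddCommGroup Y] [NormedSpace ℝ Y] [PeriodicSpace Y] {E : PeriodicEquation d X Y}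
  {μ₀ μ : Param d} {K : Finset ℤ} {Φ : Param d × Y → X} {k₁ k₂ : ℤ} {z : ℂ × ℂ}

/-- The solution of the reduced problem with prescribed modes in the kernel. -/
noncomputable def reducedSol (Φ : Param d × Y → X) (k₁ k₂ : ℤ) (p : Param d × (ℂ × ℂ)) : X :=
  Φ (p.1, modeSum Y k₁ k₂ p.2)

/-- The components of the reduced equation. -/
noncomputable def reducedEq (E : PeriodicEquation d X Y) (Φ : Param d × Y → X) (k₁ k₂ k : ℤ)
    (p : Param d × (ℂ × ℂ)) : ℂ :=
  coeff (E.F p.1 (reducedSol Φ k₁ k₂ p)) k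

/-- The conditions on a point under which the reduced problem is used there. -/
structure IsAdmissible (E : PeriodicEquation d X Y) (K : Finset ℤ) (Φ : Param d × Y → X)
    (k₁ k₂ : ℤ) (p : Param d × (ℂ × ℂ)) : Prop where
  regular : IsRegular E K Φ p.1
  analyticAt_sol : AnalyticAt ℝ (reducedSol Φ k₁ k₂) p
  analyticAt_F : AnalyticAt ℝ (fun q : Param d × X => E.F q.1 q.2) (p.1, reducedSol Φ k₁ k₂ p)
  augmented_eq : augmented E K (p.1, reducedSol Φ k₁ k₂ p) = modeSum Y k₁ k₂ p.2

theorem IsAdmissible.analyticAt_coeff_sol {p : Param d × (ℂ × ℂ)}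
    (hp : IsAdmissible E K Φ k₁ k₂ p) (k : ℤ) :
    AnalyticAt ℝ (fun p => coeff (reducedSol Φ k₁ k₂ p) k) p :=
  ((coeffL k : X →L[ℝ] ℂ).analyticAt _).fun_comp hp.analyticAt_sol

theorem IsAdmissible.analyticAt_reducedEq {p : Param d × (ℂ × ℂ)}
    (hp : IsAdmissible E K Φ k₁ k₂ p) (k : ℤ) : AnalyticAt ℝ (reducedEq E Φ k₁ k₂ k) p :=
  ((coeffL k : Y →L[ℝ] ℂ).analyticAt _).fun_comp (AnalyticAt.fun_comp
    (f := fun p : Param d × (ℂ × ℂ) => (p.1, reducedSol Φ k₁ k₂ p)) hp.analyticAt_F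
    (analyticAt_fst.prod hp.analyticAt_sol))

theorem analyticAt_slice {F : Type*} [NormedAddCommGroup F] [NormedSpace ℝ F]
    {g : Param d × (ℂ × ℂ) → F} (hg : AnalyticAt ℝ g (μ, z)) :
    AnalyticAt ℝ (fun z => g (μ, z)) z :=
  AnalyticAt.fun_comp (f := fun z : ℂ × ℂ => (μ, z)) hg (analyticAt_const.prod analyticAt_id)

namespace IsReduction

variable (R : IsReduction E μ₀ K Φ) (h₁ : k₁ ∈ K) (h₂ : k₂ ∈ K)
include R

theorem eventually_isAdmissible [CompleteSpace X] [CompleteSpace Y] :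
    ∀ᶠ p in 𝓝 (μ₀, (0 : ℂ × ℂ)), IsAdmissible E K Φ k₁ k₂ p := by
  have hΦ0 : Φ (μ₀, 0) = 0 := R.eventually_isRegular.self_of_nhds.apply_zero R
  have hm : AnalyticAt ℝ (fun p : Param d × (ℂ × ℂ) => (p.1, modeSum Y k₁ k₂ p.2)) (μ₀, 0) :=
    analyticAt_fst.prod (((modeSum Y k₁ k₂).analyticAt _).fun_comp analyticAt_snd)
  have hmt : Tendsto (fun p : Param d × (ℂ × ℂ) => (p.1, modeSum Y k₁ k₂ p.2)) (𝓝 (μ₀, 0))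
      (𝓝 (μ₀, 0)) := by simpa [ContinuousAt] using hm.continuousAt
  have hsol : AnalyticAt ℝ (reducedSol Φ k₁ k₂) (μ₀, 0) :=
    AnalyticAt.fun_comp (f := fun p : Param d × (ℂ × ℂ) => (p.1, modeSum Y k₁ k₂ p.2))
      (by simpa using R.analyticAt) hm
  have hs : Tendsto (fun p : Param d × (ℂ × ℂ) => (p.1, reducedSol Φ k₁ k₂ p)) (𝓝 (μ₀, 0))
      (𝓝 (μ₀, 0)) := by
    have := (analyticAt_fst.prod hsol).continuousAt
    simpa [ContinuousAt, reducedSol, hΦ0] using this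
  filter_upwards [(continuous_fst.tendsto (μ₀, (0 : ℂ × ℂ))).eventually R.eventually_isRegular,
    hsol.eventually_analyticAt,
    hs.eventually (R.analytic μ₀ R.mem).eventually_analyticAt,
    hmt.eventually R.right_inv] with p h1 h2 h3 h4
  exact ⟨h1, h2, h3, h4⟩

end IsReduction

namespace IsRegular

variable (hμ : IsRegular E K Φ μ) (R : IsReduction E μ₀ K Φ) (h₁ : k₁ ∈ K) (h₂ : k₂ ∈ K)
include hμ R h₁ h₂

theorem hasTaylorSeries_sol (k : ℤ) :
    HasTaylorSeries (fun z => coeff (reducedSol Φ k₁ k₂ (μ, z)) k)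
      (fun p => if freq k₁ k₂ p = k then E.uhat μ₀ k₁ k₂ μ p else 0) := by
  intro z n hn
  refine (((coeffL k : X →L[ℝ] ℂ).isBigO_comp _ _).trans
    (hμ.reduction_sub_uPoly_isBigO R h₁ h₂ (z := z) hn)).congr_left fun t => ?_
  rw [coeffL_apply, coeff_sub, hμ.coeff_uPoly R h₁ h₂]
  simp only [reducedSol, map_smul]
  congr 1
  refine Finset.sum_congr rfl fun p _ => ?_
  by_cases h : k = freq k₁ k₂ p
  · rw [if_pos h, if_pos h.symm]
  · rw [if_neg h, if_neg (Ne.symm h)]; simp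

theorem hasTaylorSeries_reducedEq (k : ℤ) : HasTaylorSeries (fun z => reducedEq E Φ k₁ k₂ k (μ, z))
    (fun p => if freq k₁ k₂ p = k then E.l μ k * E.uhat μ₀ k₁ k₂ μ p + E.nhat μ₀ k₁ k₂ μ p
      else 0) := by
  intro z n hn
  have hA := (hμ.hasTaylorSeries_sol R h₁ h₂ k z n hn).const_mul_left (E.l μ k : ℂ)
  have hB := ((coeffL k : Y →L[ℝ] ℂ).isBigO_comp _ _).trans
    (hμ.N_reduction_sub_nPoly_isBigO R h₁ h₂ (z := z) hn)
  refine (hA.add hB).congr_left fun t => ?_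
  rw [coeffL_apply, coeff_sub, hμ.coeff_nPoly R h₁ h₂]
  simp only [reducedEq, F, coeff_add, (R.fredholm μ hμ.mem).2.2.1, reducedSol, map_smul]
  rw [mul_sub, sub_add_sub_comm, Finset.mul_sum, ← Finset.sum_add_distrib]
  congr 1
  refine Finset.sum_congr rfl fun p _ => ?_
  by_cases h : k = freq k₁ k₂ p
  · rw [if_pos h, if_pos h.symm, if_pos h.symm]
    push_cast
    ring
  · rw [if_neg h, if_neg (Ne.symm h), if_neg (Ne.symm h)]; simp

end IsRegular

/-! ### Equivariance of the reduction -/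

section Equivariance

variable (R : IsReduction E μ₀ K Φ) (h₁ : k₁ ∈ K) (h₂ : k₂ ∈ K) {r : ℝ}
  (hr : ∀ z : ℂ × ℂ, ‖z‖ < r → IsAdmissible E K Φ k₁ k₂ (μ, z)) (hz : ‖z‖ < r)
include R h₁ h₂ hr hz

theorem coeff_reducedSol_rotate (a : Torus) (k : ℤ) :
    coeff (reducedSol Φ k₁ k₂ (μ, rotate k₁ k₂ a z)) k =
      fourier k a * coeff (reducedSol Φ k₁ k₂ (μ, z)) k :=
  ((hr z hz).regular.hasTaylorSeries_sol R h₁ h₂ k).apply_rotate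
    (fun _ => of_not_not ∘ mt fun h => if_neg h)
    (fun z hz => analyticAt_slice ((hr z hz).analyticAt_coeff_sol k)) a hz

theorem coeff_reducedSol_conj (k : ℤ) :
    coeff (reducedSol Φ k₁ k₂ (μ, (conj z.1, conj z.2))) k =
      conj (coeff (reducedSol Φ k₁ k₂ (μ, z)) k) :=
  ((hr z hz).regular.hasTaylorSeries_sol R h₁ h₂ k).apply_conj
    (fun z hz => analyticAt_slice ((hr z hz).analyticAt_coeff_sol k)) hz

theorem reducedEq_rotate (a : Torus) (k : ℤ) :
    reducedEq E Φ k₁ k₂ k (μ, rotate k₁ k₂ a z) = fourier k a * reducedEq E Φ k₁ k₂ k (μ, z) :=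
  ((hr z hz).regular.hasTaylorSeries_reducedEq R h₁ h₂ k).apply_rotate
    (fun _ => of_not_not ∘ mt fun h => if_neg h)
    (fun z hz => analyticAt_slice ((hr z hz).analyticAt_reducedEq k)) a hz

theorem reducedEq_conj (k : ℤ) :
    reducedEq E Φ k₁ k₂ k (μ, (conj z.1, conj z.2)) = conj (reducedEq E Φ k₁ k₂ k (μ, z)) :=
  ((hr z hz).regular.hasTaylorSeries_reducedEq R h₁ h₂ k).apply_conj
    (fun z hz => analyticAt_slice ((hr z hz).analyticAt_reducedEq k)) hz

end Equivariance

end PeriodicEquation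

/-! ### Symmetric solutions and leading coefficients of the reduced equation -/

/-- A pair of phases in resonance can be rotated to real values. -/
theorem exists_rotate_real {k₁ k₂ : ℕ} (h₁ : 0 < k₁) (h₂ : 0 < k₂) (hc : Nat.Coprime k₁ k₂)
    {z : ℂ × ℂ} (h : (invariants k₁ k₂ z).2.2.im = 0) :
    ∃ a : ℝ, (rotate k₁ k₂ (a : Torus) z).1.im = 0 ∧ (rotate k₁ k₂ (a : Torus) z).2.im = 0 := by
  have hk₁ : (k₁ : ℝ) ≠ 0 := by exact_mod_cast h₁.ne'
  have hk₂ : (k₂ : ℝ) ≠ 0 := by exact_mod_cast h₂.ne'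
  have hrot : ∀ (k : ℤ) (a : ℝ) (w : ℂ), (fourier k (a : Torus) : ℂ) * w =
      ‖w‖ * Complex.exp (((k * a + w.arg : ℝ) : ℂ) * Complex.I) := fun k a w => by
    rw [fourier_torus_coe]
    nth_rw 1 [← Complex.norm_mul_exp_arg_mul_I w]
    push_cast
    rw [add_mul, Complex.exp_add]
    ring
  have him : ∀ (k : ℤ) (a : ℝ) (w : ℂ), (w ≠ 0 → ∃ n : ℤ, k * a + w.arg = n * Real.pi) →
      ((fourier k (a : Torus) : ℂ) * w).im = 0 := fun k a w h => by
    by_cases hw : w = 0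
    · simp [hw]
    · obtain ⟨n, hn⟩ := h hw
      rw [hrot, Complex.im_ofReal_mul, Complex.exp_ofReal_mul_I_im, hn, Real.sin_int_mul_pi,
        mul_zero]
  suffices ∃ a : ℝ, (z.1 ≠ 0 → ∃ n : ℤ, (k₁ : ℤ) * a + z.1.arg = n * Real.pi) ∧
      (z.2 ≠ 0 → ∃ n : ℤ, (k₂ : ℤ) * a + z.2.arg = n * Real.pi) by
    obtain ⟨a, ha, hb⟩ := this
    exact ⟨a, him _ _ _ ha, him _ _ _ hb⟩
  push_cast
  by_cases hz₁ : z.1 = 0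
  · refine ⟨-z.2.arg / k₂, fun h => absurd hz₁ h, fun _ => ⟨0, ?_⟩⟩
    field_simp
    simp
  by_cases hz₂ : z.2 = 0
  · refine ⟨-z.1.arg / k₁, fun _ => ⟨0, ?_⟩, fun h => absurd hz₂ h⟩
    field_simp
    simp
  have hphase : Real.sin (k₂ * z.1.arg - k₁ * z.2.arg) = 0 := by
    have e : (invariants k₁ k₂ z).2.2 = ((‖z.1‖ ^ k₂ * ‖z.2‖ ^ k₁ : ℝ) : ℂ) *
        Complex.exp (((k₂ * z.1.arg - k₁ * z.2.arg : ℝ) : ℂ) * Complex.I) := by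
      simp only [invariants]
      nth_rw 1 [← Complex.norm_mul_exp_arg_mul_I z.1, ← Complex.norm_mul_exp_arg_mul_I z.2]
      rw [map_mul, Complex.conj_ofReal, ← Complex.exp_conj, map_mul, Complex.conj_ofReal,
        Complex.conj_I, mul_pow, mul_pow, ← Complex.exp_nat_mul, ← Complex.exp_nat_mul,
        mul_mul_mul_comm, ← Complex.exp_add]
      push_cast
      congr 2
      ring
    rw [e, Complex.im_ofReal_mul, Complex.exp_ofReal_mul_I_im, mul_eq_zero] at h
    refine h.resolve_left ?_
    have := norm_pos_iff.2 hz₁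
    have := norm_pos_iff.2 hz₂
    positivity
  obtain ⟨j, hj⟩ := Real.sin_eq_zero_iff.1 hphase
  -- With `k₂ arg z₁ - k₁ arg z₂ = jπ` and Bézout coefficients `A, B` of `k₁, k₂`, the translation
  -- that brings the first phase to `jBπ` brings the second to `-jAπ`.
  have hb : (k₁ : ℤ) * Nat.gcdA k₁ k₂ + k₂ * Nat.gcdB k₁ k₂ = 1 := by
    rw [← Nat.gcd_eq_gcd_ab, hc]; rfl
  have hb' : (k₁ : ℝ) * (Nat.gcdA k₁ k₂ : ℤ) + k₂ * (Nat.gcdB k₁ k₂ : ℤ) = 1 := by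
    exact_mod_cast hb
  refine ⟨((j * Nat.gcdB k₁ k₂ : ℤ) * Real.pi - z.1.arg) / k₁,
    fun _ => ⟨j * Nat.gcdB k₁ k₂, by field_simp; ring⟩, fun _ => ⟨-j * Nat.gcdA k₁ k₂, ?_⟩⟩
  push_cast
  field_simp
  linear_combination hj + (j * Real.pi) * hb'

theorem eq_zero_of_mul_pow_isBigO {g : ℝ → ℝ} {a : ℝ} {n : ℕ} (hg : Tendsto g (𝓝 0) (𝓝 a))
    (h : (fun t => g t * t ^ n) =O[𝓝 0] fun t : ℝ => t ^ (n + 1)) : a = 0 := by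
  have hO : g =O[𝓝[≠] 0] fun t : ℝ => t := by
    obtain ⟨C, hC⟩ := (h.mono nhdsWithin_le_nhds).bound
    refine Asymptotics.IsBigO.of_bound C ?_
    filter_upwards [hC, self_mem_nhdsWithin] with t ht h0
    have hpos : 0 < ‖t ^ n‖ := norm_pos_iff.2 (pow_ne_zero n h0)
    rw [norm_mul, pow_succ, norm_mul] at ht
    exact le_of_mul_le_mul_right (by linarith) hpos
  exact tendsto_nhds_unique (hg.mono_left nhdsWithin_le_nhds)
    (hO.trans_tendsto (tendsto_id.mono_left nhdsWithin_le_nhds))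

namespace PeriodicEquation

/-- Up to the critical size, only one index contributes a resonant monomial. -/
theorem eq_of_freq_eq {k₁ k₂ : ℕ} (h₁ : 0 < k₁) (h₂ : 0 < k₂) (hc : Nat.Coprime k₁ k₂)
    {p : Index} (hp : freq k₁ k₂ p = k₁) (hs : size p ≤ k₁ + k₂ - 1) :
    p = ((0, k₁), (k₂ - 1, 0)) ∨ (p.1.1 = p.2.1 + 1 ∧ p.1.2 = p.2.2) := by
  obtain ⟨⟨a, b⟩, c, e⟩ := p
  simp only [freq, size] at hp hs ⊢
  have h : ((a : ℤ) - c - 1) * k₁ = (e - b) * k₂ := by linear_combination hp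
  have hdvd : (k₂ : ℤ) ∣ (a : ℤ) - c - 1 := by
    have hcop : IsCoprime (k₂ : ℤ) k₁ := (Nat.isCoprime_iff_coprime.2 hc).symm
    exact hcop.dvd_of_dvd_mul_right ⟨_, h.trans (mul_comm _ _)⟩
  obtain ⟨j, hj⟩ := hdvd
  have hk₂ : (k₂ : ℤ) ≠ 0 := by exact_mod_cast h₂.ne'
  have hj' : (e : ℤ) - b = j * k₁ := by
    rw [hj] at h
    exact mul_right_cancel₀ hk₂ (by linear_combination -h)
  have hk1 : (1 : ℤ) ≤ k₁ := by exact_mod_cast h₁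
  have hk2 : (1 : ℤ) ≤ k₂ := by exact_mod_cast h₂
  have hs' : (a : ℤ) + b + c + e ≤ k₁ + k₂ - 1 := by omega
  -- For `j = -1` the size is at least `k₁ + k₂ - 1`, with equality only for the resonant index.
  -- Positive `j` and `j ≤ -2` exceed the bound, and `j = 0` gives the trivial monomials `z₁
  -- |z₁|^{2c} |z₂|^{2e}`.
  rcases lt_trichotomy j 0 with hneg | rfl | hpos
  · rcases eq_or_lt_of_le (Int.lt_iff_add_one_le.1 hneg) with h1 | h1
    · obtain rfl : j = -1 := by omega
      left
      simp only [Prod.mk.injEq]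
      omega
    · have : j ≤ -2 := by omega
      nlinarith
  · right
    constructor <;> omega
  · nlinarith

variable {d : ℕ} {X Y : Type*} [NormedAddCommGroup X] [NormedSpace ℝ X] [PeriodicSpace X]
  [NormedAddCommGroup Y] [NormedSpace ℝ Y] [PeriodicSpace Y] {E : PeriodicEquation d X Y}
  {μ₀ μ : Param d} {K : Finset ℤ} {Φ : Param d × Y → X} {z : ℂ × ℂ}

/-- The solution of the reduced problem is symmetric if the phases of the modes can be rotated
to real values. -/
theorem isSymmetric_reducedSol_of_rotate {k₁ k₂ : ℤ} (R : IsReduction E μ₀ K Φ) (h₁ : k₁ ∈ K)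
    (h₂ : k₂ ∈ K) {r : ℝ} (hr : ∀ z : ℂ × ℂ, ‖z‖ < r → IsAdmissible E K Φ k₁ k₂ (μ, z))
    (hz : ‖z‖ < r) {a : ℝ} (ha₁ : (rotate k₁ k₂ (a : Torus) z).1.im = 0)
    (ha₂ : (rotate k₁ k₂ (a : Torus) z).2.im = 0) :
    IsSymmetric (asFun (reducedSol Φ k₁ k₂ (μ, z))) := by
  refine (isSymmetric_iff _).2 ⟨a, fun k => ?_⟩
  have hz' : ‖rotate k₁ k₂ (a : Torus) z‖ < r := by rwa [norm_rotate]
  have h := coeff_reducedSol_conj R h₁ h₂ hr hz' k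
  rw [Complex.conj_eq_iff_im.2 ha₁, Complex.conj_eq_iff_im.2 ha₂, Prod.mk.eta,
    coeff_reducedSol_rotate R h₁ h₂ hr hz] at h
  exact Complex.conj_eq_iff_im.1 h.symm

section TwoModes

variable {k₁ k₂ : ℕ} (R : IsReduction E μ₀ K Φ) (h₁ : (k₁ : ℤ) ∈ K) (h₂ : (k₂ : ℤ) ∈ K)

include R h₁ h₂

/-- The coefficient of the leading term of the non-resonant part of the reduced equation. -/
theorem symbol_of_decomposition (hp₁ : 0 < k₁) (hp₂ : 0 < k₂) (hμ : IsRegular E K Φ μ)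
    {A B : ℝ × ℝ × ℂ → ℝ} (hA : ContinuousAt A 0)
    (hdec : ∀ᶠ z in 𝓝 (0 : ℂ × ℂ), reducedEq E Φ k₁ k₂ k₁ (μ, z) =
      A (invariants k₁ k₂ z) * z.1 + B (invariants k₁ k₂ z) * resonantMonomial k₁ k₂ z) :
    A 0 = E.l μ k₁ / 2 := by
  -- On the ray through `(1, 0)` the resonant monomial vanishes, so the term linear in `t` isolates
  -- `A`.
  have hT := hμ.hasTaylorSeries_reducedEq R h₁ h₂ k₁ (1, 0) 1 le_rfl
  have hs : Tendsto (fun t : ℝ => t • ((1, 0) : ℂ × ℂ)) (𝓝 0) (𝓝 0) :=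
    Continuous.tendsto' (by fun_prop) 0 _ (zero_smul _ _)
  have hsum : ∀ t : ℝ, ∑ p ∈ indexBox 1, (((if freq k₁ k₂ p = k₁ then
      E.l μ k₁ * E.uhat μ₀ k₁ k₂ μ p + E.nhat μ₀ k₁ k₂ μ p else 0) * t ^ size p : ℝ) : ℂ) *
        indexMonomial p (1, 0) = E.l μ k₁ / 2 * t := by
    intro t
    rw [Finset.sum_eq_single ((1, 0), (0, 0))]
    · rw [if_pos (by simp [freq]), uhat_of_size_one (by rfl), nhat_of_size_lt (by simp [size])]
      simp only [size, indexMonomial]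
      push_cast
      simp
      left
      ring
    · intro p hp hne'
      rw [mem_indexBox] at hp
      rcases Nat.lt_or_ge (size p) 1 with h | h
      · rw [uhat_of_size_zero (by omega), nhat_of_size_lt (by omega)]
        simp
      · rcases (size_eq_one_iff p).1 (by omega) with rfl | rfl | rfl | rfl
        · exact absurd rfl hne'
        · simp [indexMonomial]
        · rw [if_neg]
          · simp
          · simp only [freq]
            push_cast
            omega
        · simp [indexMonomial]
    · intro h
      exact absurd (mem_indexBox.2 (by simp [size])) h
  have hO : (fun t : ℝ => ((A (invariants k₁ k₂ (t • (1, 0))) - E.l μ k₁ / 2) * t : ℝ)) =O[𝓝 0]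
      fun t => t ^ 2 := by
    refine (hT.norm_left.congr' ?_ EventuallyEq.rfl).of_norm_left
    filter_upwards [hs.eventually hdec] with t ht
    rw [hsum, ht, ← Complex.norm_real]
    congr 1
    simp [resonantMonomial, hp₁.ne']
    ring
  have hlim : Tendsto (fun t : ℝ => A (invariants k₁ k₂ (t • (1, 0))) - E.l μ k₁ / 2) (𝓝 0)
      (𝓝 (A 0 - E.l μ k₁ / 2)) := by
    have hi : Tendsto (fun t : ℝ => invariants k₁ k₂ (t • (1, 0))) (𝓝 0) (𝓝 0) := by
      have := ((continuous_invariants k₁ k₂).tendsto 0).comp hs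
      rwa [invariants_zero hp₂] at this
    exact (hA.tendsto.comp hi).sub_const _
  exact sub_eq_zero.1 (eq_zero_of_mul_pow_isBigO (n := 1) (by simpa using hlim) (by simpa using hO))

/-- The coefficient of the leading term of the resonant part of the reduced equation. -/
theorem resonant_of_decomposition (hp₁ : 0 < k₁) (hp₂ : 0 < k₂) (hne : k₁ ≠ k₂)
    (hc : Nat.Coprime k₁ k₂) (hμ : IsRegular E K Φ μ)
    {A B : ℝ × ℝ × ℂ → ℝ} (hB : ContinuousAt B 0)
    (hdec : ∀ᶠ z in 𝓝 (0 : ℂ × ℂ), reducedEq E Φ k₁ k₂ k₁ (μ, z) =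
      A (invariants k₁ k₂ z) * z.1 + B (invariants k₁ k₂ z) * resonantMonomial k₁ k₂ z) :
    B 0 = E.resonant μ₀ k₁ k₂ μ := by
  -- On the ray through `(w, 1)` with `w ^ k₂ = i`, multiplication by `conj w` makes all nonresonant
  -- terms real, while the resonant monomial becomes a multiple of `-i`. The imaginary part thus
  -- isolates `B`.
  obtain ⟨w, hw⟩ := IsAlgClosed.exists_pow_nat_eq Complex.I hp₂
  obtain ⟨n, hn⟩ : ∃ n, k₁ + k₂ = n + 2 := ⟨k₁ + k₂ - 2, by omega⟩
  have hpow : conj w * conj w ^ (k₂ - 1) = -Complex.I := by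
    rw [← pow_succ', Nat.sub_add_cancel hp₂, ← map_pow, hw, Complex.conj_I]
  have hT := (hμ.hasTaylorSeries_reducedEq R h₁ h₂ k₁ (w, 1) (n + 1) (by omega)).const_mul_left
    (conj w)
  have hs : Tendsto (fun t : ℝ => t • ((w, 1) : ℂ × ℂ)) (𝓝 0) (𝓝 0) :=
    Continuous.tendsto' (by fun_prop) 0 _ (zero_smul _ _)
  have hsum : ∀ t : ℝ, (conj w * ∑ p ∈ indexBox (n + 1), (((if freq k₁ k₂ p = k₁ then
      E.l μ k₁ * E.uhat μ₀ k₁ k₂ μ p + E.nhat μ₀ k₁ k₂ μ p else 0) * t ^ size p : ℝ) : ℂ) *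
        indexMonomial p (w, 1)).im = -(E.resonant μ₀ k₁ k₂ μ * t ^ (n + 1)) := by
    intro t
    have hsize : size ((0, k₁), (k₂ - 1, 0)) = n + 1 := by
      simp only [size]
      omega
    have hfreq : freq k₁ k₂ ((0, k₁), (k₂ - 1, 0)) = (k₁ : ℤ) := by
      simp only [freq]
      push_cast [Nat.cast_sub (show 1 ≤ k₂ from hp₂)]
      ring
    rw [Finset.mul_sum, Complex.im_sum, Finset.sum_eq_single ((0, k₁), (k₂ - 1, 0))]
    · rw [if_pos hfreq, uhat_eq _ _ _ _ _ _ (by omega), ell,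
        if_pos (by rw [hfreq]; exact R.mem_iff.1 h₁), hsize, mul_left_comm, Complex.im_ofReal_mul]
      have : conj w * indexMonomial ((0, k₁), (k₂ - 1, 0)) (w, 1) = -Complex.I := by
        rw [← hpow]
        simp [indexMonomial]
      rw [this, resonant]
      simp
    · intro p hp hne'
      rw [mem_indexBox] at hp
      by_cases hf : freq k₁ k₂ p = k₁
      · rcases eq_of_freq_eq hp₁ hp₂ hc hf (by omega) with h | ⟨h, -⟩
        · exact absurd h hne'
        · rw [mul_left_comm, Complex.im_ofReal_mul]
          have : conj w * indexMonomial p (w, 1) =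
              ((Complex.normSq w ^ (p.2.1 + 1) : ℝ) : ℂ) := by
            rw [Complex.ofReal_pow, Complex.normSq_eq_conj_mul_self]
            simp only [indexMonomial, h, map_one, one_pow, mul_one]
            ring
          rw [this, Complex.ofReal_im, mul_zero]
      · rw [if_neg hf]
        simp
    · intro h
      exact absurd (mem_indexBox.2 hsize.le) h
  have hO : (fun t : ℝ => ((B (invariants k₁ k₂ (t • (w, 1))) - E.resonant μ₀ k₁ k₂ μ) *
      t ^ (n + 1) : ℝ)) =O[𝓝 0] fun t => t ^ (n + 1 + 1) := by
    have him := (Complex.imCLM.isBigO_comp _ _).trans hT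
    refine him.neg_left.congr' ?_ EventuallyEq.rfl
    filter_upwards [hs.eventually hdec] with t ht
    rw [Complex.imCLM_apply, mul_sub, Complex.sub_im, hsum, ht]
    have e1 : conj w * resonantMonomial k₁ k₂ (t • (w, 1)) =
        ((t ^ (n + 1) : ℝ) : ℂ) * -Complex.I := by
      have hk : k₂ - 1 + k₁ = n + 1 := by omega
      rw [← hpow, ← hk]
      simp only [resonantMonomial, Prod.smul_fst, Prod.smul_snd, Complex.real_smul, map_mul,
        Complex.conj_ofReal]
      push_cast
      ring
    have e2 : conj w * (t • ((w, 1) : ℂ × ℂ)).1 = ((t * Complex.normSq w : ℝ) : ℂ) := by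
      rw [Complex.ofReal_mul, Complex.normSq_eq_conj_mul_self]
      simp only [Prod.smul_fst, Complex.real_smul]
      ring
    rw [mul_add, mul_left_comm, e2, mul_left_comm, e1, Complex.add_im, Complex.im_ofReal_mul,
      Complex.im_ofReal_mul, Complex.im_ofReal_mul, Complex.ofReal_im]
    simp
    ring
  have hlim : Tendsto (fun t : ℝ => B (invariants k₁ k₂ (t • (w, 1))) - E.resonant μ₀ k₁ k₂ μ)
      (𝓝 0) (𝓝 (B 0 - E.resonant μ₀ k₁ k₂ μ)) := by
    have hi : Tendsto (fun t : ℝ => invariants k₁ k₂ (t • (w, 1))) (𝓝 0) (𝓝 0) := by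
      have := ((continuous_invariants k₁ k₂).tendsto 0).comp hs
      rwa [invariants_zero hp₂] at this
    exact (hB.tendsto.comp hi).sub_const _
  exact sub_eq_zero.1 (eq_zero_of_mul_pow_isBigO hlim hO)

end TwoModes

end PeriodicEquation

/-! ### Small solutions in terms of the reduction -/

namespace PeriodicEquation

variable {d : ℕ} {X Y : Type*} [NormedAddCommGroup X] [NormedSpace ℝ X] [PeriodicSpace X]
  [NormedAddCommGroup Y] [NormedSpace ℝ Y] [PeriodicSpace Y] {E : PeriodicEquation d X Y}
  {μ₀ μ : Param d} {K : Finset ℤ} {Φ : Param d × Y → X} {z : ℂ × ℂ}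

theorem exists_isReduction [CompleteSpace X] [CompleteSpace Y] (hmodes : modes X = modes Y)
    (hM : IsOpen E.M) (h1 : E.FredholmMultiplier) (h2 : E.MultilinearFourierSeries)
    (h4 : E.Analytic) (hμ₀ : μ₀ ∈ E.M) (hK : (K : Set ℤ) = E.kernelSet μ₀) :
    ∃ Φ : Param d × Y → X, IsReduction E μ₀ K Φ := by
  obtain ⟨Φ, ha, hr, hl⟩ := exists_reduction hmodes h1 h2 h4 hμ₀ hK
  exact ⟨Φ, hmodes, hM, h1, h2, h4, hμ₀, hK, ha, hr, hl⟩

theorem NoSmallAsymmetricSolutions.of_eventually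
    (h : ∀ᶠ p : Param d × X in 𝓝 (μ₀, 0), E.F p.1 p.2 = 0 → IsSymmetric (asFun p.2)) :
    E.NoSmallAsymmetricSolutions μ₀ := by
  obtain ⟨ε, hε, hball⟩ := Metric.eventually_nhds_iff_ball.1 h
  refine ⟨ε, hε, fun μ _ hμ u hu hF => not_not.2 (hball (μ, u) ?_ hF)⟩
  rw [mem_ball_iff_norm, Prod.norm_def]
  simpa using ⟨hμ, hu⟩

theorem isSymmetric_zero : IsSymmetric (asFun (0 : X)) :=
  (isSymmetric_iff _).2 ⟨0, fun k => by simp [coeff_zero]⟩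

theorem reducedSol_swap (k₁ k₂ : ℤ) (z : ℂ × ℂ) :
    reducedSol Φ k₁ k₂ (μ, z.swap) = reducedSol Φ k₂ k₁ (μ, z) := by
  rw [reducedSol, reducedSol, modeSum_apply, modeSum_apply, add_comm]
  rfl

theorem reducedEq_swap (k₁ k₂ k : ℤ) (z : ℂ × ℂ) :
    reducedEq E Φ k₁ k₂ k (μ, z.swap) = reducedEq E Φ k₂ k₁ k (μ, z) := by
  rw [reducedEq, reducedEq, reducedSol_swap]

/-- In the kernel, a function is given by the coefficients of the two modes. -/
theorem coeff_modeSum_of_mem {Z : Type*} [NormedAddCommGroup Z] [NormedSpace ℝ Z]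
    [PeriodicSpace Z] (R : IsReduction E μ₀ K Φ)
    {k₁ k₂ : ℕ} (hK : K = {(k₁ : ℤ), -(k₁ : ℤ), (k₂ : ℤ), -(k₂ : ℤ)})
    (hp₁ : 0 < k₁) (hp₂ : 0 < k₂) (hne : k₁ ≠ k₂) (y : Z) {k : ℤ} (hk : k ∈ K) :
    coeff (modeSum Y k₁ k₂ (2 * coeff y k₁, 2 * coeff y k₂)) k = coeff y k := by
  have e1 : (k₁ : ℤ) ≠ -k₁ := by omega
  have e2 : (k₂ : ℤ) ≠ -k₂ := by omega
  have e3 : (k₁ : ℤ) ≠ -k₂ := by omega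
  have e4 : (k₂ : ℤ) ≠ -k₁ := by omega
  rw [coeff_modeSum (R.mem_modes_right (by simp [hK])) (R.mem_modes_right (by simp [hK]))]
  simp only [hK, Finset.mem_insert, Finset.mem_singleton] at hk
  rcases hk with rfl | rfl | rfl | rfl
  · simp [e1, e3, hne]
  · simp [e1.symm, e4.symm, hne, coeff_neg_index, Complex.conj_ofNat]
  · simp [e2, e4, hne.symm]
  · simp [e2.symm, e3.symm, hne.symm, coeff_neg_index, Complex.conj_ofNat]

namespace IsReduction

variable [CompleteSpace X] [CompleteSpace Y] (R : IsReduction E μ₀ K Φ)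
include R

theorem exists_admissible_ball (k₁ k₂ : ℤ) : ∃ r > 0, ∀ μ : Param d, ‖μ - μ₀‖ < r →
    ∀ z : ℂ × ℂ, ‖z‖ < r → IsAdmissible E K Φ k₁ k₂ (μ, z) := by
  obtain ⟨r, hr, hball⟩ := Metric.eventually_nhds_iff_ball.1
    (R.eventually_isAdmissible (k₁ := k₁) (k₂ := k₂))
  refine ⟨r, hr, fun μ hμ z hz => hball (μ, z) ?_⟩
  rw [mem_ball_iff_norm, Prod.norm_def]
  simpa using ⟨hμ, hz⟩

/-- A small solution is determined by its modes in the kernel. -/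
theorem eventually_eq_reducedSol (k₁ k₂ : ℤ) (L : X →L[ℝ] ℂ × ℂ)
    (hL : ∀ u, ∀ k ∈ K, coeff u k = coeff (modeSum Y k₁ k₂ (L u)) k)
    (hL' : ∀ u, ∀ k ∉ K, coeff (modeSum Y k₁ k₂ (L u)) k = 0) :
    ∀ᶠ p : Param d × X in 𝓝 (μ₀, 0), E.F p.1 p.2 = 0 →
      p.2 = reducedSol Φ k₁ k₂ (p.1, L p.2) := by
  filter_upwards [R.left_inv] with p hp hF
  have : augmented E K p = modeSum Y k₁ k₂ (L p.2) := eq_of_coeff_eq fun k => by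
    rw [R.coeff_augmented, hF, coeff_zero]
    split_ifs with hk
    · exact hL _ k hk
    · exact (hL' _ k hk).symm
  rw [reducedSol, ← this, hp]

/-- Small solutions are symmetric if a condition on their modes in the kernel, which permits a
rotation of the phases, is satisfied. -/
theorem eventually_isSymmetric {k₁ k₂ : ℤ} (h₁ : k₁ ∈ K) (h₂ : k₂ ∈ K) (L : X →L[ℝ] ℂ × ℂ)
    (hL : ∀ᶠ p : Param d × X in 𝓝 (μ₀, 0), E.F p.1 p.2 = 0 →
      p.2 = reducedSol Φ k₁ k₂ (p.1, L p.2))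
    (hrot : ∀ᶠ p : Param d × (ℂ × ℂ) in 𝓝 (μ₀, 0), ∀ u, L u = p.2 →
      E.F p.1 (reducedSol Φ k₁ k₂ p) = 0 → ∃ a : ℝ,
      (rotate k₁ k₂ (a : Torus) p.2).1.im = 0 ∧ (rotate k₁ k₂ (a : Torus) p.2).2.im = 0) :
    ∀ᶠ p : Param d × X in 𝓝 (μ₀, 0), E.F p.1 p.2 = 0 → IsSymmetric (asFun p.2) := by
  obtain ⟨r, hr, hball⟩ := R.exists_admissible_ball k₁ k₂
  have hLt : Tendsto (fun p : Param d × X => (p.1, L p.2)) (𝓝 (μ₀, 0)) (𝓝 (μ₀, 0)) :=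
    Continuous.tendsto' (by fun_prop) _ _ (by simp)
  have hbt : ∀ᶠ p : Param d × X in 𝓝 (μ₀, 0), ‖p.1 - μ₀‖ < r ∧ ‖L p.2‖ < r := by
    filter_upwards [hLt.eventually (Metric.ball_mem_nhds _ hr)] with p hp
    rw [dist_eq_norm, Prod.norm_def] at hp
    simpa using hp
  filter_upwards [hL, hLt.eventually hrot, hbt] with p hp hrp hb hF
  have heq := hp hF
  obtain ⟨a, ha₁, ha₂⟩ := hrp p.2 rfl (by rw [← heq, hF])
  rw [heq]
  exact isSymmetric_reducedSol_of_rotate R h₁ h₂ (hball p.1 hb.1) hb.2 ha₁ ha₂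

variable {k₁ k₂ : ℕ} (h₁ : (k₁ : ℤ) ∈ K) (h₂ : (k₂ : ℤ) ∈ K)
include h₁ h₂

/-- The structure of the reduced equation. -/
theorem exists_decomposition (hp₁ : 0 < k₁) (hp₂ : 0 < k₂) (hne : k₁ ≠ k₂)
    (hc : Nat.Coprime k₁ k₂) :
    ∃ A B : Param d × (ℝ × ℝ × ℂ) → ℝ, AnalyticAt ℝ A (μ₀, 0) ∧ AnalyticAt ℝ B (μ₀, 0) ∧
      (∀ᶠ p in 𝓝 (μ₀, (0 : ℂ × ℂ)), reducedEq E Φ k₁ k₂ k₁ p =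
        A (p.1, invariants k₁ k₂ p.2) * p.2.1 +
          B (p.1, invariants k₁ k₂ p.2) * resonantMonomial k₁ k₂ p.2) ∧
      ∀ᶠ μ in 𝓝 μ₀, A (μ, 0) = E.l μ k₁ / 2 ∧ B (μ, 0) = E.resonant μ₀ k₁ k₂ μ := by
  obtain ⟨r, hr, hball⟩ := R.exists_admissible_ball k₁ k₂
  have hmem : ∀ᶠ p in 𝓝 (μ₀, (0 : ℂ × ℂ)), ‖p.1 - μ₀‖ < r ∧ ‖p.2‖ < r := by
    filter_upwards [Metric.ball_mem_nhds _ hr] with p hp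
    rw [mem_ball_iff_norm, Prod.norm_def] at hp
    simpa using hp
  obtain ⟨A, B, hA, hB, hdec⟩ := exists_equivariant_decomposition (f := reducedEq E Φ k₁ k₂ k₁)
    hp₁ hp₂ hc
    ((hball μ₀ (by simpa using hr) 0 (by simpa using hr)).analyticAt_reducedEq _) (by
      filter_upwards [hmem] with p hp a
      exact reducedEq_rotate R h₁ h₂ (hball p.1 hp.1) hp.2 a k₁) (by
      filter_upwards [hmem] with p hp
      exact reducedEq_conj R h₁ h₂ (hball p.1 hp.1) hp.2 k₁)
  refine ⟨A, B, hA, hB, hdec, ?_⟩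
  have ht : Tendsto (fun μ : Param d => (μ, (0 : ℝ × ℝ × ℂ))) (𝓝 μ₀) (𝓝 (μ₀, 0)) :=
    Continuous.tendsto (by fun_prop) _
  have ht' : Tendsto (fun μ : Param d => (μ, (0 : ℂ × ℂ))) (𝓝 μ₀) (𝓝 (μ₀, 0)) :=
    Continuous.tendsto (by fun_prop) _
  filter_upwards [ht.eventually hA.eventually_analyticAt, ht.eventually hB.eventually_analyticAt,
    ht'.eventually hdec.eventually_nhds, R.eventually_isRegular] with μ hAμ hBμ hd hμ
  have hd' := (Continuous.tendsto' (f := fun z : ℂ × ℂ => (μ, z)) (by fun_prop) 0 _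
    rfl).eventually hd
  have hcont : ContinuousAt (fun x : ℝ × ℝ × ℂ => (μ, x)) 0 := by fun_prop
  exact ⟨symbol_of_decomposition R h₁ h₂ hp₁ hp₂ hμ (A := fun x => A (μ, x))
      (B := fun x => B (μ, x)) (hAμ.continuousAt.comp' hcont) hd',
    resonant_of_decomposition R h₁ h₂ hp₁ hp₂ hne hc hμ (A := fun x => A (μ, x))
      (B := fun x => B (μ, x)) (hBμ.continuousAt.comp' hcont) hd'⟩

end IsReduction

/-! ### Absence of small asymmetric solutions -/

section NecessaryConditions

variable [CompleteSpace X] [CompleteSpace Y] (hmodes : modes X = modes Y)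
    (hM : IsOpen E.M) (h1 : E.FredholmMultiplier) (h2 : E.MultilinearFourierSeries)
    (h4 : E.Analytic) (hμ₀ : μ₀ ∈ E.M)
include hmodes hM h1 h2 h4 hμ₀

/-- With an empty kernel the augmented map is `F` itself, and its local inverse leaves only the
trivial solution. -/
theorem noSmallAsymmetricSolutions_of_kernelSet_eq_empty (hK : E.kernelSet μ₀ = ∅) :
    E.NoSmallAsymmetricSolutions μ₀ := by
  obtain ⟨Φ, R⟩ := exists_isReduction (K := ∅) hmodes hM h1 h2 h4 hμ₀ (by simp [hK])
  refine .of_eventually ?_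
  filter_upwards [R.left_inv, (continuous_fst.tendsto (μ₀, (0 : X))).eventually
    R.eventually_isRegular] with p hp hreg hF
  have : augmented E ∅ p = 0 := eq_of_coeff_eq fun k => by
    rw [R.coeff_augmented, hF]
    simp
  rw [this, hreg.apply_zero R] at hp
  rw [← hp]
  exact isSymmetric_zero

/-- The two-mode reduction is used with the wavenumber `k` in both places and second amplitude zero;
a single phase can always be rotated to a real value. -/
theorem noSmallAsymmetricSolutions_of_kernelSet_eq_pair {k : ℕ} (hk : 0 < k)
    (hK : E.kernelSet μ₀ = {(k : ℤ), -(k : ℤ)}) : E.NoSmallAsymmetricSolutions μ₀ := by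
  obtain ⟨Φ, R⟩ := exists_isReduction (K := {(k : ℤ), -(k : ℤ)}) hmodes hM h1 h2 h4 hμ₀
    (by simp [hK])
  have hkK : (k : ℤ) ∈ ({(k : ℤ), -(k : ℤ)} : Finset ℤ) := by simp
  have hkY := R.mem_modes_right hkK
  refine .of_eventually (R.eventually_isSymmetric hkK hkK
    (((2 : ℝ) • coeffL (k : ℤ)).prod 0) (R.eventually_eq_reducedSol k k _ ?_ ?_) ?_)
  · intro u j hj
    simp only [Finset.mem_insert, Finset.mem_singleton] at hj
    have hne : (k : ℤ) ≠ -k := by omega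
    rw [coeff_modeSum hkY hkY]
    rcases hj with rfl | rfl
    · simp [hne]
    · simp [hne.symm, coeff_neg_index, Complex.conj_ofNat]
  · intro u j hj
    simp only [Finset.mem_insert, Finset.mem_singleton, not_or] at hj
    rw [coeff_modeSum hkY hkY]
    simp [hj.1, hj.2]
  · refine Eventually.of_forall fun p u hu _ => ?_
    have h0 : p.2.2 = 0 := by rw [← hu]; simp
    obtain ⟨a, ha, -⟩ := exists_rotate_real (k₂ := 1) hk one_pos (Nat.coprime_one_right k)
      (z := (p.2.1, 0)) (by simp [invariants, hk.ne'])
    exact ⟨a, ha, by simp [rotate, h0]⟩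

/-- Multiplying the first reduced equation by `z̄₁` and taking imaginary parts removes the real
coefficient `A` and leaves `B Im ζ = 0` with `B ≠ 0` near `(μ₀, 0)`. The phases are then in
resonance. -/
theorem noSmallAsymmetricSolutions_of_resonant_ne_zero {k₁ k₂ : ℕ} (hp₁ : 0 < k₁) (hp₂ : 0 < k₂)
    (hne : k₁ ≠ k₂) (hc : Nat.Coprime k₁ k₂)
    (hK : E.kernelSet μ₀ = {(k₁ : ℤ), -(k₁ : ℤ), (k₂ : ℤ), -(k₂ : ℤ)})
    (hres : E.resonant μ₀ k₁ k₂ μ₀ ≠ 0) : E.NoSmallAsymmetricSolutions μ₀ := by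
  obtain ⟨Φ, R⟩ := exists_isReduction (K := {(k₁ : ℤ), -(k₁ : ℤ), (k₂ : ℤ), -(k₂ : ℤ)})
    hmodes hM h1 h2 h4 hμ₀ (by simp [hK])
  have hk₁ : (k₁ : ℤ) ∈ ({(k₁ : ℤ), -(k₁ : ℤ), (k₂ : ℤ), -(k₂ : ℤ)} : Finset ℤ) := by simp
  have hk₂ : (k₂ : ℤ) ∈ ({(k₁ : ℤ), -(k₁ : ℤ), (k₂ : ℤ), -(k₂ : ℤ)} : Finset ℤ) := by simp
  have hY₁ := R.mem_modes_right hk₁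
  have hY₂ := R.mem_modes_right hk₂
  refine .of_eventually (R.eventually_isSymmetric hk₁ hk₂
    (((2 : ℝ) • coeffL (k₁ : ℤ)).prod ((2 : ℝ) • coeffL (k₂ : ℤ)))
    (R.eventually_eq_reducedSol k₁ k₂ _ ?_ ?_) ?_)
  · exact fun u j hj => (coeff_modeSum_of_mem R rfl hp₁ hp₂ hne u hj).symm
  · intro u j hj
    simp only [Finset.mem_insert, Finset.mem_singleton, not_or] at hj
    rw [coeff_modeSum hY₁ hY₂]
    simp [hj.1, hj.2.1, hj.2.2.1, hj.2.2.2]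
  · obtain ⟨A, B, -, hB, hdec, hval⟩ := R.exists_decomposition hk₁ hk₂ hp₁ hp₂ hne hc
    have hB0 : B (μ₀, 0) ≠ 0 := by rwa [hval.self_of_nhds.2]
    have hinv : Tendsto (fun p : Param d × (ℂ × ℂ) => (p.1, invariants k₁ k₂ p.2)) (𝓝 (μ₀, 0))
        (𝓝 (μ₀, 0)) :=
      Continuous.tendsto' (continuous_fst.prodMk ((continuous_invariants k₁ k₂).comp
        continuous_snd)) _ _ (by simp [invariants_zero hp₂])
    filter_upwards [hdec, (hB.continuousAt.tendsto.comp hinv).eventually_ne hB0] with p hp hBp u _ hF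
    refine exists_rotate_real hp₁ hp₂ hc ?_
    have h0 : reducedEq E Φ k₁ k₂ k₁ p = 0 := by rw [reducedEq, hF, coeff_zero]
    rw [hp] at h0
    have h := congrArg (fun w => (conj p.2.1 * w).im) h0
    simp only [mul_zero, Complex.zero_im, mul_add] at h
    rw [mul_left_comm, mul_left_comm _ (B _ : ℂ), conj_mul_resonantMonomial hp₂,
      ← Complex.normSq_eq_conj_mul_self, Complex.add_im, Complex.im_ofReal_mul,
      Complex.im_ofReal_mul, Complex.ofReal_im, mul_zero, zero_add, Complex.conj_im,
      mul_eq_zero, neg_eq_zero] at h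
    exact h.resolve_left hBp

theorem noSmallAsymmetricSolutions_of_encard_eq_two (hK : (E.kernelSet μ₀).encard = 2) :
    E.NoSmallAsymmetricSolutions μ₀ := by
  obtain ⟨a, b, hab, hS⟩ := Set.encard_eq_two.1 hK
  have hneg : ∀ k, k = a ∨ k = b → -k = a ∨ -k = b := fun k hk => by
    have := neg_mem_kernelSet h1 hμ₀ (k := k) (by rw [hS]; exact hk)
    rwa [hS] at this
  have ha := hneg a (Or.inl rfl)
  have hb := hneg b (Or.inr rfl)
  -- A two-element set that is symmetric about `0` cannot contain `0`.
  have hb' : b = -a := by omega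
  refine noSmallAsymmetricSolutions_of_kernelSet_eq_pair hmodes hM h1 h2 h4 hμ₀ (k := a.natAbs)
    (by omega) ?_
  rw [hS, hb']
  rcases Int.natAbs_eq a with h | h
  · rw [← h]
  · rw [show (a.natAbs : ℤ) = -a by omega, neg_neg, Set.pair_comm]

end NecessaryConditions

end PeriodicEquation

/-! ### The identity implied by the variational structure -/

theorem integral_fourier_mul (f : Torus → ℂ) (k : ℤ) :
    ∫ x : Torus, (fourier k x : ℂ) * f x = (2 * Real.pi : ℝ) * fourierCoeff f (-k) := by
  rw [AddCircle.volume_eq_smul_haarAddCircle, integral_smul_measure, fourierCoeff,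
    ENNReal.toReal_ofReal Real.two_pi_pos.le, neg_neg]
  simp [Complex.real_smul]

/-- The points at which the two phases are not in resonance are dense. -/
theorem frequently_im_invariants_ne_zero {k₁ k₂ : ℕ} (hp₂ : 0 < k₂) (z : ℂ × ℂ) :
    ∃ᶠ z' in 𝓝 z, (invariants k₁ k₂ z').2.2.im ≠ 0 := by
  intro h
  simp only [not_not] at h
  have han : AnalyticOnNhd ℝ (fun z : ℂ × ℂ => (invariants k₁ k₂ z).2.2.im) Set.univ := fun z _ =>
    (Complex.imCLM.analyticAt _).fun_comp
      ((analyticAt_fst.pow k₂).mul (((PeriodicEquation.analyticAt_conj _).fun_comp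
        analyticAt_snd).pow k₁))
  have h0 := han.eqOn_zero_of_preconnected_of_eventuallyEq_zero isPreconnected_univ
    (Set.mem_univ z) h
  -- Vanishing near one point would propagate to the whole space by analyticity, contradicting the
  -- value `1` at `(w, 1)`.
  obtain ⟨w, hw⟩ := IsAlgClosed.exists_pow_nat_eq Complex.I hp₂
  have := h0 (Set.mem_univ ((w, 1) : ℂ × ℂ))
  simp [invariants, hw] at this

theorem invariants_swap (k₁ k₂ : ℕ) (z : ℂ × ℂ) : invariants k₂ k₁ z.swap =
    ((invariants k₁ k₂ z).2.1, (invariants k₁ k₂ z).1, conj (invariants k₁ k₂ z).2.2) := by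
  simp [invariants, mul_comm]

namespace PeriodicEquation

section Integral

variable {X Y : Type*} [NormedAddCommGroup X] [NormedSpace ℝ X] [PeriodicSpace X]
  [NormedAddCommGroup Y] [NormedSpace ℝ Y] [PeriodicSpace Y]

theorem asFun_sub (u v : X) : ∀ᵐ x : Torus, asFun (u - v) x = asFun u x - asFun v x := by
  simp only [asFun, map_sub]
  exact Lp.coeFn_sub _ _

theorem represents_realMode {k : ℤ} (hk : k ∈ modes Y) (c : ℂ) :
    Represents (realMode c k : Y) fun x => (c * fourier k x).re := by
  rw [realMode_eq]
  filter_upwards [asFun_sub (c.re • (modeVec Y k).1) (c.im • (modeVec Y k).2),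
    asFun_smul c.re (modeVec Y k).1, asFun_smul c.im (modeVec Y k).2,
    represents_modeVec_fst hk, represents_modeVec_snd hk] with x h0 h1 h2 h3 h4
  rw [h0, h1, h2, h3, h4, Complex.mul_re, cosMode, sinMode]

theorem integral_realMode_mul {k : ℤ} (hk : k ∈ modes Y) (c : ℂ) (w : X) :
    Integrable (fun x : Torus => asFun (realMode c k : Y) x * asFun w x) ∧
    ∫ x : Torus, asFun (realMode c k : Y) x * asFun w x =
      2 * Real.pi * (c * conj (coeff w k)).re := by
  have hrep : ∀ᵐ x : Torus, asFun (realMode c k : Y) x * asFun w x =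
      (c * ((fourier k x : ℂ) * (asFun w x : ℝ))).re := by
    filter_upwards [represents_realMode hk c] with x hx
    rw [hx, ← mul_assoc, Complex.re_mul_ofReal]
  have hint : Integrable fun x : Torus => c * ((fourier k x : ℂ) * (asFun w x : ℝ)) := by
    refine Integrable.const_mul ?_ c
    refine ((asFun_ofReal_memLp w).integrable (by norm_num)).bdd_mul (c := 1)
      (fourier k).continuous.aestronglyMeasurable (Eventually.of_forall fun x => ?_)
    rw [norm_fourier_apply]
  refine ⟨hint.re.congr (hrep.mono fun x hx => hx.symm), ?_⟩
  rw [integral_congr_ae hrep]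
  have := integral_re hint
  simp only [RCLike.re_to_complex] at this
  rw [this, integral_const_mul, integral_fourier_mul, mul_left_comm, Complex.re_ofReal_mul,
    ← coeff_neg_index]
  rfl

end Integral

variable {d : ℕ} {X Y : Type*} [NormedAddCommGroup X] [NormedSpace ℝ X] [PeriodicSpace X]
  [NormedAddCommGroup Y] [NormedSpace ℝ Y] [PeriodicSpace Y] {E : PeriodicEquation d X Y}
  {μ₀ μ : Param d} {K : Finset ℤ} {Φ : Param d × Y → X} {z : ℂ × ℂ} {k₁ k₂ : ℕ}

section Variational

variable (R : IsReduction E μ₀ K Φ) (hK : K = {(k₁ : ℤ), -(k₁ : ℤ), (k₂ : ℤ), -(k₂ : ℤ)})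
  (hp₁ : 0 < k₁) (hp₂ : 0 < k₂) (hne : k₁ ≠ k₂)

include R hK hp₁ hp₂ hne

variable {p : Param d × (ℂ × ℂ)}

theorem coeff_reducedSol_fst (hp : IsAdmissible E K Φ k₁ k₂ p) :
    coeff (reducedSol Φ k₁ k₂ p) k₁ = p.2.1 / 2 := by
  have h₁ : (k₁ : ℤ) ∈ K := by simp [hK]
  have h₂ : (k₂ : ℤ) ∈ K := by simp [hK]
  have h := congrArg (fun y => coeff y (k₁ : ℤ)) hp.augmented_eq
  rw [R.coeff_augmented, if_pos h₁, coeff_modeSum (R.mem_modes_right h₁) (R.mem_modes_right h₂),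
    if_pos rfl, if_neg (by omega), if_neg (by exact_mod_cast hne), if_neg (by omega)] at h
  simpa using h

theorem coeff_reducedSol_snd (hp : IsAdmissible E K Φ k₁ k₂ p) :
    coeff (reducedSol Φ k₁ k₂ p) k₂ = p.2.2 / 2 := by
  have h₁ : (k₁ : ℤ) ∈ K := by simp [hK]
  have h₂ : (k₂ : ℤ) ∈ K := by simp [hK]
  have h := congrArg (fun y => coeff y (k₂ : ℤ)) hp.augmented_eq
  rw [R.coeff_augmented, if_pos h₂, coeff_modeSum (R.mem_modes_right h₁) (R.mem_modes_right h₂),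
    if_neg (by exact_mod_cast hne.symm), if_neg (by omega), if_pos rfl, if_neg (by omega)] at h
  simpa using h

/-- Off `K` the augmented equation already gives `F = 0`, so `F` along the reduction is determined
by its two kernel coefficients. -/
theorem F_reducedSol (hp : IsAdmissible E K Φ k₁ k₂ p) :
    E.F p.1 (reducedSol Φ k₁ k₂ p) =
      modeSum Y k₁ k₂ (2 * reducedEq E Φ k₁ k₂ k₁ p, 2 * reducedEq E Φ k₁ k₂ k₂ p) := by
  refine eq_of_coeff_eq fun k => ?_
  by_cases hk : k ∈ K
  · exact (coeff_modeSum_of_mem R hK hp₁ hp₂ hne _ hk).symm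
  · have h := congrArg (fun y => coeff y k) hp.augmented_eq
    rw [R.coeff_augmented, if_neg hk] at h
    have h₁ : (k₁ : ℤ) ∈ K := by simp [hK]
    have h₂ : (k₂ : ℤ) ∈ K := by simp [hK]
    rw [h, hp.regular.coeff_modeSum_of_notMem R h₁ h₂ hk,
      hp.regular.coeff_modeSum_of_notMem R h₁ h₂ hk]

/-- The solvability condition that comes from translation invariance and the variational
structure, for small amplitudes. -/
theorem eventually_variational_identity (h3 : E.Variational) {r : ℝ} (hr0 : 0 < r)
    (hr : ∀ z : ℂ × ℂ, ‖z‖ < r → IsAdmissible E K Φ k₁ k₂ (μ, z)) :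
    ∀ᶠ z in 𝓝 (0 : ℂ × ℂ), k₁ * (reducedEq E Φ k₁ k₂ k₁ (μ, z) * conj z.1).im +
      k₂ * (reducedEq E Φ k₁ k₂ k₂ (μ, z) * conj z.2).im = 0 := by
  have h₁ : (k₁ : ℤ) ∈ K := by simp [hK]
  have h₂ : (k₂ : ℤ) ∈ K := by simp [hK]
  have hreg := (hr 0 (by simpa using hr0)).regular
  obtain ⟨J, hJ⟩ := h3 μ hreg.mem
  have hcont : Tendsto (fun z : ℂ × ℂ => reducedSol Φ k₁ k₂ (μ, z)) (𝓝 0) (𝓝 0) := by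
    have := (analyticAt_slice (hr 0 (by simpa using hr0)).analyticAt_sol).continuousAt.tendsto
    simpa [reducedSol, hreg.apply_zero R] using this
  obtain ⟨δ, hδ, hball⟩ := Metric.eventually_nhds_iff_ball.1 (hcont.eventually hJ)
  filter_upwards [Metric.ball_mem_nhds (0 : ℂ × ℂ) (lt_min hδ hr0)] with z hz
  rw [mem_ball_zero_iff, lt_min_iff] at hz
  set f₁ := reducedEq E Φ k₁ k₂ k₁ (μ, z) with hf₁
  set f₂ := reducedEq E Φ k₁ k₂ k₂ (μ, z) with hf₂
  set C : ℝ := 2 * Real.pi * (k₁ * (f₁ * conj z.1).im + k₂ * (f₂ * conj z.2).im) with hC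
  -- The functional has constant derivative `C` along this orbit of rotated amplitudes. The orbit
  -- closes after `2π`, so `C = 0`; no translation invariance of the functional itself is needed.
  let γ : ℝ → X := fun s => reducedSol Φ k₁ k₂ (μ, rotate k₁ k₂ (s : Torus) z)
  have hderiv : ∀ s, HasDerivAt (fun s => J (γ s)) C s := by
    intro s
    have hz' : ‖rotate k₁ k₂ (s : Torus) z‖ < r := by rw [norm_rotate]; exact hz.2
    obtain ⟨J', hJ', hJw⟩ := hball (rotate k₁ k₂ (s : Torus) z) (by
      rw [mem_ball_zero_iff, norm_rotate]; exact hz.1)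
    have hfd : ∀ (k : ℤ) (c : ℂ), HasDerivAt (fun s : ℝ => (fourier k (s : Torus) : ℂ) * c)
        (Complex.I * k * ((fourier k (s : Torus) : ℂ) * c)) s := fun k c => by
      have := (hasDerivAt_fourier (2 * Real.pi) k s).mul_const c
      refine this.congr_deriv ?_
      have : (Real.pi : ℂ) ≠ 0 := by exact_mod_cast Real.pi_ne_zero
      push_cast
      field_simp
    have hrd : DifferentiableAt ℝ (fun s : ℝ => rotate k₁ k₂ (s : Torus) z) s :=
      ((hfd _ _).prodMk (hfd _ _)).differentiableAt
    have hγ : HasDerivAt γ (deriv γ s) s :=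
      (DifferentiableAt.comp (g := fun z => reducedSol Φ k₁ k₂ (μ, z)) s (analyticAt_slice (hr _ hz').analyticAt_sol).differentiableAt
        hrd).hasDerivAt
    -- Elements of `X` need not have derivatives in `X`. The tangent exists because the reduction is
    -- analytic in the amplitudes, and its coefficients are found from equivariance.
    have hw : ∀ k : ℤ, coeff (deriv γ s) k = Complex.I * k * coeff (γ s) k := fun k => by
      have e1 : HasDerivAt (fun s => coeff (γ s) k) (coeff (deriv γ s) k) s :=
        (coeffL k : X →L[ℝ] ℂ).hasFDerivAt.comp_hasDerivAt s hγ
      have e2 : (fun s => coeff (γ s) k) = fun s : ℝ => (fourier k (s : Torus) : ℂ) *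
          coeff (reducedSol Φ k₁ k₂ (μ, z)) k := by
        funext s
        exact coeff_reducedSol_rotate R h₁ h₂ hr hz.2 _ k
      rw [e2] at e1
      rw [e1.unique (hfd k _)]
      exact congrArg _ (congrFun e2 s).symm
    refine (hJ'.comp_hasDerivAt s hγ).congr_deriv ?_
    have hp := hr _ hz'
    have hunit : ∀ k : ℤ, (fourier k (s : Torus) : ℂ) * conj (fourier k (s : Torus) : ℂ) = 1 :=
      fun k => by rw [Complex.mul_conj, Complex.normSq_eq_norm_sq, norm_fourier_apply]; simp
    obtain ⟨i1, v1⟩ := integral_realMode_mul (R.mem_modes_right h₁)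
      (2 * (fourier k₁ (s : Torus) * f₁)) (deriv γ s)
    obtain ⟨i2, v2⟩ := integral_realMode_mul (R.mem_modes_right h₂)
      (2 * (fourier k₂ (s : Torus) * f₂)) (deriv γ s)
    have hF := F_reducedSol R hK hp₁ hp₂ hne hp
    simp only [reducedEq_rotate R h₁ h₂ hr hz.2, ← hf₁, ← hf₂] at hF
    rw [hJw, hF, modeSum_apply]
    have hsum := asFun_add (realMode (2 * (fourier (k₁ : ℤ) (s : Torus) * f₁)) k₁ : Y)
      (realMode (2 * (fourier (k₂ : ℤ) (s : Torus) * f₂)) k₂ : Y)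
    rw [integral_congr_ae (g := fun x => asFun (realMode (2 * (fourier (k₁ : ℤ) (s : Torus) * f₁))
      k₁ : Y) x * asFun (deriv γ s) x + asFun (realMode (2 * (fourier (k₂ : ℤ) (s : Torus) * f₂))
      k₂ : Y) x * asFun (deriv γ s) x) (hsum.mono fun x hx => by
        simp only [hx, add_mul]), integral_add i1 i2, v1, v2, hw, hw,
      coeff_reducedSol_fst R hK hp₁ hp₂ hne hp, coeff_reducedSol_snd R hK hp₁ hp₂ hne hp]
    have hre : ∀ (k : ℤ) (f w : ℂ), (2 * ((fourier k (s : Torus) : ℂ) * f) *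
        conj (Complex.I * k * ((fourier k (s : Torus) : ℂ) * w / 2))).re =
        k * (f * conj w).im := fun k f w => by
      have : 2 * ((fourier k (s : Torus) : ℂ) * f) *
        conj (Complex.I * k * ((fourier k (s : Torus) : ℂ) * w / 2)) =
          ((k : ℝ) : ℂ) * (-Complex.I * (f * conj w)) := by
        simp only [map_mul, map_div₀, Complex.conj_I, Complex.conj_ofNat, map_intCast]
        push_cast
        linear_combination (-Complex.I * k * f * conj w) * hunit k
      rw [this, Complex.re_ofReal_mul]
      simp
    simp only [rotate]
    rw [hre, hre, hC]
    push_cast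
    ring
  have hconst := is_const_of_deriv_eq_zero (f := fun s => J (γ s) - s * C)
    (fun s => ((hderiv s).sub ((hasDerivAt_id s).mul_const C)).differentiableAt)
    (fun s => by
      have := ((hderiv s).sub ((hasDerivAt_id s).mul_const C)).deriv
      exact this.trans (by simp)) 0 (2 * Real.pi)
  have hγ : γ (2 * Real.pi) = γ 0 := by
    have : ((2 * Real.pi : ℝ) : Torus) = ((0 : ℝ) : Torus) := by
      rw [AddCircle.coe_period]; rfl
    simp only [γ]
    rw [this]
  simp only [hγ, zero_mul, sub_zero] at hconst
  have h0 : 2 * Real.pi * C = 0 := by linarith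
  have hC0 := (mul_eq_zero.1 h0).resolve_left Real.two_pi_pos.ne'
  exact (mul_eq_zero.1 hC0).resolve_left Real.two_pi_pos.ne'

/-- The functional is given for each `μ` separately, on a neighbourhood of `0` that may shrink with
`μ`. Analyticity along segments extends the identity to the ball of admissible amplitudes, whose
radius can be taken uniform in `μ`. -/
theorem variational_identity (h3 : E.Variational) {r : ℝ}
    (hr : ∀ z : ℂ × ℂ, ‖z‖ < r → IsAdmissible E K Φ k₁ k₂ (μ, z)) (hz : ‖z‖ < r) :
    k₁ * (reducedEq E Φ k₁ k₂ k₁ (μ, z) * conj z.1).im +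
      k₂ * (reducedEq E Φ k₁ k₂ k₂ (μ, z) * conj z.2).im = 0 := by
  refine eq_zero_of_isBigO_pow_along_segment (g := fun z : ℂ × ℂ =>
    k₁ * (reducedEq E Φ k₁ k₂ k₁ (μ, z) * conj z.1).im +
      k₂ * (reducedEq E Φ k₁ k₂ k₂ (μ, z) * conj z.2).im) (fun t ht => ?_) (fun n => ?_)
  · have hp := hr _ (norm_smul_lt_of_mem_Icc hz ht)
    have him : ∀ w : ℂ, AnalyticAt ℝ Complex.im w := fun w => Complex.imCLM.analyticAt w
    exact (analyticAt_const.mul ((him _).fun_comp ((analyticAt_slice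
      (hp.analyticAt_reducedEq k₁)).mul ((analyticAt_conj _).fun_comp analyticAt_fst)))).add
      (analyticAt_const.mul ((him _).fun_comp ((analyticAt_slice
      (hp.analyticAt_reducedEq k₂)).mul ((analyticAt_conj _).fun_comp analyticAt_snd))))
  · have hs : Tendsto (fun t : ℝ => t • z) (𝓝 0) (𝓝 0) :=
      Continuous.tendsto' (by fun_prop) 0 _ (zero_smul _ _)
    refine (Asymptotics.isBigO_zero (fun t : ℝ => t ^ n) (𝓝 0)).congr' ?_ EventuallyEq.rfl
    filter_upwards [hs.eventually (eventually_variational_identity R hK hp₁ hp₂ hne h3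
      ((norm_nonneg z).trans_lt hz) hr)] with t ht
    exact ht.symm

end Variational

end PeriodicEquation

theorem im_invariants_rotate (k₁ k₂ : ℕ) (a : Torus) (z : ℂ × ℂ) :
    (invariants k₁ k₂ (rotate k₁ k₂ a z)).2.2 = (invariants k₁ k₂ z).2.2 := by
  have h : (fourier k₁ a : ℂ) ^ k₂ * conj (fourier k₂ a : ℂ) ^ k₁ = 1 := by
    rw [fourier_pow, ← map_pow, fourier_pow, mul_comm (k₁ : ℤ), Complex.mul_conj,
      Complex.normSq_eq_norm_sq, norm_fourier_apply]
    simp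
  simp only [invariants, rotate, map_mul, mul_pow]
  linear_combination (z.1 ^ k₂ * conj z.2 ^ k₁) * h

theorem norm_invariants_le {k₁ k₂ : ℕ} (hp₁ : 0 < k₁) (hp₂ : 0 < k₂) {z : ℂ × ℂ} (hz : ‖z‖ ≤ 1) :
    ‖invariants k₁ k₂ z‖ ≤ ‖z‖ ^ 2 := by
  have h1 := norm_fst_le z
  have h2 := norm_snd_le z
  have h0 := norm_nonneg z
  simp only [invariants, Prod.norm_def, max_le_iff] at *
  refine ⟨?_, ?_, ?_⟩
  · rw [Real.norm_of_nonneg (Complex.normSq_nonneg _), Complex.normSq_eq_norm_sq]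
    gcongr
  · rw [Real.norm_of_nonneg (Complex.normSq_nonneg _), Complex.normSq_eq_norm_sq]
    gcongr
  · rw [norm_mul, norm_pow, norm_pow, RCLike.norm_conj]
    calc ‖z.1‖ ^ k₂ * ‖z.2‖ ^ k₁ ≤ max ‖z.1‖ ‖z.2‖ ^ k₂ * max ‖z.1‖ ‖z.2‖ ^ k₁ := by gcongr
      _ = max ‖z.1‖ ‖z.2‖ ^ (k₂ + k₁) := (pow_add _ _ _).symm
      _ ≤ max ‖z.1‖ ‖z.2‖ ^ 2 := pow_le_pow_of_le_one h0 (max_le hz.1 hz.2) (by omega)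

/-- A second-order Taylor estimate. -/
theorem AnalyticAt.sub_fderiv_isBigO {V F : Type*} [NormedAddCommGroup V] [NormedSpace ℝ V]
    [NormedAddCommGroup F] [NormedSpace ℝ F] {f : V → F} (hf : AnalyticAt ℝ f 0) :
    (fun v => f v - f 0 - fderiv ℝ f 0 v) =O[𝓝 0] fun v => ‖v‖ ^ 2 := by
  obtain ⟨p, hp⟩ := hf
  refine (hp.isBigO_sub_partialSum_pow 2).congr_left fun v => ?_
  rw [hp.fderiv_eq, zero_add, FormalMultilinearSeries.partialSum, Finset.sum_range_succ,
    Finset.sum_range_one, hp.coeff_zero, sub_sub]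
  congr 2

namespace PeriodicEquation

variable {d : ℕ} {X Y : Type*} [NormedAddCommGroup X] [NormedSpace ℝ X] [PeriodicSpace X]
  [NormedAddCommGroup Y] [NormedSpace ℝ Y] [PeriodicSpace Y] {E : PeriodicEquation d X Y}
  {μ₀ μ : Param d} {K : Finset ℤ} {Φ : Param d × Y → X} {z : ℂ × ℂ} {k₁ k₂ : ℕ}

/-! ### Three scalar equations for the branch -/

section BranchEquations

variable [CompleteSpace X] [CompleteSpace Y]
  (R : IsReduction E μ₀ K Φ) (hK : K = {(k₁ : ℤ), -(k₁ : ℤ), (k₂ : ℤ), -(k₂ : ℤ)})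
  (hp₁ : 0 < k₁) (hp₂ : 0 < k₂) (hne : k₁ ≠ k₂) (hc : Nat.Coprime k₁ k₂)

include R hK hp₁ hp₂ hne hc

/-- The reduced problem consists of four real equations `A₁ = A₂ = B₁ = B₂ = 0`. The variational
identity reads `(k₁B₁ - k₂B₂) Im ζ = 0`, and since `Im ζ ≠ 0` on a dense set, continuity gives `k₁B₁
= k₂B₂`: one equation is redundant. -/
theorem exists_branch_equations (h3 : E.Variational) :
    ∃ A₁ A₂ B : Param d × (ℝ × ℝ × ℂ) → ℝ,
      AnalyticAt ℝ A₁ (μ₀, 0) ∧ AnalyticAt ℝ A₂ (μ₀, 0) ∧ AnalyticAt ℝ B (μ₀, 0) ∧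
      (∀ᶠ μ in 𝓝 μ₀, A₁ (μ, 0) = E.l μ k₁ / 2 ∧ A₂ (μ, 0) = E.l μ k₂ / 2 ∧
        B (μ, 0) = E.resonant μ₀ k₁ k₂ μ) ∧
      ∀ᶠ p in 𝓝 (μ₀, (0 : ℂ × ℂ)), A₁ (p.1, invariants k₁ k₂ p.2) = 0 →
        A₂ (p.1, invariants k₁ k₂ p.2) = 0 → B (p.1, invariants k₁ k₂ p.2) = 0 →
        E.F p.1 (reducedSol Φ k₁ k₂ p) = 0 := by
  have h₁ : (k₁ : ℤ) ∈ K := by simp [hK]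
  have h₂ : (k₂ : ℤ) ∈ K := by simp [hK]
  obtain ⟨A₁, B₁, hA₁, hB₁, hd₁, hv₁⟩ := R.exists_decomposition h₁ h₂ hp₁ hp₂ hne hc
  obtain ⟨A₂, B₂, hA₂, hB₂, hd₂, hv₂⟩ := R.exists_decomposition h₂ h₁ hp₂ hp₁ hne.symm hc.symm
  -- Exchanging the roles of the two modes exchanges the squared moduli and conjugates `ζ`.
  let τ : Param d × (ℝ × ℝ × ℂ) → Param d × (ℝ × ℝ × ℂ) := fun q =>
    (q.1, q.2.2.1, q.2.1, conj q.2.2.2)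
  have hτ : AnalyticAt ℝ τ (μ₀, 0) := analyticAt_fst.prod
    ((analyticAt_fst.fun_comp (analyticAt_snd.fun_comp analyticAt_snd)).prod
      ((analyticAt_fst.fun_comp analyticAt_snd).prod ((analyticAt_conj _).fun_comp
        (analyticAt_snd.fun_comp (analyticAt_snd.fun_comp analyticAt_snd)))))
  have hτ0 : ∀ μ : Param d, τ (μ, 0) = (μ, 0) := fun μ => by simp [τ, Prod.ext_iff]
  have hτi : ∀ p : Param d × (ℂ × ℂ), τ (p.1, invariants k₁ k₂ p.2) =
      (p.1, invariants k₂ k₁ p.2.swap) := fun p => by rw [invariants_swap]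
  refine ⟨A₁, fun q => A₂ (τ q), B₁, hA₁, AnalyticAt.fun_comp (by rwa [hτ0]) hτ, hB₁, ?_, ?_⟩
  · filter_upwards [hv₁, hv₂] with μ h h'
    rw [hτ0]
    exact ⟨h.1, h'.1, h.2⟩
  have hsw : Tendsto (fun p : Param d × (ℂ × ℂ) => (p.1, p.2.swap)) (𝓝 (μ₀, 0)) (𝓝 (μ₀, 0)) :=
    Continuous.tendsto' (by fun_prop) _ _ rfl
  have hd₂' : ∀ᶠ p in 𝓝 (μ₀, (0 : ℂ × ℂ)), reducedEq E Φ k₁ k₂ k₂ p =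
      A₂ (τ (p.1, invariants k₁ k₂ p.2)) * p.2.2 +
        B₂ (τ (p.1, invariants k₁ k₂ p.2)) * resonantMonomial k₂ k₁ p.2.swap := by
    filter_upwards [hsw.eventually hd₂] with p hp
    rw [← reducedEq_swap, Prod.swap_swap] at hp
    rw [hτi]
    exact hp
  obtain ⟨r, hr, hball⟩ := R.exists_admissible_ball k₁ k₂
  have hinv : Tendsto (fun p : Param d × (ℂ × ℂ) => (p.1, invariants k₁ k₂ p.2)) (𝓝 (μ₀, 0))
      (𝓝 (μ₀, 0)) :=
    Continuous.tendsto' (continuous_fst.prodMk ((continuous_invariants k₁ k₂).comp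
      continuous_snd)) _ _ (by simp [invariants_zero hp₂])
  have hmem : ∀ᶠ p in 𝓝 (μ₀, (0 : ℂ × ℂ)), ‖p.1 - μ₀‖ < r ∧ ‖p.2‖ < r := by
    filter_upwards [Metric.ball_mem_nhds _ hr] with p hp
    rw [mem_ball_iff_norm, Prod.norm_def] at hp
    simpa using hp
  -- the variational identity relates the two resonant parts
  have hmul : ∀ᶠ p in 𝓝 (μ₀, (0 : ℂ × ℂ)), (k₁ * B₁ (p.1, invariants k₁ k₂ p.2) -
      k₂ * B₂ (τ (p.1, invariants k₁ k₂ p.2))) * (invariants k₁ k₂ p.2).2.2.im = 0 := by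
    filter_upwards [hmem, hd₁, hd₂'] with p hp h h'
    have hv := variational_identity R hK hp₁ hp₂ hne h3 (hball p.1 hp.1) hp.2
    have e1 : (reducedEq E Φ k₁ k₂ k₁ p * conj p.2.1).im =
        -(B₁ (p.1, invariants k₁ k₂ p.2) * (invariants k₁ k₂ p.2).2.2.im) := by
      rw [h, mul_comm, mul_add, mul_left_comm, mul_left_comm _ (B₁ _ : ℂ),
        conj_mul_resonantMonomial hp₂, ← Complex.normSq_eq_conj_mul_self, Complex.add_im,
        Complex.im_ofReal_mul, Complex.im_ofReal_mul, Complex.ofReal_im, Complex.conj_im]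
      ring
    have e2 : (reducedEq E Φ k₁ k₂ k₂ p * conj p.2.2).im =
        B₂ (τ (p.1, invariants k₁ k₂ p.2)) * (invariants k₁ k₂ p.2).2.2.im := by
      have := conj_mul_resonantMonomial (k₁ := k₂) hp₁ p.2.swap
      rw [Prod.fst_swap, invariants_swap, Complex.conj_conj] at this
      rw [h', mul_comm, mul_add, mul_left_comm, mul_left_comm _ (B₂ _ : ℂ), this,
        ← Complex.normSq_eq_conj_mul_self, Complex.add_im,
        Complex.im_ofReal_mul, Complex.im_ofReal_mul, Complex.ofReal_im]
      ring
    rw [e1, e2] at hv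
    linear_combination -hv
  have hcont : ∀ᶠ p in 𝓝 (μ₀, (0 : ℂ × ℂ)), ContinuousAt (fun p : Param d × (ℂ × ℂ) =>
      k₁ * B₁ (p.1, invariants k₁ k₂ p.2) - k₂ * B₂ (τ (p.1, invariants k₁ k₂ p.2))) p := by
    have hB₂τ : AnalyticAt ℝ (fun q => B₂ (τ q)) (μ₀, 0) :=
      AnalyticAt.fun_comp (by rwa [hτ0]) hτ
    filter_upwards [hinv.eventually hB₁.eventually_analyticAt,
      hinv.eventually hB₂τ.eventually_analyticAt] with p h h'
    have hi : ContinuousAt (fun p : Param d × (ℂ × ℂ) => (p.1, invariants k₁ k₂ p.2)) p :=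
      (continuous_fst.prodMk ((continuous_invariants k₁ k₂).comp continuous_snd)).continuousAt
    exact (continuousAt_const.mul (ContinuousAt.comp (f := fun p : Param d × (ℂ × ℂ) =>
      (p.1, invariants k₁ k₂ p.2)) h.continuousAt hi)).sub
      (continuousAt_const.mul (ContinuousAt.comp (f := fun p : Param d × (ℂ × ℂ) =>
      (p.1, invariants k₁ k₂ p.2)) (g := fun q => B₂ (τ q)) h'.continuousAt hi))
  have hrel : ∀ᶠ p in 𝓝 (μ₀, (0 : ℂ × ℂ)), k₁ * B₁ (p.1, invariants k₁ k₂ p.2) -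
      k₂ * B₂ (τ (p.1, invariants k₁ k₂ p.2)) = 0 := by
    filter_upwards [hmul.eventually_nhds, hcont] with p hp hpc
    by_contra h0
    have hz : Tendsto (fun z : ℂ × ℂ => (p.1, z)) (𝓝 p.2) (𝓝 p) :=
      Continuous.tendsto' (by fun_prop) _ _ rfl
    refine frequently_im_invariants_ne_zero (k₁ := k₁) hp₂ p.2 ?_
    filter_upwards [hz.eventually hp, hz.eventually (hpc.eventually_ne h0)] with z h h'
    exact not_not.2 ((mul_eq_zero.1 h).resolve_left h')
  filter_upwards [hmem, hd₁, hd₂', hrel] with p hp h h' hr ha₁ ha₂ hb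
  have hk₂ : (k₂ : ℝ) ≠ 0 := by exact_mod_cast hp₂.ne'
  have hb₂ : B₂ (τ (p.1, invariants k₁ k₂ p.2)) = 0 := by
    rw [hb, mul_zero, zero_sub, neg_eq_zero] at hr
    exact (mul_eq_zero.1 hr).resolve_left hk₂
  rw [F_reducedSol R hK hp₁ hp₂ hne (hball p.1 hp.1 p.2 hp.2), h, h', ha₁, ha₂, hb, hb₂]
  simp only [Complex.ofReal_zero, zero_mul, add_zero, mul_zero]
  exact map_zero _

end BranchEquations

/-! ### Solving for three parameters -/

section Unfolding

/-- The embedding of the first three parameters. -/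
noncomputable def firstThree (hd : 3 ≤ d) : (Fin 3 → ℝ) →L[ℝ] Param d :=
  ∑ j, (ContinuousLinearMap.proj (R := ℝ) (φ := fun _ : Fin 3 => ℝ) j).smulRight
    (EuclideanSpace.single (Fin.castLE hd j) (1 : ℝ))

theorem firstThree_apply (hd : 3 ≤ d) (x : Fin 3 → ℝ) :
    firstThree hd x = ∑ j, x j • EuclideanSpace.single (Fin.castLE hd j) (1 : ℝ) := by
  simp [firstThree]

/-- Three equations with nonvanishing Jacobian are solved for the first three parameters. -/
theorem exists_unfolding {V : Type*} [NormedAddCommGroup V] [NormedSpace ℝ V] [CompleteSpace V]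
    (hd : 3 ≤ d) (A : Fin 3 → Param d × V → ℝ) (hA : ∀ i, AnalyticAt ℝ (A i) (μ₀, 0))
    (hA0 : ∀ i, A i (μ₀, 0) = 0)
    (hdet : Matrix.det (Matrix.of fun i j : Fin 3 =>
      fderiv ℝ (fun μ => A i (μ, 0)) μ₀ (EuclideanSpace.single (Fin.castLE hd j) 1)) ≠ 0) :
    ∃ Q : V → Param d, AnalyticAt ℝ Q 0 ∧ Q 0 = μ₀ ∧ ∀ᶠ σ in 𝓝 0, ∀ i, A i (Q σ, σ) = 0 := by
  -- The parameters beyond the third are frozen at their values in `μ₀`.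
  let m : V × (Fin 3 → ℝ) → Param d × V := fun q => (μ₀ + firstThree hd q.2, q.1)
  have hm : AnalyticAt ℝ m (0, 0) :=
    (analyticAt_const.add (((firstThree hd).analyticAt _).fun_comp analyticAt_snd)).prod
      analyticAt_fst
  have hm0 : m (0, 0) = (μ₀, 0) := by simp [m]
  let G : V × (Fin 3 → ℝ) → Fin 3 → ℝ := fun q i => A i (m q)
  have hG : AnalyticAt ℝ G (0, 0) := analyticAt_pi_iff.2 fun i =>
    AnalyticAt.fun_comp (by rw [hm0]; exact hA i) hm
  have hG0 : G (0, 0) = 0 := by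
    funext i
    simp only [G, hm0, hA0, Pi.zero_apply]
  have hder : ∀ x i, fderiv ℝ G (0, 0) (0, x) i =
      fderiv ℝ (fun μ => A i (μ, 0)) μ₀ (firstThree hd x) := by
    intro x i
    have hslice : DifferentiableAt ℝ (fun μ => A i (μ, 0)) μ₀ :=
      (AnalyticAt.fun_comp (f := fun μ : Param d => (μ, (0 : V))) (hA i)
        (analyticAt_id.prod analyticAt_const)).differentiableAt
    have e1 := (hG.differentiableAt.hasFDerivAt.comp (0 : Fin 3 → ℝ)
      ((hasFDerivAt_const (0 : V) (0 : Fin 3 → ℝ)).prodMk (hasFDerivAt_id (0 : Fin 3 → ℝ))))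
    have e2 : HasFDerivAt (fun x : Fin 3 → ℝ => A i (μ₀ + firstThree hd x, 0))
        ((fderiv ℝ (fun μ => A i (μ, 0)) μ₀).comp (firstThree hd)) 0 := by
      have h0 : HasFDerivAt (fun x : Fin 3 → ℝ => μ₀ + firstThree hd x) (firstThree hd) 0 :=
        (firstThree hd).hasFDerivAt.const_add μ₀
      refine HasFDerivAt.comp (g := fun μ => A i (μ, 0)) (0 : Fin 3 → ℝ) ?_ h0
      simpa using hslice.hasFDerivAt
    have e3 := (hasFDerivAt_pi'.1 e1 i).unique e2
    simpa using congrArg (fun T : (Fin 3 → ℝ) →L[ℝ] ℝ => T x) e3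
  have hinj : Function.Injective fun x => fderiv ℝ G (0, 0) (0, x) := by
    have hlin : (fun x => fderiv ℝ G (0, 0) (0, x)) =
        ((fderiv ℝ G (0, 0)).comp (.inr ℝ V (Fin 3 → ℝ))) := rfl
    rw [hlin, injective_iff_map_eq_zero]
    intro x hx
    refine Matrix.eq_zero_of_mulVec_eq_zero hdet ?_
    funext i
    have := congrFun hx i
    have h' := hder x i
    rw [firstThree_apply, map_sum] at h'
    simp only [map_smul, smul_eq_mul] at h'
    refine Eq.trans ?_ (h'.symm.trans this)
    rw [Matrix.mulVec, dotProduct]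
    exact Finset.sum_congr rfl fun j _ => by rw [Matrix.of_apply, mul_comm]
  have hbij : Function.Bijective fun x => fderiv ℝ G (0, 0) (0, x) :=
    ⟨hinj, (LinearMap.injective_iff_surjective
      (f := ((fderiv ℝ G (0, 0)).comp (.inr ℝ V (Fin 3 → ℝ))).toLinearMap)).1 hinj⟩
  obtain ⟨S, hS, hr, hl⟩ := hG.exists_implicit_solution hbij
  rw [hG0] at hS hr
  have hS0 : S (0, 0) = 0 := by
    have := hl.self_of_nhds
    simpa [hG0] using this
  have hpair : AnalyticAt ℝ (fun σ : V => (σ, (0 : Fin 3 → ℝ))) 0 :=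
    analyticAt_id.prod analyticAt_const
  refine ⟨fun σ => μ₀ + firstThree hd (S (σ, 0)), analyticAt_const.add
    (((firstThree hd).analyticAt _).fun_comp (AnalyticAt.fun_comp hS hpair)), by simp [hS0], ?_⟩
  filter_upwards [hpair.continuousAt.tendsto.eventually hr] with σ h i
  exact congrFun h i

end Unfolding

end PeriodicEquation

/-! ### The family of solutions over complex amplitudes -/

theorem analyticAt_invariants (k₁ k₂ : ℕ) (z : ℂ × ℂ) : AnalyticAt ℝ (invariants k₁ k₂) z := by
  have hsq : ∀ w : ℂ, AnalyticAt ℝ Complex.normSq w := fun w => by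
    have : AnalyticAt ℝ (fun w : ℂ => w.re * w.re + w.im * w.im) w :=
      ((Complex.reCLM.analyticAt w).mul (Complex.reCLM.analyticAt w)).add
        ((Complex.imCLM.analyticAt w).mul (Complex.imCLM.analyticAt w))
    exact this
  exact ((hsq _).fun_comp analyticAt_fst).prod (((hsq _).fun_comp analyticAt_snd).prod
    ((analyticAt_fst.pow k₂).mul (((PeriodicEquation.analyticAt_conj _).fun_comp
      analyticAt_snd).pow k₁)))

namespace PeriodicEquation

variable {d : ℕ} {X Y : Type*} [NormedAddCommGroup X] [NormedSpace ℝ X] [PeriodicSpace X]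
  [NormedAddCommGroup Y] [NormedSpace ℝ Y] [PeriodicSpace Y] {E : PeriodicEquation d X Y}
  {μ₀ μ : Param d} {K : Finset ℤ} {Φ : Param d × Y → X} {z : ℂ × ℂ} {k₁ k₂ : ℕ}

variable (R : IsReduction E μ₀ K Φ) (hK : K = {(k₁ : ℤ), -(k₁ : ℤ), (k₂ : ℤ), -(k₂ : ℤ)})
  (hp₁ : 0 < k₁) (hp₂ : 0 < k₂) (hne : k₁ ≠ k₂) (hc : Nat.Coprime k₁ k₂)

include R hK hp₁ hp₂ hne hc in
/-- The solution of the reduced problem is symmetric if and only if the phases are in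
resonance. -/
theorem isSymmetric_reducedSol_iff {r : ℝ}
    (hr : ∀ z : ℂ × ℂ, ‖z‖ < r → IsAdmissible E K Φ k₁ k₂ (μ, z)) (hz : ‖z‖ < r) :
    IsSymmetric (asFun (reducedSol Φ k₁ k₂ (μ, z))) ↔ (invariants k₁ k₂ z).2.2.im = 0 := by
  constructor
  · intro h
    obtain ⟨a, ha⟩ := (isSymmetric_iff _).1 h
    have e1 := ha k₁
    have e2 := ha k₂
    rw [coeff_reducedSol_fst R hK hp₁ hp₂ hne (hr z hz), ← mul_div_assoc, Complex.div_ofNat_im,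
      div_eq_zero_iff, or_iff_left two_ne_zero] at e1
    rw [coeff_reducedSol_snd R hK hp₁ hp₂ hne (hr z hz), ← mul_div_assoc, Complex.div_ofNat_im,
      div_eq_zero_iff, or_iff_left two_ne_zero] at e2
    rw [← im_invariants_rotate k₁ k₂ (a : Torus), ← Complex.conj_eq_iff_im]
    simp only [invariants, rotate, map_mul, map_pow, Complex.conj_conj]
    rw [← map_mul, ← map_mul, Complex.conj_eq_iff_im.2 e1, Complex.conj_eq_iff_im.2 e2]
  · intro h
    obtain ⟨a, ha₁, ha₂⟩ := exists_rotate_real hp₁ hp₂ hc h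
    exact isSymmetric_reducedSol_of_rotate R (by simp [hK]) (by simp [hK]) hr hz ha₁ ha₂

include R in
/-- The derivative of the augmented map at the trivial solution. -/
theorem IsReduction.fderiv_augmented (a : Param d) (x : X) :
    fderiv ℝ (augmented E K) (μ₀, 0) (a, x) = augmentedL E K μ₀ x := by
  have han := (augmented_analyticAt (K := K) R.analytic R.mem).differentiableAt.hasFDerivAt
  have e1 := han.comp (0 : X)
    ((hasFDerivAt_const μ₀ (0 : X)).prodMk (hasFDerivAt_id (0 : X)))
  have hx := congrArg (fun T : X →L[ℝ] Y => T x)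
    (e1.unique (hasFDerivAt_augmented R.series R.analytic R.mem))
  have e2 := han.comp (f := fun μ : Param d => (μ, (0 : X))) μ₀ ((hasFDerivAt_id μ₀).prodMk (hasFDerivAt_const (0 : X) μ₀))
  have e3 : HasFDerivAt (fun μ : Param d => augmented E K (μ, 0)) (0 : Param d →L[ℝ] Y) μ₀ :=
    (hasFDerivAt_const (0 : Y) μ₀).congr_of_eventuallyEq (by
      filter_upwards [R.isOpen.mem_nhds R.mem] with μ hμ using augmented_zero R.series hμ)
  have ha := congrArg (fun T : Param d →L[ℝ] Y => T a) (e2.unique e3)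
  simp only [ContinuousLinearMap.comp_apply, ContinuousLinearMap.prod_apply,
    zero_apply, ContinuousLinearMap.id_apply] at hx ha
  have : ((a, x) : Param d × X) = (a, 0) + (0, x) := by simp
  rw [this, map_add, ha, hx, zero_add]

include R hK hp₁ hp₂ hne hc in
-- The family is first built over the complex amplitudes `z`, where it is analytic also at `z = 0`.
-- The parameter depends on `z` through the invariants alone, and the amplitudes are recovered as
-- twice the Fourier coefficients.
theorem exists_solution_family [CompleteSpace X] [CompleteSpace Y] (h3 : E.Variational)
    (hd : 3 ≤ d) (hres : E.resonant μ₀ k₁ k₂ μ₀ = 0) (hjac : E.jacobian hd μ₀ k₁ k₂ ≠ 0) :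
    ∃ ε > 0, ∃ (W : ℂ × ℂ → X) (Q : ℂ × ℂ → Param d),
      (∀ z, ‖z‖ < ε → AnalyticAt ℝ W z ∧ AnalyticAt ℝ Q z) ∧
      (∀ z, ‖z‖ < ε → Q z ∈ E.M ∧ E.F (Q z) (W z) = 0 ∧
        (IsSymmetric (asFun (W z)) ↔ (invariants k₁ k₂ z).2.2.im = 0)) ∧
      (∀ z, ‖z‖ < ε → coeff (W z) k₁ = z.1 / 2 ∧ coeff (W z) k₂ = z.2 / 2) ∧
      ∃ C, ∀ z, ‖z‖ < ε → ‖W z - modeSum X k₁ k₂ z‖ ≤ C * ‖z‖ ^ 2 ∧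
        ‖Q z - μ₀‖ ≤ C * ‖z‖ ^ 2 := by
  have h₁ : (k₁ : ℤ) ∈ K := by simp [hK]
  have h₂ : (k₂ : ℤ) ∈ K := by simp [hK]
  obtain ⟨A₁, A₂, B, hA₁, hA₂, hB, hval, hsol⟩ :=
    exists_branch_equations R hK hp₁ hp₂ hne hc h3
  obtain ⟨S, hS, hS0, hSA⟩ := exists_unfolding hd ![A₁, A₂, B]
    (by rw [Fin.forall_fin_succ, Fin.forall_fin_two]; exact ⟨hA₁, hA₂, hB⟩)
    (by
      have := hval.self_of_nhds
      rw [(R.mem_iff.1 h₁).2, (R.mem_iff.1 h₂).2, hres, zero_div] at this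
      rw [Fin.forall_fin_succ, Fin.forall_fin_two]; exact this) (by
    intro h0
    refine hjac ?_
    have hslice : ∀ {A : Param d × (ℝ × ℝ × ℂ) → ℝ}, AnalyticAt ℝ A (μ₀, 0) →
        DifferentiableAt ℝ (fun μ => A (μ, 0)) μ₀ := fun hA =>
      (AnalyticAt.fun_comp (f := fun μ : Param d => (μ, (0 : ℝ × ℝ × ℂ))) hA
        (analyticAt_id.prod analyticAt_const)).differentiableAt
    -- The coefficients at zero amplitude are half the symbols, so the two Jacobians differ by the
    -- row factors `2, 2, 1`.
    have hscale : ∀ i : Fin 3, ∀ v : Param d, fderiv ℝ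
        ((![fun μ => E.l μ k₁, fun μ => E.l μ k₂, E.resonant μ₀ k₁ k₂] :
          Fin 3 → Param d → ℝ) i) μ₀ v = (![2, 2, 1] : Fin 3 → ℝ) i *
            fderiv ℝ (fun μ => (![A₁, A₂, B] : Fin 3 → Param d × (ℝ × ℝ × ℂ) → ℝ) i (μ, 0))
              μ₀ v := by
      have hgen : ∀ (c : ℝ) (f : Param d → ℝ) (A : Param d × (ℝ × ℝ × ℂ) → ℝ),
          AnalyticAt ℝ A (μ₀, 0) → (∀ᶠ μ in 𝓝 μ₀, f μ = c * A (μ, 0)) → ∀ v,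
          fderiv ℝ f μ₀ v = c * fderiv ℝ (fun μ => A (μ, 0)) μ₀ v := fun c f A hA h v => by
        rw [EventuallyEq.fderiv_eq h, fderiv_const_mul (hslice hA)]
        rfl
      rw [Fin.forall_fin_succ, Fin.forall_fin_two]
      refine ⟨hgen _ _ _ hA₁ ?_, hgen _ _ _ hA₂ ?_, hgen _ _ _ hB ?_⟩
      · filter_upwards [hval] with μ h
        change E.l μ k₁ = 2 * A₁ (μ, 0)
        linarith [h.1]
      · filter_upwards [hval] with μ h
        change E.l μ k₂ = 2 * A₂ (μ, 0)
        linarith [h.2.1]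
      · filter_upwards [hval] with μ h
        change E.resonant μ₀ k₁ k₂ μ = 1 * B (μ, 0)
        linarith [h.2.2]
    rw [jacobian]
    simp only [hscale]
    rw [Matrix.det_mul_column (![2, 2, 1] : Fin 3 → ℝ) (fun i j =>
      fderiv ℝ (fun μ => (![A₁, A₂, B] : Fin 3 → Param d × (ℝ × ℝ × ℂ) → ℝ) i (μ, 0)) μ₀
        (EuclideanSpace.single (Fin.castLE hd j) 1))]
    exact mul_eq_zero_of_right _ h0)
  obtain ⟨r, hr, hball⟩ := R.exists_admissible_ball k₁ k₂
  set Q : ℂ × ℂ → Param d := fun z => S (invariants k₁ k₂ z) with hQdef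
  set W : ℂ × ℂ → X := fun z => reducedSol Φ k₁ k₂ (Q z, z) with hWdef
  have hinv0 : invariants k₁ k₂ 0 = 0 := invariants_zero hp₂
  have hinv : Tendsto (invariants k₁ k₂) (𝓝 0) (𝓝 0) := by
    have := (continuous_invariants k₁ k₂).tendsto 0
    rwa [hinv0] at this
  have hQ : AnalyticAt ℝ Q 0 :=
    AnalyticAt.fun_comp (by rwa [hinv0]) (analyticAt_invariants k₁ k₂ 0)
  have hQ0 : Q 0 = μ₀ := by rw [hQdef]; simp only [hinv0, hS0]
  have hadm0 := hball μ₀ (by simpa using hr) 0 (by simpa using hr)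
  have hW : AnalyticAt ℝ W 0 := AnalyticAt.fun_comp (f := fun z => (Q z, z))
    (by rw [hQ0]; exact hadm0.analyticAt_sol) (hQ.prod analyticAt_id)
  have hpair : Tendsto (fun z => (Q z, z)) (𝓝 0) (𝓝 (μ₀, 0)) := by
    have := hQ.continuousAt.tendsto.prodMk_nhds (tendsto_id (x := 𝓝 (0 : ℂ × ℂ)))
    rwa [hQ0] at this
  have hW0 : W 0 = 0 := by
    simp only [hWdef, hQ0, reducedSol, map_zero]
    exact hadm0.regular.apply_zero R
  have hsmall : ∀ᶠ z in 𝓝 (0 : ℂ × ℂ), ‖Q z - μ₀‖ < r ∧ ‖z‖ < r := by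
    filter_upwards [hpair.eventually (Metric.ball_mem_nhds _ hr)] with z hz
    rw [dist_eq_norm, Prod.norm_def] at hz
    simpa using hz
  have hzero : ∀ᶠ z in 𝓝 (0 : ℂ × ℂ), E.F (Q z) (W z) = 0 := by
    filter_upwards [hpair.eventually hsol, hinv.eventually hSA] with z h h'
    exact h (h' 0) (h' 1) (h' 2)
  -- the linear part of the family
  have hder : fderiv ℝ W 0 = modeSum X k₁ k₂ := by
    have haug : HasFDerivAt (augmented E K) (fderiv ℝ (augmented E K) (μ₀, 0)) (Q 0, W 0) := by
      rw [hQ0, hW0]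
      exact (augmented_analyticAt (K := K) R.analytic R.mem).differentiableAt.hasFDerivAt
    -- The relation `augmented (Q z, W z) = modeSum z` is differentiated at `0`. The derivative of
    -- `Q` drops out because `augmented` vanishes on the trivial branch, and injectivity of the
    -- linearization identifies that of `W`.
    have e1 := haug.comp (0 : ℂ × ℂ)
      (hQ.differentiableAt.hasFDerivAt.prodMk hW.differentiableAt.hasFDerivAt)
    have e2 : HasFDerivAt (fun z => augmented E K (Q z, W z)) (modeSum Y k₁ k₂) 0 :=
      (modeSum Y k₁ k₂).hasFDerivAt.congr_of_eventuallyEq (by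
        filter_upwards [hsmall] with z hz using (hball _ hz.1 _ hz.2).augmented_eq)
    refine ContinuousLinearMap.ext fun v => ?_
    have e3 := congrArg (fun T : ℂ × ℂ →L[ℝ] Y => T v) (e1.unique e2)
    simp only [ContinuousLinearMap.comp_apply, ContinuousLinearMap.prod_apply,
      R.fderiv_augmented] at e3
    refine (bijective_augmentedL R.modes_eq R.fredholm R.mem R.kernel).1 (e3.trans ?_)
    refine eq_of_coeff_eq fun k => ?_
    rw [coeff_augmentedL R.fredholm (fun _ => R.mem_modes_right) (fun _ => R.neg_mem) R.mem]
    have hXY : coeff (modeSum X (k₁ : ℤ) k₂ v) k = coeff (modeSum Y (k₁ : ℤ) k₂ v) k := by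
      rw [coeff_modeSum (R.mem_modes h₁) (R.mem_modes h₂),
        coeff_modeSum (R.mem_modes_right h₁) (R.mem_modes_right h₂)]
    rw [hXY]
    split_ifs with hk
    · rfl
    · rw [hadm0.regular.coeff_modeSum_of_notMem R h₁ h₂ hk, mul_zero]
  have hOW := hW.sub_fderiv_isBigO
  rw [hder] at hOW
  -- The parameter is a differentiable function of the invariants, which are themselves
  -- quadratically small.
  have hOQ : (fun z => Q z - μ₀) =O[𝓝 0] fun z : ℂ × ℂ => ‖z‖ ^ 2 := by
    have h := (hS.differentiableAt.hasFDerivAt.isBigO_sub).comp_tendsto hinv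
    have h' : (fun z => invariants k₁ k₂ z - 0) =O[𝓝 0] fun z : ℂ × ℂ => ‖z‖ ^ 2 :=
      Asymptotics.IsBigO.of_bound 1 (by
        filter_upwards [Metric.ball_mem_nhds (0 : ℂ × ℂ) one_pos] with z hz
        rw [sub_zero, one_mul, norm_pow, norm_norm]
        exact norm_invariants_le hp₁ hp₂ (mem_ball_zero_iff.1 hz).le)
    refine (h.trans h').congr_left fun z => ?_
    simp only [Function.comp_apply, hS0, hQdef]
  obtain ⟨C₁, hC₁⟩ := hOW.bound
  obtain ⟨C₂, hC₂⟩ := hOQ.bound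
  obtain ⟨ε, hε, hεball⟩ := Metric.eventually_nhds_iff_ball.1 (hsmall.and (hzero.and
    (hC₁.and (hC₂.and (hQ.eventually_analyticAt.and hW.eventually_analyticAt)))))
  simp only [mem_ball_zero_iff] at hεball
  refine ⟨ε, hε, W, Q, fun z hz => ?_, fun z hz => ?_, fun z hz => ?_, max C₁ C₂, fun z hz => ?_⟩
  · exact (hεball z hz).2.2.2.2.symm
  · obtain ⟨⟨hz1, hz2⟩, hF, -⟩ := hεball z hz
    exact ⟨(hball _ hz1 _ hz2).regular.mem, hF,
      isSymmetric_reducedSol_iff R hK hp₁ hp₂ hne hc (hball _ hz1) hz2⟩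
  · obtain ⟨⟨hz1, hz2⟩, -⟩ := hεball z hz
    exact ⟨coeff_reducedSol_fst R hK hp₁ hp₂ hne (hball _ hz1 _ hz2),
      coeff_reducedSol_snd R hK hp₁ hp₂ hne (hball _ hz1 _ hz2)⟩
  · obtain ⟨-, -, h1, h2, -⟩ := hεball z hz
    rw [hW0, sub_zero, norm_pow, norm_norm] at h1
    rw [norm_pow, norm_norm] at h2
    exact ⟨h1.trans (by gcongr; exact le_max_left _ _), h2.trans (by gcongr; exact le_max_right _ _)⟩

end PeriodicEquation

/-! ### Polar coordinates -/

section Polar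

variable {k k₁ k₂ : ℕ}

/-- The complex number `r e^{ikθ}`. -/
noncomputable def polarMode (k : ℕ) (r θ : ℝ) : ℂ := r * Complex.exp (((k * θ : ℝ) : ℂ) * Complex.I)

/-- The complex amplitudes `(r₁ e^{ik₁θ₁}, r₂ e^{ik₂θ₂})`. -/
noncomputable def polarModes (k₁ k₂ : ℕ) (p : (ℝ × ℝ) × (ℝ × ℝ)) : ℂ × ℂ :=
  (polarMode k₁ p.1.1 p.2.1, polarMode k₂ p.1.2 p.2.2)

theorem norm_polarMode (k : ℕ) (r θ : ℝ) : ‖polarMode k r θ‖ = |r| := by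
  rw [polarMode, norm_mul, Complex.norm_exp_ofReal_mul_I, mul_one, Complex.norm_real,
    Real.norm_eq_abs]

theorem norm_polarModes (k₁ k₂ : ℕ) (p : (ℝ × ℝ) × (ℝ × ℝ)) : ‖polarModes k₁ k₂ p‖ = ‖p.1‖ := by
  rw [Prod.norm_def, Prod.norm_def, polarModes, norm_polarMode, norm_polarMode]
  rfl

theorem analyticAt_polarModes (k₁ k₂ : ℕ) (p : (ℝ × ℝ) × (ℝ × ℝ)) :
    AnalyticAt ℝ (polarModes k₁ k₂) p := by
  have hexp : ∀ w : ℂ, AnalyticAt ℝ Complex.exp w := fun w =>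
    analyticAt_cexp.restrictScalars
  have hof : ∀ t : ℝ, AnalyticAt ℝ (fun t : ℝ => (t : ℂ)) t := fun t =>
    Complex.ofRealCLM.analyticAt t
  have h11 : AnalyticAt ℝ (fun p : (ℝ × ℝ) × (ℝ × ℝ) => p.1.1) p :=
    analyticAt_fst.fun_comp analyticAt_fst
  have h12 : AnalyticAt ℝ (fun p : (ℝ × ℝ) × (ℝ × ℝ) => p.1.2) p :=
    analyticAt_snd.fun_comp analyticAt_fst
  have h21 : AnalyticAt ℝ (fun p : (ℝ × ℝ) × (ℝ × ℝ) => p.2.1) p :=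
    analyticAt_fst.fun_comp analyticAt_snd
  have h22 : AnalyticAt ℝ (fun p : (ℝ × ℝ) × (ℝ × ℝ) => p.2.2) p :=
    analyticAt_snd.fun_comp analyticAt_snd
  exact (((hof _).fun_comp h11).mul ((hexp _).fun_comp
      (((hof _).fun_comp (analyticAt_const.mul h21)).mul analyticAt_const))).prod
    (((hof _).fun_comp h12).mul ((hexp _).fun_comp
      (((hof _).fun_comp (analyticAt_const.mul h22)).mul analyticAt_const)))

/-- In polar coordinates `ζ = r₁^{k₂} r₂^{k₁} e^{ik₁k₂(θ₁-θ₂)}`. -/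
theorem im_invariants_polarModes_eq_zero_iff (hp₁ : 0 < k₁) (hp₂ : 0 < k₂)
    (p : (ℝ × ℝ) × (ℝ × ℝ)) : (invariants k₁ k₂ (polarModes k₁ k₂ p)).2.2.im = 0 ↔
      p.1.1 = 0 ∨ p.1.2 = 0 ∨ ∃ j : ℤ, (p.2.1 - p.2.2) * (k₁ * k₂) = j * Real.pi := by
  have h : (invariants k₁ k₂ (polarModes k₁ k₂ p)).2.2 = ((p.1.1 ^ k₂ * p.1.2 ^ k₁ : ℝ) : ℂ) *
      Complex.exp ((((p.2.1 - p.2.2) * (k₁ * k₂) : ℝ) : ℂ) * Complex.I) := by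
    simp only [invariants, polarModes, polarMode]
    rw [map_mul, Complex.conj_ofReal, ← Complex.exp_conj, map_mul, Complex.conj_ofReal,
      Complex.conj_I, mul_pow, mul_pow, ← Complex.exp_nat_mul, ← Complex.exp_nat_mul,
      mul_mul_mul_comm, ← Complex.exp_add]
    push_cast
    congr 2
    ring
  rw [h, Complex.im_ofReal_mul, Complex.exp_ofReal_mul_I_im, mul_eq_zero, mul_eq_zero,
    pow_eq_zero_iff hp₂.ne', pow_eq_zero_iff hp₁.ne', Real.sin_eq_zero_iff, or_assoc]
  simp only [eq_comm]

theorem polarMode_eq_iff {r r' θ θ' : ℝ} (hr : 0 < r) (hr' : 0 < r') :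
    polarMode k r θ = polarMode k r' θ' ↔
      r = r' ∧ ∃ a : ℤ, (θ - θ') * k = a * (2 * Real.pi) := by
  have key : Complex.exp (((k * θ : ℝ) : ℂ) * Complex.I) =
      Complex.exp (((k * θ' : ℝ) : ℂ) * Complex.I) ↔
      ∃ a : ℤ, (θ - θ') * k = a * (2 * Real.pi) := by
    rw [Complex.exp_eq_exp_iff_exists_int]
    refine exists_congr fun a => ?_
    have e : ((k * θ : ℝ) : ℂ) * Complex.I =
        ((k * θ' : ℝ) : ℂ) * Complex.I + a * (2 * Real.pi * Complex.I) ↔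
        ((k * θ : ℝ) : ℂ) * Complex.I = ((k * θ' + a * (2 * Real.pi) : ℝ) : ℂ) * Complex.I := by
      push_cast
      ring_nf
    rw [e, mul_left_inj' Complex.I_ne_zero, Complex.ofReal_inj]
    constructor <;> intro h <;> linarith
  constructor
  · intro h
    have hrr : r = r' := by
      have := congrArg norm h
      rwa [norm_polarMode, norm_polarMode, abs_of_pos hr, abs_of_pos hr'] at this
    refine ⟨hrr, key.1 ?_⟩
    rw [polarMode, polarMode, ← hrr] at h
    exact mul_left_cancel₀ (by exact_mod_cast hr.ne') h
  · rintro ⟨rfl, h⟩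
    rw [polarMode, polarMode, key.2 h]

theorem hasDerivAt_polarMode (k : ℕ) (r θ a b : ℝ) :
    HasDerivAt (fun t : ℝ => polarMode k (r + t * a) (θ + t * b))
      ((a + ((r * (k * b) : ℝ) : ℂ) * Complex.I) *
        Complex.exp (((k * θ : ℝ) : ℂ) * Complex.I)) 0 := by
  have h1 : HasDerivAt (fun t : ℝ => ((r + t * a : ℝ) : ℂ)) (a : ℂ) 0 := by
    have : HasDerivAt (fun t : ℝ => r + t * a) a 0 := by
      simpa using ((hasDerivAt_id (0 : ℝ)).mul_const a).const_add r
    exact this.ofReal_comp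
  have h2 : HasDerivAt (fun t : ℝ => ((k * (θ + t * b) : ℝ) : ℂ)) ((k * b : ℝ) : ℂ) 0 := by
    have : HasDerivAt (fun t : ℝ => k * (θ + t * b)) (k * b) 0 := by
      simpa using (((hasDerivAt_id (0 : ℝ)).mul_const b).const_add θ).const_mul (k : ℝ)
    exact this.ofReal_comp
  refine (h1.mul (h2.mul_const Complex.I).cexp).congr_deriv ?_
  simp only [zero_mul, add_zero]
  push_cast
  ring

theorem eq_zero_of_polarMode_deriv {r θ a b : ℝ} (hk : 0 < k) (hr : r ≠ 0)
    (h : (a + ((r * (k * b) : ℝ) : ℂ) * Complex.I) *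
        Complex.exp (((k * θ : ℝ) : ℂ) * Complex.I) = 0) : a = 0 ∧ b = 0 := by
  have h' := (mul_eq_zero.1 h).resolve_right (Complex.exp_ne_zero _)
  have hre := congrArg Complex.re h'
  have him := congrArg Complex.im h'
  simp only [Complex.add_re, Complex.add_im, Complex.ofReal_re, Complex.ofReal_im,
    Complex.re_ofReal_mul, Complex.im_ofReal_mul, Complex.I_re, Complex.I_im, Complex.zero_re,
    Complex.zero_im, mul_zero, mul_one, add_zero, zero_add] at hre him
  have hk' : (k : ℝ) ≠ 0 := by exact_mod_cast hk.ne'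
  simpa [hre, hr, hk'] using him

variable {X : Type*} [NormedAddCommGroup X] [NormedSpace ℝ X] [PeriodicSpace X]

theorem represents_modeSum_polarModes (h₁ : (k₁ : ℤ) ∈ modes X) (h₂ : (k₂ : ℤ) ∈ modes X)
    (p : (ℝ × ℝ) × (ℝ × ℝ)) :
    Represents (PeriodicEquation.modeSum X k₁ k₂ (polarModes k₁ k₂ p)) (twoModes k₁ k₂ p) := by
  have hmode : ∀ (k : ℕ) (r θ : ℝ) (x : Torus), (polarMode k r θ * fourier (k : ℤ) x).re =
      r * cosMode k (x + (θ : Torus)) := fun k r θ x => by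
    rw [cosMode, fourier_apply, fourier_apply, smul_add, AddCircle.toCircle_add, Circle.coe_mul,
      ← fourier_apply (n := (k : ℤ)) (x := (θ : Torus)), fourier_torus_coe, polarMode, mul_assoc,
      Complex.re_ofReal_mul, mul_comm (Complex.exp _)]
    norm_cast
  rw [PeriodicEquation.modeSum_apply]
  filter_upwards [asFun_add (realMode (polarModes k₁ k₂ p).1 k₁ : X)
    (realMode (polarModes k₁ k₂ p).2 k₂),
    PeriodicEquation.represents_realMode h₁ (polarModes k₁ k₂ p).1,
    PeriodicEquation.represents_realMode h₂ (polarModes k₁ k₂ p).2] with x h h' h''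
  rw [h, h', h'', twoModes, polarModes, hmode, hmode]

/-- A family of functions with prescribed modes is an immersion in polar coordinates. -/
theorem injective_fderiv_polarModes {F : Type*} [NormedAddCommGroup F] [NormedSpace ℝ F]
    (hp₁ : 0 < k₁) (hp₂ : 0 < k₂) {G : (ℝ × ℝ) × (ℝ × ℝ) → X × F} {p : (ℝ × ℝ) × (ℝ × ℝ)}
    (hG : DifferentiableAt ℝ G p) (hr₁ : p.1.1 ≠ 0) (hr₂ : p.1.2 ≠ 0)
    (hcoeff : ∀ᶠ q in 𝓝 p, coeff (G q).1 k₁ = (polarModes k₁ k₂ q).1 / 2 ∧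
      coeff (G q).1 k₂ = (polarModes k₁ k₂ q).2 / 2) :
    Function.Injective (fderiv ℝ G p) := by
  rw [injective_iff_map_eq_zero]
  intro v hv
  have hline : HasDerivAt (fun t : ℝ => p + t • v) v 0 := by
    simpa using ((hasDerivAt_id (0 : ℝ)).smul_const v).const_add p
  have hGl : HasDerivAt (fun t : ℝ => G (p + t • v)) 0 0 := by
    have : HasFDerivAt G (fderiv ℝ G p) (p + (0 : ℝ) • v) := by simpa using hG.hasFDerivAt
    have h := this.comp_hasDerivAt (0 : ℝ) hline
    rwa [hv] at h
  -- A direction annihilated by the derivative does not change the Fourier coefficients to first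
  -- order, hence not the polar amplitudes, which are nondegenerate for `r₁ r₂ ≠ 0`.
  have hco : ∀ k : ℤ, HasDerivAt (fun t : ℝ => coeff (G (p + t • v)).1 k) 0 0 := fun k => by
    have h := ((coeffL k : X →L[ℝ] ℂ).comp (.fst ℝ X F)).hasFDerivAt.comp_hasDerivAt (0 : ℝ) hGl
    rw [map_zero] at h
    exact h
  have ht : Tendsto (fun t : ℝ => p + t • v) (𝓝 0) (𝓝 p) := by
    simpa [ContinuousAt] using hline.continuousAt
  have hev := ht.eventually hcoeff
  have e1 := (hasDerivAt_polarMode k₁ p.1.1 p.2.1 v.1.1 v.2.1).div_const 2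
  have e2 := (hasDerivAt_polarMode k₂ p.1.2 p.2.2 v.1.2 v.2.2).div_const 2
  have u1 := (e1.congr_of_eventuallyEq (hev.mono fun t h => h.1)).unique (hco k₁)
  have u2 := (e2.congr_of_eventuallyEq (hev.mono fun t h => h.2)).unique (hco k₂)
  rw [div_eq_zero_iff, or_iff_left two_ne_zero] at u1 u2
  obtain ⟨a1, b1⟩ := eq_zero_of_polarMode_deriv hp₁ hr₁ u1
  obtain ⟨a2, b2⟩ := eq_zero_of_polarMode_deriv hp₂ hr₂ u2
  exact Prod.ext (Prod.ext a1 a2) (Prod.ext b1 b2)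

end Polar

/-! ### The main theorem -/

theorem mainTheorem1 {d : ℕ} {X Y : Type*}
    [NormedAddCommGroup X] [NormedSpace ℝ X] [CompleteSpace X] [PeriodicSpace X]
    [NormedAddCommGroup Y] [NormedSpace ℝ Y] [CompleteSpace Y] [PeriodicSpace Y]
    (hmodes : modes X = modes Y)
    (E : PeriodicEquation d X Y) (hM : IsOpen E.M)
    (h1 : E.FredholmMultiplier) (h2 : E.MultilinearFourierSeries)
    (h3 : E.Variational) (h4 : E.Analytic)
    (μ₀ : Param d) (hμ₀ : μ₀ ∈ E.M) :
    -- (a) necessary conditions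
    (((E.kernelSet μ₀).encard = 0 ∨ (E.kernelSet μ₀).encard = 2 ∨
        ∃ k₁ k₂ : ℕ, 0 < k₁ ∧ 0 < k₂ ∧ k₁ ≠ k₂ ∧ Nat.Coprime k₁ k₂ ∧
          E.kernelSet μ₀ = {(k₁ : ℤ), -(k₁ : ℤ), (k₂ : ℤ), -(k₂ : ℤ)} ∧
          E.resonant μ₀ k₁ k₂ μ₀ ≠ 0) →
      E.NoSmallAsymmetricSolutions μ₀) ∧
    -- (b) sufficient conditions
    (∀ (hd : 3 ≤ d) (k₁ k₂ : ℕ), 0 < k₁ → 0 < k₂ → k₁ ≠ k₂ → Nat.Coprime k₁ k₂ →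
      E.kernelSet μ₀ = {(k₁ : ℤ), -(k₁ : ℤ), (k₂ : ℤ), -(k₂ : ℤ)} →
      E.resonant μ₀ k₁ k₂ μ₀ = 0 →
      E.jacobian hd μ₀ k₁ k₂ ≠ 0 →
      ∃ ε > 0, ∃ (U : (ℝ × ℝ) × (ℝ × ℝ) → X) (P : (ℝ × ℝ) × (ℝ × ℝ) → Param d),
        -- the parametrization `(r, θ) ↦ (u, μ)` is analytic
        AnalyticOnNhd ℝ (fun p => (U p, P p)) {p | ‖p.1‖ < ε} ∧
        -- its values are solutions, and it is known which of them are asymmetric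
        (∀ p, ‖p.1‖ < ε → P p ∈ E.M ∧ E.F (P p) (U p) = 0 ∧
          (IsAsymmetric (asFun (U p)) ↔
            p.1.1 ≠ 0 ∧ p.1.2 ≠ 0 ∧
              ¬ ∃ j : ℤ, (p.2.1 - p.2.2) * (k₁ * k₂) = j * Real.pi)) ∧
        -- asymptotics as `r → 0`, uniformly in `θ`
        (∃ C : ℝ, ∀ p, ‖p.1‖ < ε →
          (∃ v : X, Represents v (twoModes k₁ k₂ p) ∧ ‖U p - v‖ ≤ C * ‖p.1‖ ^ 2) ∧
            ‖P p - μ₀‖ ≤ C * ‖p.1‖ ^ 2) ∧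
        -- it is an immersion where `r₁ r₂ ≠ 0`, and for `r₁, r₂ > 0` it is injective up to the
        -- periods of `θ₁` and `θ₂`
        (∀ p, ‖p.1‖ < ε → p.1.1 ≠ 0 → p.1.2 ≠ 0 →
          Function.Injective (fderiv ℝ (fun p => (U p, P p)) p)) ∧
        (∀ p p', ‖p.1‖ < ε → ‖p'.1‖ < ε → 0 < p.1.1 → 0 < p.1.2 → 0 < p'.1.1 → 0 < p'.1.2 →
          ((U p, P p) = (U p', P p') ↔
            p.1 = p'.1 ∧ (∃ a : ℤ, (p.2.1 - p'.2.1) * k₁ = a * (2 * Real.pi)) ∧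
              ∃ b : ℤ, (p.2.2 - p'.2.2) * k₂ = b * (2 * Real.pi)))) := by
  refine ⟨?_, ?_⟩
  · rintro (h | h | ⟨k₁, k₂, hp₁, hp₂, hne, hc, hK, hres⟩)
    · exact PeriodicEquation.noSmallAsymmetricSolutions_of_kernelSet_eq_empty hmodes hM h1 h2 h4
        hμ₀ (Set.encard_eq_zero.1 h)
    · exact PeriodicEquation.noSmallAsymmetricSolutions_of_encard_eq_two hmodes hM h1 h2 h4 hμ₀ h
    · exact PeriodicEquation.noSmallAsymmetricSolutions_of_resonant_ne_zero hmodes hM h1 h2 h4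
        hμ₀ hp₁ hp₂ hne hc hK hres
  intro hd k₁ k₂ hp₁ hp₂ hne hc hK hres hjac
  obtain ⟨Φ, R⟩ := PeriodicEquation.exists_isReduction
    (K := {(k₁ : ℤ), -(k₁ : ℤ), (k₂ : ℤ), -(k₂ : ℤ)}) hmodes hM h1 h2 h4 hμ₀ (by simp [hK])
  obtain ⟨ε, hε, W, Q, han, hsol, hcoeff, C, hC⟩ := PeriodicEquation.exists_solution_family R rfl
    hp₁ hp₂ hne hc h3 hd hres hjac
  -- The norm of the amplitudes depends on `r` only, which makes the domain and the estimates
  -- uniform in `θ`.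
  have hnorm : ∀ {p : (ℝ × ℝ) × (ℝ × ℝ)}, ‖p.1‖ < ε → ‖polarModes k₁ k₂ p‖ < ε := fun hp => by
    rwa [norm_polarModes]
  have hfam : AnalyticOnNhd ℝ (fun p => (W (polarModes k₁ k₂ p), Q (polarModes k₁ k₂ p)))
      {p : (ℝ × ℝ) × (ℝ × ℝ) | ‖p.1‖ < ε} := fun p hp =>
    ((han _ (hnorm hp)).1.fun_comp (analyticAt_polarModes k₁ k₂ p)).prod
      ((han _ (hnorm hp)).2.fun_comp (analyticAt_polarModes k₁ k₂ p))
  refine ⟨ε, hε, fun p => W (polarModes k₁ k₂ p), fun p => Q (polarModes k₁ k₂ p), hfam,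
    fun p hp => ?_, ⟨C, fun p hp => ?_⟩, fun p hp hr₁ hr₂ => ?_, fun p p' hp hp' h₁ h₂ h₁' h₂' => ?_⟩
  · obtain ⟨hmem, hF, hsym⟩ := hsol _ (hnorm hp)
    refine ⟨hmem, hF, ?_⟩
    rw [IsAsymmetric, hsym, im_invariants_polarModes_eq_zero_iff hp₁ hp₂, not_or, not_or]
  · have h := hC _ (hnorm hp)
    rw [norm_polarModes] at h
    exact ⟨⟨_, represents_modeSum_polarModes (R.mem_modes (by simp)) (R.mem_modes (by simp)) p,
      h.1⟩, h.2⟩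
  · refine injective_fderiv_polarModes hp₁ hp₂ (hfam p hp).differentiableAt hr₁ hr₂ ?_
    have hopen : ∀ᶠ q : (ℝ × ℝ) × (ℝ × ℝ) in 𝓝 p, ‖q.1‖ < ε :=
      (continuous_fst.norm.continuousAt.eventually_lt continuousAt_const hp)
    filter_upwards [hopen] with q hq using hcoeff _ (hnorm hq)
  · have hiff : polarModes k₁ k₂ p = polarModes k₁ k₂ p' ↔ p.1 = p'.1 ∧
        (∃ a : ℤ, (p.2.1 - p'.2.1) * k₁ = a * (2 * Real.pi)) ∧
          ∃ b : ℤ, (p.2.2 - p'.2.2) * k₂ = b * (2 * Real.pi) := by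
      rw [polarModes, polarModes, Prod.mk.injEq, polarMode_eq_iff h₁ h₁', polarMode_eq_iff h₂ h₂',
        Prod.ext_iff]
      tauto
    rw [← hiff]
    constructor
    · intro h
      have hW := congrArg Prod.fst h
      simp only at hW
      -- Equal functions have equal Fourier coefficients at `k₁` and `k₂`, hence equal amplitudes.
      obtain ⟨e1, e2⟩ := hcoeff _ (hnorm hp)
      obtain ⟨e1', e2'⟩ := hcoeff _ (hnorm hp')
      rw [hW] at e1 e2
      refine Prod.ext ?_ ?_
      · linear_combination 2 * (e1' - e1)
      · linear_combination 2 * (e2' - e2)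
    · intro h
      simp only [h]
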